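/- **Theorem 2.1.** Let $p\ge 1$ be an integer and let $V\in C^{2p+3}(\mathbb R;\mathbb R)$ be such that $V^{(n)}\in L^\infty(\mathbb R)$ for all $2\le n\le 2p+3$. Let $\Phi_k(y)=(2^kk!)^{-1/2}\omega(y)H_k(y)$, $k\ge0$, be the orthonormal Hermite functions of $L^2(\mathbb R)$, with $\omega(y)=\pi^{-1/4}e^{-y^2/2}$ and $H_k=(-1)^k\omega^{-2}\partial_y^k\omega^2$, and for $f\in L^2(\mathbb R^2)$ write $f_k(x)=\int_{\mathbb R} f(x,y)\Phi_k(y)\,dy$. For $\hbar>0$ put $$W^\hbar(x,y)=\frac{V(x+\frac\hbar2y)-V(x-\frac\hbar2y)}{\hbar},\quad \mathcal E^\hbar(x,y)=W^\hbar(x,y)-V'(x)\,y,\quad \mathcal E^\hbar_{k,l}(x)=\int_{\mathbb R}\mathcal E^\hbar(x,y)\Phi_k(y)\Phi_l(y)\,dy,$$ and $\mathcal D u=\partial_xu+V'u$, $\mathcal D^\star u=-\partial_xu+V'u$. For initial data $R^{in},\hat R^{in}\in L^2(\mathbb R^2;\mathbb C)$, let $R,\hat R\in C([0,\infty);L^2(\mathbb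 R^2;\mathbb C))$ be weak solutions (tested against $C_c^\infty(\mathbb R^2)$) of the von Neumann equation in Weyl's variables and of its semiclassical limit, $$\partial_tR=i\,\partial_x\partial_yR-i\,W^\hbar(x,y)\,R,\quad R(0)=R^{in};\qquad \partial_t\hat R=i\,\partial_x\partial_y\hat R-i\,V'(x)\,y\,\hat R,\quad \hat R(0)=\hat R^{in}.$$ For $N\ge0$ let $R^N(t|x,y)=\sum_{k=0}^NR^N_k(t|x)\Phi_k(y)$, where the $R^N_k\in C([0,\infty);L^2(\mathbb R))$ solve, in the weak sense, for $0\le k\le N$, $$\partial_tR^N_k+i\Big(\sqrt{\tfrac k2}\,\mathcal D R^N_{k-1}+\sqrt{\tfrac{k+1}2}\,\mathcal D^\star R^N_{k+1}\Big)=-i\sum_{l=0}^N\mathcal E^\hbar_{k,l}R^N_l,\qquad R^N_k(0)=R^{in}_k,\qquad R^N_{-1}=R^N_{N+1}=0,$$ and let $\hat R^N=\sum_{k=0}^N\hat R^N_k\Phi_k$, where the $\hat R^N_k$ solve the same system with right-hand side $0$ and initial data $\hat R^{in}_k$. Then the following holds for all $M\ge0$. 1. For every $\hbar_0>0$ and $t\ge0$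 there is a constant $\mathcal C_t$, depending only on $t,p,V,M$ and $\hbar_0$, such that for all $\hbar\in(0,\hbar_0]$, all $N\ge0$ and all $R^{in}$ (which may depend on $\hbar$) with $\|x^a\partial_x^b\,y^\alpha\partial_y^\beta R^{in}\|_{L^2}\le M$ for all integers $a,b,\alpha,\beta\ge0$ with $a+b+\alpha+\beta\le2(p+1)$ (weak derivatives), $$\|R^N(t)-R(t)\|_{L^2(\mathbb R^2)}\le\frac{\mathcal C_t}{(2N+3)^{p-1/2}}\,(1+\hbar^2).$$ 2. For every $t\ge0$ there is a constant $\mathcal C_t$, depending only on $t,p,V$ and $M$, such that for all $N\ge0$ and all $\hat R^{in}$ satisfying the same bounds by $M$, $$\|\hat R(t)-\hat R^N(t)\|_{L^2(\mathbb R^2)}\le\frac{\mathcal C_t}{(2N+3)^{p-1/2}}.$$ -/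

import Mathlib

open MeasureTheory Set
open scoped ContDiff NNReal

noncomputable section

namespace WeylHermite

/-- The space `L²(ℝ; ℂ)` in the variable `x`. -/
abbrev L2x : Type := Lp ℂ 2 (volume : Measure ℝ)

/-- The space `L²(ℝ × ℝ; ℂ)` in the variables `(x, y)`. -/
abbrev L2xy : Type := Lp ℂ 2 (volume : Measure (ℝ × ℝ))

/-- Test functions: smooth and compactly supported, with complex values. -/
def IsTest {E : Type*} [NormedAddCommGroup E] [NormedSpace ℝ E] (φ : E → ℂ) : Prop :=
  ContDiff ℝ ∞ φ ∧ HasCompactSupport φ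

/-- The classical partial derivative `∂ₓ^b ∂_y^β φ` of a smooth function on `ℝ × ℝ`. -/
def partialXY (b β : ℕ) (φ : ℝ × ℝ → ℂ) (z : ℝ × ℝ) : ℂ :=
  iteratedDeriv b (fun x => iteratedDeriv β (fun y => φ (x, y)) z.2) z.1

/-- `g` is the weak partial derivative `∂ₓ^b ∂_y^β f`. -/
def IsWeakPartial (b β : ℕ) (f g : L2xy) : Prop :=
  ∀ φ : ℝ × ℝ → ℂ, IsTest φ →
    ∫ z, f z * partialXY b β φ z = (-1 : ℂ) ^ (b + β) * ∫ z, g z * φ z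

/-- For all `a + b + α + β ≤ m` one has `‖x^a ∂ₓ^b y^α ∂_y^β f‖_{L²} ≤ M`
(the multiplication by `y^α` commutes with `∂ₓ^b`). -/
def WeightedSobolevBound (m : ℕ) (M : ℝ≥0) (f : L2xy) : Prop :=
  ∀ b β : ℕ, b + β ≤ m → ∃ g : L2xy, IsWeakPartial b β f g ∧
    ∀ a α : ℕ, a + b + α + β ≤ m →
      eLpNorm (fun z : ℝ × ℝ => (z.1 : ℂ) ^ a * (z.2 : ℂ) ^ α * g z) 2 volume ≤ M

/-- Hypotheses on the potential: `V ∈ C^{m+1}(ℝ)` and `V^{(n)}` is bounded for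
`n = 2, …, m + 1`. -/
def IsAdmissiblePotential (m : ℕ) (V : ℝ → ℝ) : Prop :=
  ContDiff ℝ ((m + 1 : ℕ) : WithTop ℕ∞) V ∧
    ∀ n : ℕ, 2 ≤ n → n ≤ m + 1 → ∃ B : ℝ, ∀ x : ℝ, |iteratedDeriv n V x| ≤ B

/-- The potential term `(V(x + ħy/2) - V(x - ħy/2)) / ħ` of the von Neumann equation. -/
def weylPotential (V : ℝ → ℝ) (hbar : ℝ) (x y : ℝ) : ℝ :=
  (V (x + hbar / 2 * y) - V (x - hbar / 2 * y)) / hbar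

/-- The potential term `V'(x) y` of the semiclassical limit equation. -/
def limitPotential (V : ℝ → ℝ) (x y : ℝ) : ℝ := deriv V x * y

/-- `R ∈ C([0, ∞); L²(ℝ²))` is the (weak) solution of
`∂ₜ R = i ∂ₓ ∂_y R - i U(x, y) R`, `R(0) = Rin`. -/
structure IsWeylSolution (U : ℝ → ℝ → ℝ) (Rin : L2xy) (R : ℝ → L2xy) : Prop where
  continuousOn : ContinuousOn R (Ici 0)
  initial : R 0 = Rin
  weak_eq : ∀ φ : ℝ × ℝ → ℂ, IsTest φ → ∀ t : ℝ, 0 ≤ t →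
    HasDerivWithinAt (fun s => ∫ z, R s z * φ z)
      (∫ z : ℝ × ℝ, R t z *
        (Complex.I * partialXY 1 1 φ z - Complex.I * (U z.1 z.2 : ℂ) * φ z))
      (Ici 0) t

/-- Solutions of the von Neumann equation in Weyl's variables. -/
def IsVonNeumannSolution (V : ℝ → ℝ) (hbar : ℝ) : L2xy → (ℝ → L2xy) → Prop :=
  IsWeylSolution (weylPotential V hbar)

/-- Solutions of the semiclassical limit equation. -/
def IsLimitSolution (V : ℝ → ℝ) : L2xy → (ℝ → L2xy) → Prop :=
  IsWeylSolution (limitPotential V)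

/-- The weight `ω(y) = π^{-1/4} e^{-y²/2}`. -/
def gaussWeight (y : ℝ) : ℝ := Real.pi ^ (-(1 / 4) : ℝ) * Real.exp (-y ^ 2 / 2)

/-- The physicists' Hermite polynomials `H_k = (-1)^k ω^{-2} ∂_y^k ω²`. -/
def hermiteH (k : ℕ) (y : ℝ) : ℝ :=
  (-1) ^ k * (gaussWeight y ^ 2)⁻¹ * iteratedDeriv k (fun s => gaussWeight s ^ 2) y

/-- The Hermite functions `Φ_k = (2^k k!)^{-1/2} ω H_k`. -/
def hermiteFn (k : ℕ) (y : ℝ) : ℝ :=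
  (Real.sqrt (2 ^ k * (k.factorial : ℝ)))⁻¹ * gaussWeight y * hermiteH k y

/-- The `k`-th Hermite coefficient in `y`: `f_k(x) = ∫ f(x, y) Φ_k(y) dy`. -/
def hermiteCoeff (f : L2xy) (k : ℕ) (x : ℝ) : ℂ := ∫ y : ℝ, f (x, y) * (hermiteFn k y : ℂ)

/-- `𝓔^ħ(x, y) = (V(x + ħy/2) - V(x - ħy/2)) / ħ - V'(x) y`. -/
def weylRemainder (V : ℝ → ℝ) (hbar : ℝ) (x y : ℝ) : ℝ :=
  weylPotential V hbar x y - limitPotential V x y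

/-- `𝓔^ħ_{k,l}(x) = ∫ 𝓔^ħ(x, y) Φ_k(y) Φ_l(y) dy`. -/
def weylRemainderCoeff (V : ℝ → ℝ) (hbar : ℝ) (k l : ℕ) (x : ℝ) : ℝ :=
  ∫ y : ℝ, weylRemainder V hbar x y * hermiteFn k y * hermiteFn l y

/-- `𝓓 φ = φ' + V' φ`. -/
def opD (V : ℝ → ℝ) (φ : ℝ → ℂ) (x : ℝ) : ℂ := deriv φ x + ((deriv V x : ℝ) : ℂ) * φ x

/-- `𝓓* φ = -φ' + V' φ`. -/
def opDStar (V : ℝ → ℝ) (φ : ℝ → ℂ) (x : ℝ) : ℂ := -deriv φ x + ((deriv V x : ℝ) : ℂ) * φ x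

/-- `r = (r_k)` is the (weak) solution, with components in `C([0, ∞); L²(ℝ))`, of the truncated
Hermite system, for `0 ≤ k ≤ N`,
`∂ₜ r_k + i (√(k/2) 𝓓 r_{k-1} + √((k+1)/2) 𝓓* r_{k+1}) = -i ∑_{l ≤ N} e_{k,l} r_l`,
with `r_k(0)` the `k`-th Hermite coefficient of `Rin` and `r_{-1} = r_{N+1} = 0`.
Components are indexed by `ℕ` and vanish beyond `N`. For `k = 0` the natural number `k - 1`
is `0`, but the term that contains it is multiplied by `√(0/2) = 0`, as `r_{-1} = 0` requires.
In the weak form, `𝓓` and `𝓓*` are moved to the test function and exchange their roles. -/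
structure IsTruncatedSolution (V : ℝ → ℝ) (e : ℕ → ℕ → ℝ → ℝ) (N : ℕ) (Rin : L2xy)
    (r : ℝ → ℕ → L2x) : Prop where
  continuousOn : ∀ k : ℕ, k ≤ N → ContinuousOn (fun t => r t k) (Ici 0)
  initial : ∀ k : ℕ, k ≤ N → (r 0 k : ℝ → ℂ) =ᵐ[volume] hermiteCoeff Rin k
  truncated : ∀ t : ℝ, 0 ≤ t → ∀ k : ℕ, N < k → r t k = 0
  weak_eq : ∀ k : ℕ, k ≤ N → ∀ φ : ℝ → ℂ, IsTest φ → ∀ t : ℝ, 0 ≤ t →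
    HasDerivWithinAt (fun s => ∫ x, r s k x * φ x)
      (∫ x : ℝ,
        (-Complex.I * ((Real.sqrt ((k : ℝ) / 2) : ℂ) * (r t (k - 1) x * opDStar V φ x)
            + (Real.sqrt (((k : ℝ) + 1) / 2) : ℂ) * (r t (k + 1) x * opD V φ x))
          - Complex.I * ∑ l ∈ Finset.range (N + 1), (e k l x : ℂ) * r t l x * φ x))
      (Ici 0) t

/-- Solutions `R^N` of the Hermite–Galerkin truncation of the von Neumann equation. -/
def IsTruncatedVonNeumannSolution (V : ℝ → ℝ) (hbar : ℝ) (N : ℕ) :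
    L2xy → (ℝ → ℕ → L2x) → Prop :=
  IsTruncatedSolution V (weylRemainderCoeff V hbar) N

/-- Solutions of the Hermite–Galerkin truncation of the limit equation (no remainder term). -/
def IsTruncatedLimitSolution (V : ℝ → ℝ) (N : ℕ) : L2xy → (ℝ → ℕ → L2x) → Prop :=
  IsTruncatedSolution V (fun _ _ _ => 0) N

/-- The function `(x, y) ↦ ∑_{k ≤ N} r_k(x) Φ_k(y)`. -/
def hermiteSum (N : ℕ) (r : ℕ → L2x) (z : ℝ × ℝ) : ℂ :=
  ∑ k ∈ Finset.range (N + 1), r k z.1 * (hermiteFn k z.2 : ℂ)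

end WeylHermite

end

/-! Both evolution equations have the form `∂ₜR = -iLR` with `L = -∂ₓ∂_y + U`, where `U` is the Weyl
potential or its limit `V'(x)y`. In the orthonormal basis `Φ_j(x)Φ_k(y)` of `L²(ℝ²)` the operator
`L` is a real symmetric matrix, `weylMat U`. By the Hermite recurrences the truncated system is the
compression of this matrix to the modes `k ≤ N` (`IsTruncatedSolution.hasDerivWithinAt_tensor`). The
theorem thus compares an `ℓ²`-conserving flow with one of its Galerkin truncations.

Regularity is measured by the weight `λ = j + k + 1`. Multiplication by `x` or `y` and one
derivative each cost `λ^{1/2}`. As `V''` is bounded, `U` grows at most quadratically, while `∇U` and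
its derivatives grow at most linearly, uniformly for `ħ ≤ ħ₀`. Hence `L` costs one power of `λ`. A
commutator with `λ` replaces `U` by `∇U` times a ladder operator, so `[λ^s, L]` costs no more than
`λ^s` itself (`exists_weylMat_bounds`), and a Gronwall argument propagates `∑ λ^{2s}|v|²`
(`IsGalerkin.weighted_le`). The assumption on the initial data bounds this sum at time 0 for `s = p
+ 1` (`WeightedSobolevBound.sum_lam_le`). The error of the truncation is driven by `L` applied to
modes with `λ ≥ N + 2`: of the `p + 1` available powers of `λ`, one pays for `L` and `p` give the
rate `N^{-p}` (`galerkin_compare`). This is half a power more than is claimed.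

These estimates concern finite matrices, whereas the given weak solutions are only continuous in
`L²`. `tendsto_galerkin` identifies them, mode by mode, with limits of finite Galerkin
approximations. It is a duality argument: the difference is paired with a backward Galerkin solution
that starts from a single mode, so that all the regularity is carried by the dual solution. To read
off the equations of the Hermite coefficients, the weak formulations are extended from compactly
supported test functions to Hermite functions by dominated approximation
(`hasDerivWithinAt_of_tendsto`, `IsPolyGauss.exists_approx`). The bounds do not depend on the size
of the finite box and pass to the limit. -/

noncomputable section

namespace WeylHermite

/-! ### Galerkin approximations for symmetric matrices with weighted bounds -/

section Galerkin

variable {ι : Type*}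

/-- The matrix `A` is bounded from `ℓ²` with squared weight `w` to `ℓ²`, with squared norm `C`. -/
def MatBound (A : ι → ι → ℝ) (w : ι → ℝ) (C : ℝ) : Prop :=
  ∀ (F F' : Finset ι) (v : ι → ℝ),
    ∑ i ∈ F', (∑ j ∈ F, A i j * v j) ^ 2 ≤ C * ∑ j ∈ F, w j * v j ^ 2

lemma MatBound.complex {A : ι → ι → ℝ} {w : ι → ℝ} {C : ℝ} (h : MatBound A w C)
    (F F' : Finset ι) (v : ι → ℂ) :
    ∑ i ∈ F', ‖∑ j ∈ F, (A i j : ℂ) * v j‖ ^ 2 ≤ C * ∑ j ∈ F, w j * ‖v j‖ ^ 2 := by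
  have h1 := h F F' (fun j => (v j).re)
  have h2 := h F F' (fun j => (v j).im)
  have e1 : ∀ i, ‖∑ j ∈ F, (A i j : ℂ) * v j‖ ^ 2 =
      (∑ j ∈ F, A i j * (v j).re) ^ 2 + (∑ j ∈ F, A i j * (v j).im) ^ 2 := by
    intro i
    rw [← Complex.normSq_eq_norm_sq, Complex.normSq_apply]
    simp [pow_two]
  have e2 : ∀ j, w j * ‖v j‖ ^ 2 = w j * (v j).re ^ 2 + w j * (v j).im ^ 2 := by
    intro j
    rw [← Complex.normSq_eq_norm_sq, Complex.normSq_apply]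
    ring
  simp only [e1, e2, Finset.sum_add_distrib, mul_add]
  exact add_le_add h1 h2

/-- `v` solves `v' = -i L v` on the finite set of modes `F`. -/
def IsGalerkin (L : ι → ι → ℝ) (F : Finset ι) (v : ℝ → ι → ℂ) : Prop :=
  ∀ t : ℝ, ∀ i ∈ F,
    HasDerivAt (fun s => v s i) (-Complex.I * ∑ j ∈ F, (L i j : ℂ) * v t j) t

lemma exists_isGalerkin (L : ι → ι → ℝ) (F : Finset ι) (v₀ : ι → ℂ) :
    ∃ v : ℝ → ι → ℂ, IsGalerkin L F v ∧ ∀ i ∈ F, v 0 i = v₀ i := by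
  classical
  let A₀ : (F → ℂ) →ₗ[ℂ] (F → ℂ) :=
    LinearMap.pi fun i => ∑ j : F, (-Complex.I * (L i j : ℂ)) • LinearMap.proj j
  let A : (F → ℂ) →L[ℂ] (F → ℂ) := LinearMap.toContinuousLinearMap A₀
  let x₀ : F → ℂ := fun i => v₀ i
  let u : ℝ → (F → ℂ) := fun t => (NormedSpace.exp (t • A)) x₀
  have hu : ∀ t, HasDerivAt u (A (u t)) t := by
    intro t
    have h : HasDerivAt (fun s : ℝ => NormedSpace.exp (s • A)) (A * NormedSpace.exp (t • A)) t :=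
      hasDerivAt_exp_smul_const' A t
    let ev : ((F → ℂ) →L[ℂ] (F → ℂ)) →L[ℝ] (F → ℂ) :=
      (ContinuousLinearMap.apply ℂ (F → ℂ) x₀).restrictScalars ℝ
    exact ev.hasFDerivAt.comp_hasDerivAt t h
  refine ⟨fun t i => if h : i ∈ F then u t ⟨i, h⟩ else 0, ?_, ?_⟩
  · intro t i hi
    have h := (hasDerivAt_pi.1 (hu t)) ⟨i, hi⟩
    have e : (fun s => if h : i ∈ F then u s ⟨i, h⟩ else 0) = fun s => u s ⟨i, hi⟩ := by
      funext s; rw [dif_pos hi]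
    rw [e]
    refine h.congr_deriv ?_
    simp only [A, A₀, LinearMap.coe_toContinuousLinearMap', LinearMap.pi_apply,
      LinearMap.sum_apply, LinearMap.smul_apply, LinearMap.proj_apply, smul_eq_mul]
    rw [Finset.mul_sum, ← Finset.sum_attach F, Finset.univ_eq_attach]
    refine Finset.sum_congr rfl fun j _ => ?_
    simp [mul_assoc]
  · intro i hi
    have e : NormedSpace.exp ((0 : ℝ) • A) = 1 := by
      rw [zero_smul ℝ A]; exact NormedSpace.exp_zero
    simp only [hi, u, x₀, dif_pos, e]
    rfl

lemma gronwall_affine {E E' : ℝ → ℝ} {a b : ℝ} (ha : 0 ≤ a) (hb : 0 ≤ b)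
    (hE : ∀ t, HasDerivAt E (E' t) t) {t : ℝ} (ht : 0 ≤ t)
    (hle : ∀ s ∈ Icc 0 t, E' s ≤ a * E s + b) : E t ≤ Real.exp (a * t) * (E 0 + b * t) := by
  -- The derivative of `exp(-as) E(s)` is at most `b exp(-as) ≤ b`, so `G` is nonincreasing.
  let G : ℝ → ℝ := fun s => Real.exp (-(a * s)) * E s - b * s
  have hG : ∀ s, HasDerivAt G
      (Real.exp (-(a * s)) * (-(a * 1)) * E s + Real.exp (-(a * s)) * E' s - b * 1) s := by
    intro s
    exact (((((hasDerivAt_id s).const_mul a).neg).exp).mul (hE s)).sub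
      ((hasDerivAt_id s).const_mul b)
  have hanti : AntitoneOn G (Icc 0 t) := by
    refine antitoneOn_of_deriv_nonpos (convex_Icc 0 t)
      (fun s _ => (hG s).continuousAt.continuousWithinAt)
      (fun s _ => (hG s).differentiableAt.differentiableWithinAt) ?_
    intro s hs
    rw [interior_Icc] at hs
    rw [(hG s).deriv]
    have h1 := hle s ⟨hs.1.le, hs.2.le⟩
    have h2 : Real.exp (-(a * s)) ≤ 1 :=
      Real.exp_le_one_iff.2 (by have := mul_nonneg ha hs.1.le; linarith)
    have h3 := Real.exp_pos (-(a * s))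
    nlinarith [mul_le_mul_of_nonneg_left h1 h3.le, mul_le_mul_of_nonneg_right h2 hb]
  have h := hanti (left_mem_Icc.2 ht) (right_mem_Icc.2 ht) ht
  simp only [G, mul_zero, neg_zero, Real.exp_zero, one_mul, sub_zero] at h
  have h4 : E t = Real.exp (a * t) * (Real.exp (-(a * t)) * E t) := by
    rw [← mul_assoc, ← Real.exp_add]; simp
  rw [h4]
  exact mul_le_mul_of_nonneg_left (by linarith) (Real.exp_pos _).le

/-- The quadratic form of a real symmetric matrix is real, so `-i` times it is imaginary. This is
the conservation of the `ℓ²` norm by the flow of `-iL`. -/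
lemma re_symm_form {L : ι → ι → ℝ} (hL : ∀ i j, L i j = L j i) (F : Finset ι) (w : ι → ℂ) :
    ∑ i ∈ F, ((starRingEnd ℂ) (w i) * (-Complex.I * ∑ j ∈ F, (L i j : ℂ) * w j)).re = 0 := by
  have h : (starRingEnd ℂ) (∑ i ∈ F, ∑ j ∈ F, (starRingEnd ℂ) (w i) * (L i j : ℂ) * w j) =
      ∑ i ∈ F, ∑ j ∈ F, (starRingEnd ℂ) (w i) * (L i j : ℂ) * w j := by
    simp only [map_sum, map_mul, Complex.conj_conj, Complex.conj_ofReal]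
    rw [Finset.sum_comm]
    refine Finset.sum_congr rfl fun i _ => Finset.sum_congr rfl fun j _ => ?_
    rw [hL]; ring
  have h2 := Complex.conj_eq_iff_im.1 h
  rw [← Complex.re_sum]
  have h3 : ∑ i ∈ F, (starRingEnd ℂ) (w i) * (-Complex.I * ∑ j ∈ F, (L i j : ℂ) * w j) =
      -Complex.I * ∑ i ∈ F, ∑ j ∈ F, (starRingEnd ℂ) (w i) * (L i j : ℂ) * w j := by
    simp only [Finset.mul_sum]
    refine Finset.sum_congr rfl fun i _ => Finset.sum_congr rfl fun j _ => ?_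
    ring
  rw [h3, Complex.mul_re]
  simp [h2]

/-- `L` drops out of the energy balance by `re_symm_form`. The source contributes `2⟨w, g⟩ ≤ ‖w‖² +
‖g‖²`, whence the rate `1 + a`; no bound on `L` itself enters. -/
lemma energy_estimate {L : ι → ι → ℝ} (hL : ∀ i j, L i j = L j i) {F : Finset ι}
    {w g : ℝ → ι → ℂ} {a b : ℝ} (ha : 0 ≤ a) (hb : 0 ≤ b)
    (hw : ∀ t, ∀ i ∈ F, HasDerivAt (fun s => w s i)
      (-Complex.I * ∑ j ∈ F, (L i j : ℂ) * w t j + g t i) t)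
    {t : ℝ} (ht : 0 ≤ t)
    (hg : ∀ s ∈ Icc 0 t, ∑ i ∈ F, ‖g s i‖ ^ 2 ≤ a * ∑ i ∈ F, ‖w s i‖ ^ 2 + b) :
    ∑ i ∈ F, ‖w t i‖ ^ 2 ≤ Real.exp ((1 + a) * t) * (∑ i ∈ F, ‖w 0 i‖ ^ 2 + b * t) := by
  refine gronwall_affine (E := fun t => ∑ i ∈ F, ‖w t i‖ ^ 2)
    (E' := fun t => ∑ i ∈ F, 2 * inner ℝ (w t i)
      (-Complex.I * ∑ j ∈ F, (L i j : ℂ) * w t j + g t i)) (by linarith) hb ?_ ht ?_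
  · intro t
    exact HasDerivAt.fun_sum fun i hi => (hw t i hi).norm_sq
  · intro t ht
    have h1 : ∀ i, 2 * inner ℝ (w t i) (-Complex.I * ∑ j ∈ F, (L i j : ℂ) * w t j + g t i) ≤
        2 * ((starRingEnd ℂ) (w t i) * (-Complex.I * ∑ j ∈ F, (L i j : ℂ) * w t j)).re
          + (‖w t i‖ ^ 2 + ‖g t i‖ ^ 2) := by
      intro i
      rw [inner_add_right, mul_add]
      have h2 : inner ℝ (w t i) (g t i) ≤ ‖w t i‖ * ‖g t i‖ := real_inner_le_norm _ _
      have h3 : inner ℝ (w t i) (-Complex.I * ∑ j ∈ F, (L i j : ℂ) * w t j) =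
        ((starRingEnd ℂ) (w t i) * (-Complex.I * ∑ j ∈ F, (L i j : ℂ) * w t j)).re := by
        rw [Complex.inner, mul_comm]
      rw [h3]
      nlinarith [sq_nonneg (‖w t i‖ - ‖g t i‖)]
    refine (Finset.sum_le_sum fun i _ => h1 i).trans ?_
    rw [Finset.sum_add_distrib, ← Finset.mul_sum, re_symm_form hL, Finset.sum_add_distrib]
    have := hg t ht
    linarith

/-- The rescaled vector `λ^s v` solves the same equation with the source `-i[λ^s, L]v`, which `hs`
controls by `λ^s v` itself. The constant depends on `F` in no way, which is what later permits the
limit of large boxes. -/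
lemma IsGalerkin.weighted_le {L : ι → ι → ℝ} (hL : ∀ i j, L i j = L j i) {F : Finset ι}
    {v : ℝ → ι → ℂ} (hv : IsGalerkin L F v) {lam : ι → ℝ} {s : ℕ} {C : ℝ} (hC : 0 ≤ C)
    (hs : MatBound (fun i j => (lam i ^ s - lam j ^ s) * L i j) (fun j => lam j ^ (2 * s)) C)
    {t : ℝ} (ht : 0 ≤ t) :
    ∑ i ∈ F, lam i ^ (2 * s) * ‖v t i‖ ^ 2 ≤
      Real.exp ((1 + C) * t) * ∑ i ∈ F, lam i ^ (2 * s) * ‖v 0 i‖ ^ 2 := by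
  have e : ∀ t i, ‖((lam i ^ s : ℝ) : ℂ) * v t i‖ ^ 2 = lam i ^ (2 * s) * ‖v t i‖ ^ 2 := by
    intro t i
    rw [norm_mul, mul_pow, Complex.norm_real, Real.norm_eq_abs, sq_abs, ← pow_mul, mul_comm s]
  have h := energy_estimate hL (F := F) (w := fun t i => ((lam i ^ s : ℝ) : ℂ) * v t i)
    (g := fun t i => -Complex.I * ∑ j ∈ F, (((lam i ^ s - lam j ^ s) * L i j : ℝ) : ℂ) * v t j)
    (a := C) (b := 0) hC le_rfl ?_ ht ?_
  · simpa only [e, zero_mul, add_zero] using h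
  · intro t i hi
    refine ((hv t i hi).const_mul ((lam i ^ s : ℝ) : ℂ)).congr_deriv ?_
    symm
    rw [← mul_add, ← Finset.sum_add_distrib, mul_left_comm,
      Finset.mul_sum _ _ ((lam i ^ s : ℝ) : ℂ)]
    congr 1
    refine Finset.sum_congr rfl fun j _ => ?_
    push_cast
    ring
  · intro t _
    simp only [e, add_zero]
    simp only [norm_mul (-Complex.I), norm_neg, Complex.norm_I, one_mul]
    exact hs.complex F F (v t)

/-- Weak solutions of an infinite symmetric system are limits of Galerkin approximations. -/
lemma tendsto_galerkin {L : ι → ι → ℝ} (hL : ∀ i j, L i j = L j i) {lam : ι → ℝ}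
    {C₁ C₂ : ℝ} (hC₂ : 0 ≤ C₂)
    (h₁ : MatBound (fun i j => lam i * L i j) (fun j => lam j ^ (2 * 2)) C₁) (hC₁ : 0 ≤ C₁)
    (h₂ : MatBound (fun i j => (lam i ^ 2 - lam j ^ 2) * L i j) (fun j => lam j ^ (2 * 2)) C₂)
    {S : Set ι} {F : ℕ → Finset ι} (hFS : ∀ n, ∀ i ∈ F n, i ∈ S)
    (hF : ∀ n, ∀ i ∈ S, i ∉ F n → (n : ℝ) ≤ lam i)
    {c l : ℝ → ι → ℂ} (hc0 : ∀ t, 0 ≤ t → ∀ i ∉ S, c t i = 0)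
    (hderiv : ∀ i ∈ S, ∀ t, 0 ≤ t →
      HasDerivWithinAt (fun s => c s i) (-Complex.I * l t i) (Ici 0) t)
    (hsum : ∀ i ∈ S, ∀ t, 0 ≤ t → HasSum (fun j => (L i j : ℂ) * c t j) (l t i))
    {T B : ℝ} (hT : 0 ≤ T)
    (hB : ∀ t ∈ Icc 0 T, ∀ Q : Finset ι, ∑ i ∈ Q, ‖c t i‖ ^ 2 ≤ B)
    {v : ℕ → ℝ → ι → ℂ} (hv : ∀ n, IsGalerkin L (F n) (v n))
    (hv0 : ∀ n, ∀ i ∈ F n, v n 0 i = c 0 i) {i₀ : ι} (hi₀ : i₀ ∈ S) :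
    Filter.Tendsto (fun n => v n T i₀) Filter.atTop (nhds (c T i₀)) := by
  classical
  have hB0 : 0 ≤ B := by simpa using hB 0 (left_mem_Icc.2 hT) ∅
  -- Bound for the `λ⁴`-weighted square norm, up to time `T`, of the dual solution that starts from
  -- the unit vector at `i₀`.
  set W : ℝ := Real.exp ((1 + C₂) * T) * lam i₀ ^ (2 * 2) with hW
  have hlam4 : ∀ i, 0 ≤ lam i ^ (2 * 2) := fun i => by rw [pow_mul]; positivity
  have key : ∀ n : ℕ, lam i₀ < n → 0 < n →
      ‖c T i₀ - v n T i₀‖ ≤ (Real.sqrt (C₁ * W) * Real.sqrt B * T) * (1 / (n : ℝ)) := by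
    intro n hn hn0
    have hi₀F : i₀ ∈ F n := by
      by_contra hcon
      exact absurd (hF n i₀ hi₀ hcon) (not_le.2 hn)
    have hnpos : (0 : ℝ) < n := by exact_mod_cast hn0
    -- The dual solution isolates the mode `i₀`. It carries the regularity that is not known for
    -- `c`.
    obtain ⟨w, hw, hw0⟩ := exists_isGalerkin L (F n) (fun i => if i = i₀ then 1 else 0)
    have hwW : ∀ s ∈ Icc 0 T, ∑ i ∈ F n, lam i ^ (2 * 2) * ‖w s i‖ ^ 2 ≤ W := by
      intro s hs
      refine (hw.weighted_le hL hC₂ h₂ hs.1).trans ?_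
      have : ∑ i ∈ F n, lam i ^ (2 * 2) * ‖w 0 i‖ ^ 2 = lam i₀ ^ (2 * 2) := by
        rw [Finset.sum_eq_single i₀]
        · rw [hw0 i₀ hi₀F]; simp
        · intro i hi hne; rw [hw0 i hi]; simp [hne]
        · intro h; exact absurd hi₀F h
      rw [this, hW]
      refine mul_le_mul_of_nonneg_right (Real.exp_le_exp.2 ?_) (hlam4 _)
      exact mul_le_mul_of_nonneg_left hs.2 (by linarith)
    -- the defect of the truncation
    have defect : ∀ s ∈ Icc 0 T, ∀ u : ι → ℂ, ∑ i ∈ F n, lam i ^ (2 * 2) * ‖u i‖ ^ 2 ≤ W →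
        ‖∑ i ∈ F n, u i * (l s i - ∑ j ∈ F n, (L i j : ℂ) * c s j)‖ ≤
          Real.sqrt (C₁ * W) * Real.sqrt B * (1 / n) := by
      intro s hs u hu
      have hs1 : HasSum (fun j => ∑ i ∈ F n, u i * ((L i j : ℂ) * c s j))
          (∑ i ∈ F n, u i * l s i) :=
        hasSum_sum fun i hi => (hsum i (hFS n i hi) s hs.1).mul_left (u i)
      have hs2 : Filter.Tendsto (fun Q : Finset ι =>
          ‖∑ j ∈ Q, (∑ i ∈ F n, u i * ((L i j : ℂ) * c s j)) -
            ∑ j ∈ F n, (∑ i ∈ F n, u i * ((L i j : ℂ) * c s j))‖) Filter.atTop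
          (nhds ‖∑ i ∈ F n, u i * l s i -
            ∑ j ∈ F n, (∑ i ∈ F n, u i * ((L i j : ℂ) * c s j))‖) :=
        (hs1.sub_const _).norm
      have e : ∑ i ∈ F n, u i * (l s i - ∑ j ∈ F n, (L i j : ℂ) * c s j) =
          ∑ i ∈ F n, u i * l s i - ∑ j ∈ F n, (∑ i ∈ F n, u i * ((L i j : ℂ) * c s j)) := by
        rw [Finset.sum_comm (s := F n) (t := F n), ← Finset.sum_sub_distrib]
        refine Finset.sum_congr rfl fun i _ => ?_
        rw [mul_sub, Finset.mul_sum]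
      rw [e]
      refine le_of_tendsto hs2 ?_
      -- Once `Q` contains `F n`, the difference of the partial sums runs over the modes outside `F
      -- n` only.
      filter_upwards [Filter.eventually_ge_atTop (F n)] with Q hQ
      rw [← Finset.sum_sdiff hQ, add_sub_cancel_right]
      -- Outside `F n` either `c` vanishes or `λ_j ≥ n`. The second case yields the factor `1/n` at
      -- the price of a factor `λ_j`, which by symmetry falls on `L u` and is covered by `h₁`. On
      -- `c` only the `ℓ²` bound is used.
      have hterm : ∀ j ∈ Q \ F n, ‖∑ i ∈ F n, u i * ((L i j : ℂ) * c s j)‖ ≤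
          (‖∑ i ∈ F n, ((lam j * L j i : ℝ) : ℂ) * u i‖ * ‖c s j‖) * (1 / n) := by
        intro j hj
        have hj2 := (Finset.mem_sdiff.1 hj).2
        by_cases hjS : j ∈ S
        · have hl := hF n j hjS hj2
          have e2 : ∑ i ∈ F n, ((lam j * L j i : ℝ) : ℂ) * u i =
              (lam j : ℂ) * ∑ i ∈ F n, (L i j : ℂ) * u i := by
            rw [Finset.mul_sum]
            refine Finset.sum_congr rfl fun i _ => ?_
            rw [hL j i]; push_cast; ring
          have e3 : ∑ i ∈ F n, u i * ((L i j : ℂ) * c s j) =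
              (∑ i ∈ F n, (L i j : ℂ) * u i) * c s j := by
            rw [Finset.sum_mul]
            refine Finset.sum_congr rfl fun i _ => ?_
            ring
          rw [e2, e3, norm_mul, norm_mul, Complex.norm_real, Real.norm_eq_abs,
            abs_of_nonneg (hnpos.le.trans hl)]
          rw [mul_one_div, le_div_iff₀ hnpos]
          have := mul_le_mul_of_nonneg_right hl
            (mul_nonneg (norm_nonneg (∑ i ∈ F n, (L i j : ℂ) * u i)) (norm_nonneg (c s j)))
          nlinarith
        · simp [hc0 s hs.1 j hjS]
      refine (norm_sum_le_of_le _ hterm).trans ?_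
      rw [← Finset.sum_mul]
      refine mul_le_mul_of_nonneg_right ?_ (by positivity)
      refine (Real.sum_mul_le_sqrt_mul_sqrt _ _ _).trans ?_
      refine mul_le_mul (Real.sqrt_le_sqrt ?_) (Real.sqrt_le_sqrt (hB s hs _))
        (Real.sqrt_nonneg _) (Real.sqrt_nonneg _)
      exact (h₁.complex (F n) (Q \ F n) u).trans (mul_le_mul_of_nonneg_left hu hC₁)
    -- The pairing is bilinear, without conjugation: `w(T - s)` evolves by `+iL`, so the symmetry of
    -- `L` cancels everything in `P'` but the defect. At `s = 0` the pairing vanishes, at `s = T` it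
    -- is the error in the mode `i₀`.
    let P : ℝ → ℂ := fun s => ∑ i ∈ F n, (c s i - v n s i) * w (T - s) i
    have hP : ∀ s ∈ Icc 0 T, HasDerivWithinAt P
        (-Complex.I * ∑ i ∈ F n, w (T - s) i * (l s i - ∑ j ∈ F n, (L i j : ℂ) * c s j))
        (Icc 0 T) s := by
      intro s hs
      have hw' : ∀ i ∈ F n, HasDerivAt (fun s => w (T - s) i)
          (Complex.I * ∑ j ∈ F n, (L i j : ℂ) * w (T - s) j) s := by
        intro i hi
        have := HasDerivAt.scomp s (hw (T - s) i hi) ((hasDerivAt_id s).const_sub T)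
        refine this.congr_deriv ?_
        simp
      have hd : ∀ i ∈ F n, HasDerivWithinAt (fun s => (c s i - v n s i) * w (T - s) i)
          ((-Complex.I * l s i - -Complex.I * ∑ j ∈ F n, (L i j : ℂ) * v n s j) * w (T - s) i +
            (c s i - v n s i) * (Complex.I * ∑ j ∈ F n, (L i j : ℂ) * w (T - s) j))
          (Icc 0 T) s := by
        intro i hi
        exact (((hderiv i (hFS n i hi) s hs.1).mono Icc_subset_Ici_self).sub
          (hv n s i hi).hasDerivWithinAt).mul (hw' i hi).hasDerivWithinAt
      refine (HasDerivWithinAt.fun_sum hd).congr_deriv ?_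
      symm
      have hsw : ∑ i ∈ F n, (c s i - v n s i) * (∑ j ∈ F n, (L i j : ℂ) * w (T - s) j) =
          ∑ i ∈ F n, w (T - s) i * ∑ j ∈ F n, (L i j : ℂ) * (c s j - v n s j) := by
        simp only [Finset.mul_sum]
        rw [Finset.sum_comm]
        refine Finset.sum_congr rfl fun i _ => Finset.sum_congr rfl fun j _ => ?_
        rw [hL]; ring
      have hsw2 : ∑ i ∈ F n, (c s i - v n s i) *
          (Complex.I * ∑ j ∈ F n, (L i j : ℂ) * w (T - s) j) =
          Complex.I * ∑ i ∈ F n, w (T - s) i * ∑ j ∈ F n, (L i j : ℂ) * (c s j - v n s j) := by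
        rw [← hsw, Finset.mul_sum]
        refine Finset.sum_congr rfl fun i _ => ?_
        ring
      rw [Finset.sum_add_distrib, hsw2, Finset.mul_sum, Finset.mul_sum, ← Finset.sum_add_distrib]
      refine Finset.sum_congr rfl fun i _ => ?_
      simp only [mul_sub, Finset.sum_sub_distrib]
      ring
    have hP0 : P 0 = 0 :=
      Finset.sum_eq_zero fun i hi => by rw [hv0 n i hi, sub_self, zero_mul]
    have hPT : P T = c T i₀ - v n T i₀ := by
      simp only [P, sub_self]
      rw [Finset.sum_eq_single i₀]
      · rw [hw0 i₀ hi₀F]; simp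
      · intro i hi hne; rw [hw0 i hi]; simp [hne]
      · intro h; exact absurd hi₀F h
    have hmv := (convex_Icc 0 T).norm_image_sub_le_of_norm_hasDerivWithin_le hP
      (C := Real.sqrt (C₁ * W) * Real.sqrt B * (1 / n)) ?_ (left_mem_Icc.2 hT) (right_mem_Icc.2 hT)
    · rw [hP0, hPT, sub_zero, sub_zero, Real.norm_eq_abs, abs_of_nonneg hT] at hmv
      linarith
    · intro s hs
      rw [norm_mul, norm_neg, Complex.norm_I, one_mul]
      exact defect s hs _ (hwW (T - s) ⟨by linarith [hs.2], by linarith [hs.1]⟩)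
  rw [tendsto_iff_norm_sub_tendsto_zero]
  have hlim : Filter.Tendsto (fun n : ℕ => (Real.sqrt (C₁ * W) * Real.sqrt B * T) * (1 / (n : ℝ)))
      Filter.atTop (nhds 0) := by
    simpa using tendsto_one_div_atTop_nhds_zero_nat.const_mul (Real.sqrt (C₁ * W) * Real.sqrt B * T)
  refine squeeze_zero' (Filter.Eventually.of_forall fun n => norm_nonneg _) ?_ hlim
  obtain ⟨n₀, hn₀⟩ := exists_nat_gt (lam i₀)
  filter_upwards [Filter.eventually_ge_atTop (n₀ + 1)] with n hn
  rw [norm_sub_rev]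
  exact key n (hn₀.trans_le (by exact_mod_cast (by omega : n₀ ≤ n))) (by omega)

/-- Comparison of the Galerkin approximations with and without a spectral cutoff `S`. -/
lemma galerkin_compare [DecidableEq ι] {L : ι → ι → ℝ} (hL : ∀ i j, L i j = L j i)
    {lam : ι → ℝ} {C : ℝ} (hC : 0 ≤ C) {p : ℕ} (h₀ : MatBound L (fun j => lam j ^ 2) C)
    (h₁ : MatBound (fun i j => (lam i ^ (p + 1) - lam j ^ (p + 1)) * L i j)
      (fun j => lam j ^ (2 * (p + 1))) C)
    {Q F : Finset ι} (hFQ : F ⊆ Q) {Λ : ℝ} (hΛ : 1 ≤ Λ) (hS : ∀ i ∈ Q, i ∉ F → Λ ≤ lam i)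
    {v r : ℝ → ι → ℂ} (hv : IsGalerkin L Q v) (hr : IsGalerkin L F r)
    (h0 : ∀ i ∈ F, r 0 i = v 0 i) {B : ℝ}
    (hB : ∑ i ∈ Q, lam i ^ (2 * (p + 1)) * ‖v 0 i‖ ^ 2 ≤ B) {t : ℝ} (ht : 0 ≤ t) :
    ∑ i ∈ F, ‖r t i - v t i‖ ^ 2 + ∑ i ∈ Q with i ∉ F, ‖v t i‖ ^ 2 ≤
      Real.exp ((2 + C) * t) * (B * (1 + C * t)) / Λ ^ (2 * p) := by
  have hΛ0 : 0 < Λ := by linarith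
  have hpw : ∀ i, 0 ≤ lam i ^ (2 * (p + 1)) := fun i => by rw [pow_mul]; positivity
  have hB0 : 0 ≤ B := le_trans
    (Finset.sum_nonneg fun i _ => mul_nonneg (hpw i) (by positivity)) hB
  have hprop : ∀ s ∈ Icc 0 t, ∑ i ∈ Q, lam i ^ (2 * (p + 1)) * ‖v s i‖ ^ 2 ≤
      Real.exp ((1 + C) * t) * B := by
    intro s hs
    refine (hv.weighted_le hL hC h₁ hs.1).trans ?_
    have : Real.exp ((1 + C) * s) ≤ Real.exp ((1 + C) * t) :=
      Real.exp_le_exp.2 (mul_le_mul_of_nonneg_left hs.2 (by linarith))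
    exact mul_le_mul this hB
      (Finset.sum_nonneg fun i _ => mul_nonneg (hpw i) (by positivity)) (Real.exp_pos _).le
  set D : ℝ := Real.exp ((1 + C) * t) * B with hD
  have hD0 : 0 ≤ D := by positivity
  -- Of the weight `λ^{2(p+1)}`, the part `λ^{2p}` is traded for `Λ^{-2p}`. The part `λ²` is kept
  -- because it is what `h₀` requires.
  have htail : ∀ s ∈ Icc 0 t, ∑ i ∈ Q with i ∉ F, lam i ^ 2 * ‖v s i‖ ^ 2 ≤ D / Λ ^ (2 * p) := by
    intro s hs
    rw [le_div_iff₀ (by positivity), Finset.sum_mul]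
    refine le_trans ?_ (hprop s hs)
    refine (Finset.sum_le_sum (g := fun i => lam i ^ (2 * (p + 1)) * ‖v s i‖ ^ 2) ?_).trans
      (Finset.sum_le_sum_of_subset_of_nonneg (Finset.filter_subset _ _)
        fun i _ _ => mul_nonneg (hpw i) (by positivity))
    intro i hi
    obtain ⟨hiQ, hiF⟩ := Finset.mem_filter.1 hi
    have h1 : Λ ^ (2 * p) ≤ lam i ^ (2 * p) := pow_le_pow_left₀ hΛ0.le (hS i hiQ hiF) _
    have h2 : lam i ^ (2 * (p + 1)) = lam i ^ (2 * p) * lam i ^ 2 := by ring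
    rw [h2]
    have h3 : 0 ≤ lam i ^ 2 * ‖v s i‖ ^ 2 := by positivity
    nlinarith [mul_le_mul_of_nonneg_right h1 h3]
  have htail0 : ∑ i ∈ Q with i ∉ F, ‖v t i‖ ^ 2 ≤ D / Λ ^ (2 * p) := by
    refine le_trans (Finset.sum_le_sum fun i hi => ?_) (htail t (right_mem_Icc.2 ht))
    obtain ⟨hiQ, hiF⟩ := Finset.mem_filter.1 hi
    have h1 : 1 ≤ lam i ^ 2 := one_le_pow₀ (hΛ.trans (hS i hiQ hiF))
    nlinarith [sq_nonneg ‖v t i‖]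
  have hdiff : ∑ i ∈ F, ‖r t i - v t i‖ ^ 2 ≤
      Real.exp (1 * t) * (0 + C * (D / Λ ^ (2 * p)) * t) := by
    let w : ℝ → ι → ℂ := fun s i => r s i - v s i
    let g : ℝ → ι → ℂ := fun s i => Complex.I * ∑ j ∈ Q with j ∉ F, (L i j : ℂ) * v s j
    have hw : ∀ s, ∀ i ∈ F, HasDerivAt (fun s => w s i)
        (-Complex.I * ∑ j ∈ F, (L i j : ℂ) * w s j + g s i) s := by
      intro s i hi
      refine ((hr s i hi).sub (hv s i (hFQ hi))).congr_deriv ?_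
      symm
      have e : ∑ j ∈ Q, (L i j : ℂ) * v s j =
          ∑ j ∈ F, (L i j : ℂ) * v s j + ∑ j ∈ Q with j ∉ F, (L i j : ℂ) * v s j := by
        rw [← Finset.sum_filter_add_sum_filter_not Q (fun j => j ∈ F)]
        congr 1
        refine Finset.sum_congr ?_ fun _ _ => rfl
        ext j
        simp only [Finset.mem_filter]
        exact ⟨fun h => h.2, fun h => ⟨hFQ h, h⟩⟩
      simp only [e, w, g, mul_sub, Finset.sum_sub_distrib]
      ring
    have hgb : ∀ s ∈ Icc 0 t, ∑ i ∈ F, ‖g s i‖ ^ 2 ≤ C * (D / Λ ^ (2 * p)) := by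
      intro s hs
      simp only [g, norm_mul, Complex.norm_I, one_mul]
      exact (h₀.complex _ F (v s)).trans (mul_le_mul_of_nonneg_left (htail s hs) hC)
    have hw0 : ∀ i ∈ F, w 0 i = 0 := fun i hi => by simp [w, h0 i hi]
    have h := energy_estimate hL (a := 0) (b := C * (D / Λ ^ (2 * p))) le_rfl (by positivity) hw ht
      (fun s hs => by rw [zero_mul, zero_add]; exact hgb s hs)
    rw [add_zero] at h
    refine h.trans (le_of_eq ?_)
    rw [Finset.sum_eq_zero (s := F)]
    intro i hi
    rw [hw0 i hi]; simp
  have : Real.exp ((2 + C) * t) * (B * (1 + C * t)) / Λ ^ (2 * p) =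
      Real.exp (1 * t) * (0 + C * (D / Λ ^ (2 * p)) * t) +
        Real.exp (1 * t) * (D / Λ ^ (2 * p)) := by
    rw [hD, show (2 + C) * t = 1 * t + (1 + C) * t by ring, Real.exp_add]
    ring
  rw [this]
  refine add_le_add hdiff (htail0.trans ?_)
  have h1 : 1 ≤ Real.exp (1 * t) := Real.one_le_exp (by linarith)
  have : 0 ≤ D / Λ ^ (2 * p) := by positivity
  nlinarith

end Galerkin

/-! ### Hermite functions of one variable -/

/-- Products of a polynomial and the Gaussian weight `e^{-x²/2}`. -/
def IsPolyGauss (f : ℝ → ℝ) : Prop :=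
  ∃ P : Polynomial ℝ, f = fun x => P.eval x * Real.exp (-x ^ 2 / 2)

lemma hasDerivAt_gauss (x : ℝ) :
    HasDerivAt (fun x : ℝ => Real.exp (-x ^ 2 / 2)) (-x * Real.exp (-x ^ 2 / 2)) x := by
  have h : HasDerivAt (fun x : ℝ => -x ^ 2 / 2) (-x) x := by
    refine (((hasDerivAt_pow 2 x).neg).div_const 2).congr_deriv ?_
    simp only [Nat.cast_ofNat, Nat.add_one_sub_one, pow_one]
    ring
  exact h.exp.congr_deriv (mul_comm _ _)

namespace IsPolyGauss

lemma exists_hasDerivAt {f : ℝ → ℝ} (hf : IsPolyGauss f) :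
    ∃ f', IsPolyGauss f' ∧ ∀ x, HasDerivAt f (f' x) x := by
  obtain ⟨P, rfl⟩ := hf
  refine ⟨_, ⟨P.derivative - Polynomial.X * P, rfl⟩, fun x => ?_⟩
  refine ((P.hasDerivAt x).mul (hasDerivAt_gauss x)).congr_deriv ?_
  simp only [Polynomial.eval_sub, Polynomial.eval_mul, Polynomial.eval_X]
  ring

lemma deriv {f : ℝ → ℝ} (hf : IsPolyGauss f) : IsPolyGauss (deriv f) := by
  obtain ⟨f', hf', h⟩ := hf.exists_hasDerivAt
  rwa [show _root_.deriv f = f' from funext fun x => (h x).deriv]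

lemma differentiable {f : ℝ → ℝ} (hf : IsPolyGauss f) : Differentiable ℝ f := by
  obtain ⟨f', _, h⟩ := hf.exists_hasDerivAt
  exact fun x => (h x).differentiableAt

lemma contDiff {f : ℝ → ℝ} (hf : IsPolyGauss f) : ContDiff ℝ ∞ f := by
  obtain ⟨P, rfl⟩ := hf
  have : ContDiff ℝ ∞ fun x : ℝ => P.eval x := by
    simpa only [Polynomial.coe_aeval_eq_eval] using P.contDiff_aeval (𝕜 := ℝ) ∞
  exact this.mul (by fun_prop)

lemma continuous {f : ℝ → ℝ} (hf : IsPolyGauss f) : Continuous f := hf.contDiff.continuous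

lemma iteratedDeriv {f : ℝ → ℝ} (hf : IsPolyGauss f) (n : ℕ) : IsPolyGauss (iteratedDeriv n f) := by
  induction n with
  | zero => simpa using hf
  | succ n ih => rw [iteratedDeriv_succ]; exact ih.deriv

lemma id_mul {f : ℝ → ℝ} (hf : IsPolyGauss f) : IsPolyGauss (fun x => x * f x) := by
  obtain ⟨P, rfl⟩ := hf
  exact ⟨Polynomial.X * P, funext fun x => by
    simp only [Polynomial.eval_mul, Polynomial.eval_X]; ring⟩

lemma pow_mul {f : ℝ → ℝ} (hf : IsPolyGauss f) (n : ℕ) : IsPolyGauss (fun x => x ^ n * f x) := by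
  obtain ⟨P, rfl⟩ := hf
  exact ⟨Polynomial.X ^ n * P, funext fun x => by
    simp only [Polynomial.eval_mul, Polynomial.eval_X, Polynomial.eval_pow]; ring⟩

end IsPolyGauss

/-- The rate `1/8` leaves `exp(-3x²/8)` of the weight `exp(-x²/2)`. A further `1/8` later absorbs
the quadratic growth of a potential, and the remaining `exp(-x²/4)` is still square integrable. -/
lemma exists_eval_le_exp (P : Polynomial ℝ) :
    ∃ C, 0 ≤ C ∧ ∀ x : ℝ, |P.eval x| ≤ C * Real.exp (x ^ 2 / 8) := by
  induction P using Polynomial.induction_on' with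
  | add P Q hP hQ =>
    obtain ⟨C, hC, h⟩ := hP
    obtain ⟨D, hD, h'⟩ := hQ
    refine ⟨C + D, by positivity, fun x => ?_⟩
    rw [Polynomial.eval_add, add_mul]
    exact (abs_add_le _ _).trans (add_le_add (h x) (h' x))
  | monomial n a =>
    refine ⟨|a| * (1 + 8 ^ n * n.factorial), by positivity, fun x => ?_⟩
    rw [Polynomial.eval_monomial, abs_mul, mul_assoc]
    refine mul_le_mul_of_nonneg_left ?_ (abs_nonneg a)
    have h1 : (x ^ 2 / 8) ^ n / n.factorial ≤ Real.exp (x ^ 2 / 8) :=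
      Real.pow_div_factorial_le_exp _ (by positivity) n
    have h2 : (x ^ 2) ^ n ≤ 8 ^ n * n.factorial * Real.exp (x ^ 2 / 8) := by
      rw [div_le_iff₀ (by positivity), div_pow, div_le_iff₀ (by positivity)] at h1
      linarith
    have h3 : 1 ≤ Real.exp (x ^ 2 / 8) := Real.one_le_exp (by positivity)
    have h4 : |x ^ n| ≤ 1 + (x ^ 2) ^ n := by
      have : (x ^ 2) ^ n = |x ^ n| ^ 2 := by rw [sq_abs, ← pow_mul, ← pow_mul, mul_comm]
      rw [this]
      nlinarith [sq_nonneg (|x ^ n| - 1)]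
    rw [add_mul, one_mul]
    linarith

lemma IsPolyGauss.exists_le {f : ℝ → ℝ} (hf : IsPolyGauss f) :
    ∃ C, 0 ≤ C ∧ ∀ x, |f x| ≤ C * Real.exp (-(3 / 8) * x ^ 2) := by
  obtain ⟨P, rfl⟩ := hf
  obtain ⟨C, hC, h⟩ := exists_eval_le_exp P
  refine ⟨C, hC, fun x => ?_⟩
  rw [abs_mul, Real.abs_exp]
  refine (mul_le_mul_of_nonneg_right (h x) (Real.exp_pos _).le).trans (le_of_eq ?_)
  rw [mul_assoc, ← Real.exp_add]
  congr 2
  ring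

lemma IsPolyGauss.integrable {f : ℝ → ℝ} (hf : IsPolyGauss f) : Integrable f := by
  obtain ⟨C, hC, h⟩ := hf.exists_le
  refine ((integrable_exp_neg_mul_sq (b := 3 / 8) (by norm_num)).const_mul C).mono'
    hf.continuous.aestronglyMeasurable (Filter.Eventually.of_forall fun x => ?_)
  exact h x

lemma IsPolyGauss.abs_le {f : ℝ → ℝ} (hf : IsPolyGauss f) : ∃ C, 0 ≤ C ∧ ∀ x, |f x| ≤ C := by
  obtain ⟨C, hC, h⟩ := hf.exists_le
  refine ⟨C, hC, fun x => (h x).trans ?_⟩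
  have : Real.exp (-(3 / 8) * x ^ 2) ≤ 1 := Real.exp_le_one_iff.2 (by nlinarith [sq_nonneg x])
  nlinarith

lemma IsPolyGauss.integrable_mul {f g : ℝ → ℝ} (hf : IsPolyGauss f) (hg : IsPolyGauss g) :
    Integrable (fun x => f x * g x) := by
  obtain ⟨C, hC, h⟩ := hg.abs_le
  exact hf.integrable.mul_bdd hg.continuous.aestronglyMeasurable
    (Filter.Eventually.of_forall fun x => h x)

lemma gaussWeight_sq (y : ℝ) : gaussWeight y ^ 2 = (Real.sqrt Real.pi)⁻¹ * Real.exp (-y ^ 2) := by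
  rw [gaussWeight, mul_pow, ← Real.exp_nat_mul, ← Real.rpow_natCast, ← Real.rpow_mul Real.pi_pos.le,
    Real.sqrt_eq_rpow, ← Real.rpow_neg Real.pi_pos.le]
  congr 2
  · norm_num
  · push_cast; ring

lemma gaussWeight_pos (y : ℝ) : 0 < gaussWeight y :=
  mul_pos (Real.rpow_pos_of_pos Real.pi_pos _) (Real.exp_pos _)

lemma hasDerivAt_gaussWeight (y : ℝ) : HasDerivAt gaussWeight (-y * gaussWeight y) y := by
  refine ((hasDerivAt_gauss y).const_mul _).congr_deriv ?_
  rw [gaussWeight]; ring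

lemma contDiff_gaussWeight_sq : ContDiff ℝ ∞ (fun s => gaussWeight s ^ 2) := by
  unfold gaussWeight; fun_prop

lemma hasDerivAt_iteratedDeriv_gaussWeight_sq (k : ℕ) (y : ℝ) :
    HasDerivAt (iteratedDeriv k (fun s => gaussWeight s ^ 2))
      (iteratedDeriv (k + 1) (fun s => gaussWeight s ^ 2) y) y := by
  rw [iteratedDeriv_succ]
  refine DifferentiableAt.hasDerivAt ?_
  exact (contDiff_gaussWeight_sq.differentiable_iteratedDeriv k
    (by exact_mod_cast WithTop.coe_lt_coe.2 (ENat.natCast_lt_top k))) y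

/-- This is the `k`-th derivative of `(ω²)' = -2yω²`, and it yields both the three-term recurrence
and the derivative rule for `H_k`. For `k = 0` the truncated index `k - 1` is harmless, since its
coefficient is 0. -/
lemma iteratedDeriv_gaussWeight_sq_succ (k : ℕ) (y : ℝ) :
    iteratedDeriv (k + 1) (fun s => gaussWeight s ^ 2) y =
      -2 * y * iteratedDeriv k (fun s => gaussWeight s ^ 2) y
        - 2 * k * iteratedDeriv (k - 1) (fun s => gaussWeight s ^ 2) y := by
  induction k generalizing y with
  | zero =>
    simp only [zero_add, iteratedDeriv_one, iteratedDeriv_zero, Nat.cast_zero]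
    refine (((hasDerivAt_gaussWeight y).pow 2).deriv).trans ?_
    simp
    ring
  | succ k ih =>
    have e : iteratedDeriv (k + 1) (fun s => gaussWeight s ^ 2) = fun y =>
      -2 * y * iteratedDeriv k (fun s => gaussWeight s ^ 2) y
        - 2 * k * iteratedDeriv (k - 1) (fun s => gaussWeight s ^ 2) y := funext ih
    rw [iteratedDeriv_succ]
    nth_rewrite 1 [e]
    have h1 := (((hasDerivAt_id y).const_mul (-2 : ℝ)).mul
      (hasDerivAt_iteratedDeriv_gaussWeight_sq k y)).sub
      ((hasDerivAt_iteratedDeriv_gaussWeight_sq (k - 1) y).const_mul (2 * (k : ℝ)))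
    refine (HasDerivAt.deriv h1).trans ?_
    rcases k with _ | k
    · simp
      ring
    · simp
      ring

lemma hermiteH_zero (y : ℝ) : hermiteH 0 y = 1 := by
  have := (gaussWeight_pos y).ne'
  simp [hermiteH, this]

lemma hermiteH_succ (k : ℕ) (y : ℝ) :
    hermiteH (k + 1) y = 2 * y * hermiteH k y - 2 * k * hermiteH (k - 1) y := by
  simp only [hermiteH]
  rw [iteratedDeriv_gaussWeight_sq_succ]
  rcases k with _ | k
  · simp
    ring
  · simp only [Nat.add_sub_cancel]
    ring

lemma hasDerivAt_hermiteH (k : ℕ) (y : ℝ) :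
    HasDerivAt (hermiteH k) (2 * k * hermiteH (k - 1) y) y := by
  have hpos := (gaussWeight_pos y).ne'
  have h1 : HasDerivAt (fun y => (gaussWeight y ^ 2)⁻¹) (2 * y * (gaussWeight y ^ 2)⁻¹) y := by
    refine (((hasDerivAt_gaussWeight y).pow 2).inv (pow_ne_zero 2 hpos)).congr_deriv ?_
    simp only [Nat.cast_ofNat, Nat.add_one_sub_one, pow_one, Pi.pow_apply]
    field_simp
  have h2 := ((h1.const_mul ((-1 : ℝ) ^ k)).mul (hasDerivAt_iteratedDeriv_gaussWeight_sq k y))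
  refine HasDerivAt.congr_deriv (f' := _) h2 ?_
  have h3 := hermiteH_succ k y
  have h4 : hermiteH (k + 1) y = -((-1) ^ k * (gaussWeight y ^ 2)⁻¹ *
      iteratedDeriv (k + 1) (fun s => gaussWeight s ^ 2) y) := by
    rw [hermiteH, pow_succ]; ring
  rw [h4] at h3
  simp only [hermiteH] at h3 ⊢
  linarith

/-- The normalisation constant of the Hermite functions. -/
def hermiteNorm (k : ℕ) : ℝ := (Real.sqrt (2 ^ k * (k.factorial : ℝ)))⁻¹

lemma hermiteNorm_succ (k : ℕ) :
    hermiteNorm k = 2 * Real.sqrt (((k : ℝ) + 1) / 2) * hermiteNorm (k + 1) := by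
  have e : (2 : ℝ) ^ (k + 1) * ((k + 1).factorial : ℝ) =
      (2 ^ k * (k.factorial : ℝ)) * (2 ^ 2 * (((k : ℝ) + 1) / 2)) := by
    rw [Nat.factorial_succ]; push_cast; ring
  rw [hermiteNorm, hermiteNorm, e, Real.sqrt_mul (x := 2 ^ k * (k.factorial : ℝ)) (by positivity),
    Real.sqrt_mul (x := 2 ^ 2) (by positivity), Real.sqrt_sq (by norm_num)]
  have h1 : Real.sqrt (2 ^ k * (k.factorial : ℝ)) ≠ 0 := by positivity
  have h2 : Real.sqrt (((k : ℝ) + 1) / 2) ≠ 0 := by positivity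
  field_simp

lemma hermiteFn_eq (k : ℕ) (y : ℝ) :
    hermiteFn k y = hermiteNorm k * gaussWeight y * hermiteH k y := rfl

lemma hermiteFn_zero (y : ℝ) : hermiteFn 0 y = gaussWeight y := by
  simp [hermiteFn_eq, hermiteNorm, hermiteH_zero]

lemma sqrt_half_mul_hermiteFn_succ (k : ℕ) (y : ℝ) :
    Real.sqrt (((k : ℝ) + 1) / 2) * hermiteFn (k + 1) y =
      hermiteNorm k * gaussWeight y * (y * hermiteH k y - k * hermiteH (k - 1) y) := by
  rw [hermiteFn_eq, hermiteH_succ, hermiteNorm_succ k]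
  ring

lemma sqrt_half_mul_hermiteFn_pred (k : ℕ) (y : ℝ) :
    Real.sqrt ((k : ℝ) / 2) * hermiteFn (k - 1) y =
      hermiteNorm k * gaussWeight y * (k * hermiteH (k - 1) y) := by
  rcases k with _ | k
  · simp
  · rw [Nat.add_sub_cancel, hermiteFn_eq, hermiteNorm_succ k]
    have h : Real.sqrt (((k : ℝ) + 1) / 2) ^ 2 = ((k : ℝ) + 1) / 2 := Real.sq_sqrt (by positivity)
    push_cast
    linear_combination (2 * hermiteNorm (k + 1) * gaussWeight y * hermiteH k y) * h

lemma mul_hermiteFn (k : ℕ) (y : ℝ) :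
    y * hermiteFn k y = Real.sqrt ((k : ℝ) / 2) * hermiteFn (k - 1) y +
      Real.sqrt (((k : ℝ) + 1) / 2) * hermiteFn (k + 1) y := by
  rw [sqrt_half_mul_hermiteFn_succ, sqrt_half_mul_hermiteFn_pred, hermiteFn_eq]
  ring

lemma hasDerivAt_hermiteFn (k : ℕ) (y : ℝ) :
    HasDerivAt (hermiteFn k) (Real.sqrt ((k : ℝ) / 2) * hermiteFn (k - 1) y -
      Real.sqrt (((k : ℝ) + 1) / 2) * hermiteFn (k + 1) y) y := by
  rw [sqrt_half_mul_hermiteFn_succ, sqrt_half_mul_hermiteFn_pred]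
  refine HasDerivAt.congr_deriv (f' := _) (((hasDerivAt_gaussWeight y).const_mul
    (hermiteNorm k)).mul (hasDerivAt_hermiteH k y)) ?_
  ring

lemma isPolyGauss_hermiteFn (k : ℕ) : IsPolyGauss (hermiteFn k) := by
  have hH : ∀ k, ∃ P : Polynomial ℝ, ∀ y, hermiteH k y = P.eval y := by
    intro k
    induction k using Nat.strong_induction_on with
    | _ k ih =>
      rcases k with _ | k
      · exact ⟨1, fun y => by simp [hermiteH_zero]⟩
      · obtain ⟨P, hP⟩ := ih k (by omega)
        obtain ⟨Q, hQ⟩ := ih (k - 1) (by omega)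
        refine ⟨Polynomial.C 2 * Polynomial.X * P - Polynomial.C (2 * (k : ℝ)) * Q, fun y => ?_⟩
        rw [hermiteH_succ, hP, hQ]
        simp
  obtain ⟨P, hP⟩ := hH k
  refine ⟨Polynomial.C (hermiteNorm k * Real.pi ^ (-(1 / 4) : ℝ)) * P, funext fun y => ?_⟩
  rw [hermiteFn_eq, hP, gaussWeight, Polynomial.eval_mul, Polynomial.eval_C]
  ring

lemma deriv_hermiteFn (k : ℕ) (y : ℝ) :
    deriv (hermiteFn k) y = Real.sqrt ((k : ℝ) / 2) * hermiteFn (k - 1) y -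
      Real.sqrt (((k : ℝ) + 1) / 2) * hermiteFn (k + 1) y := (hasDerivAt_hermiteFn k y).deriv

/-- The annihilation operator lowers the index. -/
lemma annihilate_hermiteFn (k : ℕ) (y : ℝ) :
    y * hermiteFn (k + 1) y + deriv (hermiteFn (k + 1)) y =
      2 * Real.sqrt (((k : ℝ) + 1) / 2) * hermiteFn k y := by
  rw [mul_hermiteFn, deriv_hermiteFn]
  push_cast
  ring

lemma create_hermiteFn (k : ℕ) (y : ℝ) :
    y * hermiteFn k y - deriv (hermiteFn k) y =
      2 * Real.sqrt (((k : ℝ) + 1) / 2) * hermiteFn (k + 1) y := by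
  rw [mul_hermiteFn, deriv_hermiteFn]
  ring

lemma integral_mul_deriv_polyGauss {f g : ℝ → ℝ} (hf : IsPolyGauss f) (hg : IsPolyGauss g) :
    ∫ y, f y * deriv g y = -∫ y, deriv f y * g y :=
  integral_mul_deriv_eq_deriv_mul_of_integrable
    (fun x _ => (hf.differentiable x).hasDerivAt) (fun x _ => (hg.differentiable x).hasDerivAt)
    (hf.integrable_mul hg.deriv) (hf.deriv.integrable_mul hg) (hf.integrable_mul hg)

lemma integral_annihilate_mul {f g : ℝ → ℝ} (hf : IsPolyGauss f) (hg : IsPolyGauss g) :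
    ∫ y, (y * f y + deriv f y) * g y = ∫ y, f y * (y * g y - deriv g y) := by
  have h := integral_mul_deriv_polyGauss hf hg
  have e1 : ∫ y, (y * f y + deriv f y) * g y = (∫ y, (y * f y) * g y) + ∫ y, deriv f y * g y := by
    rw [← integral_add (hf.id_mul.integrable_mul hg) (hf.deriv.integrable_mul hg)]
    exact integral_congr_ae (Filter.Eventually.of_forall fun y => by ring)
  have e2 : ∫ y, f y * (y * g y - deriv g y) = (∫ y, (y * f y) * g y) - ∫ y, f y * deriv g y := by
    rw [← integral_sub (hf.id_mul.integrable_mul hg) (hf.integrable_mul hg.deriv)]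
    exact integral_congr_ae (Filter.Eventually.of_forall fun y => by ring)
  rw [e1, e2, h]; ring

/-- Annihilation `y + ∂` and creation `y - ∂` are adjoint, so the inner product is moved from `(j,
k)` to `(j + 1, k + 1)`. This reduces everything to index 0, where `Φ_0` is annihilated or a
Gaussian integral remains. -/
lemma integral_hermiteFn_mul (j k : ℕ) :
    ∫ y, hermiteFn j y * hermiteFn k y = if j = k then 1 else 0 := by
  have hstep : ∀ j k : ℕ, Real.sqrt (((j : ℝ) + 1) / 2) * ∫ y, hermiteFn j y * hermiteFn k y =
      Real.sqrt (((k : ℝ) + 1) / 2) * ∫ y, hermiteFn (j + 1) y * hermiteFn (k + 1) y := by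
    intro j k
    have h := integral_annihilate_mul (isPolyGauss_hermiteFn (j + 1)) (isPolyGauss_hermiteFn k)
    simp only [annihilate_hermiteFn, create_hermiteFn] at h
    have e1 : ∫ y, 2 * Real.sqrt (((j : ℝ) + 1) / 2) * hermiteFn j y * hermiteFn k y =
        2 * Real.sqrt (((j : ℝ) + 1) / 2) * ∫ y, hermiteFn j y * hermiteFn k y := by
      rw [← integral_const_mul]; congr 1; ext y; ring
    have e2 : ∫ y, hermiteFn (j + 1) y * (2 * Real.sqrt (((k : ℝ) + 1) / 2) * hermiteFn (k + 1) y) =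
        2 * Real.sqrt (((k : ℝ) + 1) / 2) * ∫ y, hermiteFn (j + 1) y * hermiteFn (k + 1) y := by
      rw [← integral_const_mul]; congr 1; ext y; ring
    rw [e1, e2] at h
    linarith
  have hzero : ∀ k : ℕ, ∫ y, hermiteFn 0 y * hermiteFn (k + 1) y = 0 := by
    intro k
    have h := integral_annihilate_mul (isPolyGauss_hermiteFn 0) (isPolyGauss_hermiteFn k)
    have e0 : ∀ y, y * hermiteFn 0 y + deriv (hermiteFn 0) y = 0 := by
      intro y
      rw [mul_hermiteFn, deriv_hermiteFn]; simp
    simp only [e0, zero_mul, integral_zero, create_hermiteFn] at h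
    have e2 : ∫ y, hermiteFn 0 y * (2 * Real.sqrt (((k : ℝ) + 1) / 2) * hermiteFn (k + 1) y) =
        2 * Real.sqrt (((k : ℝ) + 1) / 2) * ∫ y, hermiteFn 0 y * hermiteFn (k + 1) y := by
      rw [← integral_const_mul]; congr 1; ext y; ring
    rw [e2] at h
    have : 2 * Real.sqrt (((k : ℝ) + 1) / 2) ≠ 0 := by positivity
    exact (mul_eq_zero.1 h.symm).resolve_left this
  induction j generalizing k with
  | zero =>
    rcases k with _ | k
    · simp only [hermiteFn_zero, if_true]
      have : ∀ y, gaussWeight y * gaussWeight y =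
          (Real.sqrt Real.pi)⁻¹ * Real.exp (-1 * y ^ 2) := by
        intro y; rw [← pow_two, gaussWeight_sq, neg_one_mul]
      simp only [this]
      rw [integral_const_mul, integral_gaussian, div_one]
      have : Real.sqrt Real.pi ≠ 0 := by positivity
      field_simp
    · rw [hzero]; simp
  | succ j ih =>
    rcases k with _ | k
    · rw [if_neg (by omega), ← hzero j]
      congr 1; ext y; ring
    · have h := hstep j k
      rw [ih k] at h
      have hk : Real.sqrt (((k : ℝ) + 1) / 2) ≠ 0 := by positivity
      by_cases hjk : j = k
      · subst hjk
        simp only [if_true, mul_one] at h ⊢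
        exact (mul_left_cancel₀ hk (by rw [mul_one]; exact h)).symm
      · rw [if_neg hjk, mul_zero] at h
        rw [if_neg (by omega)]
        exact (mul_eq_zero.1 h.symm).resolve_left hk

/-! ### Completeness of the Hermite functions -/

open FourierTransform in
lemma exists_schwartz_fourier_eq {φ : ℝ → ℝ} (hφ : ContDiff ℝ ∞ φ) (hφc : HasCompactSupport φ) :
    ∃ ψ : SchwartzMap ℝ ℂ, ∀ x, (𝓕 ψ : SchwartzMap ℝ ℂ) x = φ x := by
  have hc : HasCompactSupport (fun x => (φ x : ℂ)) := hφc.comp_left Complex.ofReal_zero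
  have hs : ContDiff ℝ ∞ (fun x => (φ x : ℂ)) := Complex.ofRealCLM.contDiff.comp hφ
  refine ⟨𝓕⁻ (hc.toSchwartzMap hs), fun x => ?_⟩
  rw [fourier_fourierInv_eq]
  rfl

open FourierTransform in
lemma integral_fourier_mul_eq (ψ : SchwartzMap ℝ ℂ) {g : ℝ → ℂ} (hg : Integrable g) :
    ∫ x, (𝓕 (ψ : ℝ → ℂ) x) • g x = ∫ x, (ψ x) • 𝓕 g x := by
  simpa using! VectorFourier.integral_fourierIntegral_smul_eq_flip (L := innerₗ ℝ)
    Real.continuous_fourierChar continuous_inner (ψ.integrable (μ := volume)) hg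

-- Every test function is the Fourier transform of a Schwartz function, and the transform can be
-- moved across the pairing onto `g`.
open FourierTransform in
lemma ae_eq_zero_of_fourier_eq_zero {g : ℝ → ℂ} (hg : Integrable g) (h : ∀ ξ, 𝓕 g ξ = 0) :
    g =ᵐ[volume] 0 := by
  refine ae_eq_zero_of_integral_contDiff_smul_eq_zero hg.locallyIntegrable ?_
  intro φ hφ hφc
  obtain ⟨ψ, hψ⟩ := exists_schwartz_fourier_eq hφ hφc
  have h3 : ∫ x, φ x • g x = ∫ x, (𝓕 (ψ : ℝ → ℂ) x) • g x := by
    congr 1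
    ext x
    rw [← SchwartzMap.fourier_coe, hψ]
    simp
  rw [h3, integral_fourier_mul_eq ψ hg]
  simp [h]

/-- The exponential moments allow the power series of `exp(-2πiξy)` to be integrated term by term
against `g`. Each term is a moment, so the Fourier transform of `g` vanishes. -/
lemma ae_eq_zero_of_moments {g : ℝ → ℂ} (hm : AEStronglyMeasurable g)
    (hg : ∀ c : ℝ, Integrable fun y => Real.exp (c * |y|) * ‖g y‖)
    (h : ∀ k : ℕ, ∫ y : ℝ, (y : ℂ) ^ k * g y = 0) : g =ᵐ[volume] 0 := by
  have hg0 : Integrable g := by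
    have := hg 0
    simp only [zero_mul, Real.exp_zero, one_mul] at this
    exact (integrable_norm_iff hm).1 this
  refine ae_eq_zero_of_fourier_eq_zero hg0 fun ξ => ?_
  rw [Real.fourier_eq]
  have hs : HasSum (fun k : ℕ => ∫ y : ℝ, ((-(2 * Real.pi * ξ * y) : ℝ) * Complex.I : ℂ) ^ k /
      (k.factorial : ℂ) * g y)
      (∫ y : ℝ, Complex.exp ((-(2 * Real.pi * ξ * y) : ℝ) * Complex.I) * g y) := by
    refine hasSum_integral_of_dominated_convergence
      (fun k y => (2 * Real.pi * |ξ| * |y|) ^ k / (k.factorial : ℝ) * ‖g y‖) ?_ ?_ ?_ ?_ ?_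
    · intro k
      refine AEStronglyMeasurable.mul ?_ hm
      exact Continuous.aestronglyMeasurable (by fun_prop)
    · intro k
      refine Filter.Eventually.of_forall fun y => le_of_eq ?_
      simp only [norm_mul, norm_div, norm_pow, Complex.norm_real, Complex.norm_I, mul_one,
        Real.norm_eq_abs, abs_neg, abs_mul, abs_two, abs_of_pos Real.pi_pos, Complex.norm_natCast]
    · refine Filter.Eventually.of_forall fun y => ?_
      exact (Real.summable_pow_div_factorial _).mul_right _
    · refine (hg (2 * Real.pi * |ξ|)).congr (Filter.Eventually.of_forall fun y => ?_)
      simp only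
      rw [tsum_mul_right, Real.exp_eq_exp_ℝ, NormedSpace.exp_eq_tsum_div]
    · refine Filter.Eventually.of_forall fun y => ?_
      refine HasSum.mul_right _ ?_
      rw [Complex.exp_eq_exp_ℂ]
      exact NormedSpace.expSeries_div_hasSum_exp _
  have h0 : ∀ k : ℕ, ∫ y : ℝ, ((-(2 * Real.pi * ξ * y) : ℝ) * Complex.I : ℂ) ^ k /
      (k.factorial : ℂ) * g y = 0 := by
    intro k
    have e : ∀ y : ℝ, ((-(2 * Real.pi * ξ * y) : ℝ) * Complex.I : ℂ) ^ k /
      (k.factorial : ℂ) * g y = ((-(2 * Real.pi * ξ) : ℝ) * Complex.I : ℂ) ^ k /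
      (k.factorial : ℂ) * ((y : ℂ) ^ k * g y) := by
      intro y; push_cast; ring
    simp only [e]
    rw [integral_const_mul, h k, mul_zero]
  simp only [h0] at hs
  have h1 := hs.unique hasSum_zero
  refine Eq.trans ?_ h1
  congr 1
  ext y
  rw [Real.fourierChar_apply']
  simp [Circle.smul_def, Circle.coe_exp]
  left
  rw [← Complex.exp_neg]
  ring_nf

lemma IsPolyGauss.integrable_mul_of_gauss {F : ℝ → ℂ} {f : ℝ → ℝ} (hf : IsPolyGauss f)
    (hF : Integrable fun y => F y * (Real.exp (-(1 / 4) * y ^ 2) : ℂ)) :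
    Integrable fun y => F y * (f y : ℂ) := by
  obtain ⟨C, hC, h⟩ := hf.exists_le
  have hb : ∀ y, |f y * Real.exp ((1 / 4) * y ^ 2)| ≤ C := by
    intro y
    rw [abs_mul, Real.abs_exp]
    refine (mul_le_mul_of_nonneg_right (h y) (Real.exp_pos _).le).trans ?_
    rw [mul_assoc, ← Real.exp_add]
    have : Real.exp (-(3 / 8) * y ^ 2 + 1 / 4 * y ^ 2) ≤ 1 :=
      Real.exp_le_one_iff.2 (by nlinarith [sq_nonneg y])
    nlinarith
  have h2 := hF.mul_bdd (g := fun y => ((f y * Real.exp ((1 / 4) * y ^ 2) : ℝ) : ℂ)) (c := C)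
    (Continuous.aestronglyMeasurable (by have := hf.continuous; fun_prop))
    (Filter.Eventually.of_forall fun y => by rw [Complex.norm_real]; exact hb y)
  refine h2.congr (Filter.Eventually.of_forall fun y => ?_)
  have : (Real.exp (-(1 / 4) * y ^ 2) : ℂ) * (Real.exp ((1 / 4) * y ^ 2) : ℂ) = 1 := by
    rw [← Complex.ofReal_mul, ← Real.exp_add]; simp
  push_cast at this ⊢
  linear_combination (F y * f y) * this

/-- The recurrence for `yΦ_k` shows that all moments of `FΦ_0` vanish, and `Φ_0` is nowhere zero.
The integrability hypothesis is weaker than `F ∈ L²` so that Fubini supplies it directly, for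
partial integrals and for almost every section of a function in `L²(ℝ²)`. -/
lemma ae_eq_zero_of_hermite {F : ℝ → ℂ}
    (hF : Integrable fun y => F y * (Real.exp (-(1 / 4) * y ^ 2) : ℂ))
    (h : ∀ k : ℕ, ∫ y, F y * (hermiteFn k y : ℂ) = 0) : F =ᵐ[volume] 0 := by
  have hpow : ∀ m k : ℕ, ∫ y, F y * ((y ^ m * hermiteFn k y : ℝ) : ℂ) = 0 := by
    intro m
    induction m with
    | zero => intro k; simpa using h k
    | succ m ih =>
      intro k
      have e : ∀ y : ℝ, F y * ((y ^ (m + 1) * hermiteFn k y : ℝ) : ℂ) =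
          (Real.sqrt ((k : ℝ) / 2) : ℂ) * (F y * ((y ^ m * hermiteFn (k - 1) y : ℝ) : ℂ)) +
          (Real.sqrt (((k : ℝ) + 1) / 2) : ℂ) *
            (F y * ((y ^ m * hermiteFn (k + 1) y : ℝ) : ℂ)) := by
        intro y
        rw [pow_succ, mul_assoc, mul_hermiteFn]
        push_cast
        ring
      simp only [e]
      rw [integral_add, integral_const_mul, integral_const_mul, ih, ih]
      · simp
      · exact (((isPolyGauss_hermiteFn _).pow_mul m).integrable_mul_of_gauss hF).const_mul _
      · exact (((isPolyGauss_hermiteFn _).pow_mul m).integrable_mul_of_gauss hF).const_mul _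
  have h1 : (fun y => F y * (hermiteFn 0 y : ℂ)) =ᵐ[volume] 0 := by
    refine ae_eq_zero_of_moments
      ((isPolyGauss_hermiteFn 0).integrable_mul_of_gauss hF).aestronglyMeasurable ?_ ?_
    · intro c
      -- Completing the square: `c|y| - y²/4 ≤ c²`, by `(c - |y|/2)² ≥ 0`.
      have hb : ∀ y : ℝ, Real.exp (c * |y|) * gaussWeight y * Real.exp ((1 / 4) * y ^ 2) ≤
          Real.pi ^ (-(1 / 4) : ℝ) * Real.exp (c ^ 2) := by
        intro y
        rw [gaussWeight, mul_left_comm, mul_assoc, mul_assoc, ← mul_assoc (Real.exp (c * |y|)),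
          ← Real.exp_add, ← Real.exp_add]
        refine mul_le_mul_of_nonneg_left (Real.exp_le_exp.2 ?_) (by positivity)
        nlinarith [sq_nonneg (c - |y| / 2), sq_abs y]
      have h2 := hF.norm.mul_bdd
        (g := fun y => Real.exp (c * |y|) * gaussWeight y * Real.exp ((1 / 4) * y ^ 2))
        (c := Real.pi ^ (-(1 / 4) : ℝ) * Real.exp (c ^ 2))
        (Continuous.aestronglyMeasurable (by unfold gaussWeight; fun_prop))
        (Filter.Eventually.of_forall fun y => by
          rw [Real.norm_eq_abs, abs_of_nonneg]
          · exact hb y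
          · have := gaussWeight_pos y; positivity)
      refine h2.congr (Filter.Eventually.of_forall fun y => ?_)
      have e : Real.exp (-(1 / 4) * y ^ 2) * Real.exp ((1 / 4) * y ^ 2) = 1 := by
        rw [← Real.exp_add]; simp
      simp only [norm_mul, Complex.norm_real, Real.norm_eq_abs, Real.abs_exp, hermiteFn_zero,
        abs_of_pos (gaussWeight_pos y)]
      linear_combination (‖F y‖ * Real.exp (c * |y|) * gaussWeight y) * e
    · intro k
      refine Eq.trans ?_ (hpow k 0)
      congr 1; ext y; push_cast; ring
  filter_upwards [h1] with y hy
  have hne : (hermiteFn 0 y : ℂ) ≠ 0 := by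
    rw [hermiteFn_zero]; exact_mod_cast (gaussWeight_pos y).ne'
  exact (mul_eq_zero.1 hy).resolve_right hne

/-! ### The Hermite basis of `L²(ℝ × ℝ)` -/

/-- The tensor products `Φ_j(x) Φ_k(y)` of Hermite functions. -/
def herm (i : ℕ × ℕ) (z : ℝ × ℝ) : ℝ := hermiteFn i.1 z.1 * hermiteFn i.2 z.2

lemma IsPolyGauss.memLp_prod {f g : ℝ → ℝ} (hf : IsPolyGauss f) (hg : IsPolyGauss g) :
    MemLp (fun z : ℝ × ℝ => ((f z.1 * g z.2 : ℝ) : ℂ)) 2 volume := by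
  have hfc := hf.continuous
  have hgc := hg.continuous
  rw [memLp_two_iff_integrable_sq_norm (Continuous.aestronglyMeasurable (by fun_prop))]
  have h := (hf.integrable_mul hf).mul_prod (hg.integrable_mul hg)
  rw [← Measure.volume_eq_prod] at h
  refine h.congr (Filter.Eventually.of_forall fun z => ?_)
  simp only [Complex.norm_real, Real.norm_eq_abs, sq_abs]
  ring

lemma memLp_herm (i : ℕ × ℕ) : MemLp (fun z => (herm i z : ℂ)) 2 volume :=
  (isPolyGauss_hermiteFn i.1).memLp_prod (isPolyGauss_hermiteFn i.2)

/-- The element `Φ_j(x) Φ_k(y)` of `L²(ℝ × ℝ)`. -/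
def hermL (i : ℕ × ℕ) : L2xy := (memLp_herm i).toLp _

/-- The coefficients of `u` in the Hermite basis. -/
def coef (u : L2xy) (i : ℕ × ℕ) : ℂ := ∫ z, u z * (herm i z : ℂ)

lemma integrable_mul_memLp (u : L2xy) {w : ℝ × ℝ → ℂ} (hw : MemLp w 2 volume) :
    Integrable (fun z => u z * w z) :=
  (Lp.memLp u).integrable_mul hw

lemma inner_toLp {w : ℝ × ℝ → ℝ} (hw : MemLp (fun z => (w z : ℂ)) 2 volume) (u : L2xy) :
    inner ℂ (hw.toLp _) u = ∫ z, u z * (w z : ℂ) := by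
  rw [L2.inner_def]
  refine integral_congr_ae ?_
  filter_upwards [hw.coeFn_toLp] with z hz
  rw [hz, RCLike.inner_apply]
  simp

lemma coef_eq_inner (u : L2xy) (i : ℕ × ℕ) : coef u i = inner ℂ (hermL i) u :=
  (inner_toLp (memLp_herm i) u).symm

lemma coef_toLp {w : ℝ × ℝ → ℝ} (hw : MemLp (fun z => (w z : ℂ)) 2 volume) (i : ℕ × ℕ) :
    coef (hw.toLp _) i = ((∫ z, w z * herm i z : ℝ) : ℂ) := by
  rw [← integral_complex_ofReal]
  refine integral_congr_ae ?_
  filter_upwards [hw.coeFn_toLp] with z hz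
  rw [hz]
  push_cast
  rfl

lemma integral_herm_mul (i j : ℕ × ℕ) : ∫ z, herm i z * herm j z = if i = j then 1 else 0 := by
  have h := integral_prod_mul (μ := (volume : Measure ℝ)) (ν := (volume : Measure ℝ))
    (fun x => hermiteFn i.1 x * hermiteFn j.1 x) (fun y => hermiteFn i.2 y * hermiteFn j.2 y)
  rw [← Measure.volume_eq_prod] at h
  have e : ∀ z : ℝ × ℝ, herm i z * herm j z =
      (hermiteFn i.1 z.1 * hermiteFn j.1 z.1) * (hermiteFn i.2 z.2 * hermiteFn j.2 z.2) := by
    intro z; simp only [herm]; ring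
  simp only [e]
  rw [h, integral_hermiteFn_mul, integral_hermiteFn_mul]
  by_cases h1 : i.1 = j.1 <;> by_cases h2 : i.2 = j.2 <;> simp [h1, h2, Prod.ext_iff]

lemma orthonormal_hermL : Orthonormal ℂ hermL := by
  rw [orthonormal_iff_ite]
  intro i j
  rw [← coef_eq_inner, hermL, coef_toLp, integral_herm_mul]
  by_cases h : i = j
  · simp [h]
  · simp [h, Ne.symm h]

lemma integral_iterated {f : ℝ × ℝ → ℂ} (hf : Integrable f) : ∫ z, f z = ∫ x, ∫ y, f (x, y) :=
  integral_prod (μ := volume) (ν := volume) f hf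

lemma integrable_integral_snd {f : ℝ × ℝ → ℂ} (hf : Integrable f) :
    Integrable (fun x => ∫ y, f (x, y)) :=
  Integrable.integral_prod_left (μ := volume) (ν := volume) hf

lemma ae_integrable_snd {f : ℝ × ℝ → ℂ} (hf : Integrable f) :
    ∀ᵐ x : ℝ, Integrable (fun y => f (x, y)) :=
  Integrable.prod_right_ae (μ := volume) (ν := volume) hf

lemma IsPolyGauss.memLp {f : ℝ → ℝ} (hf : IsPolyGauss f) : MemLp f 2 volume := by
  rw [memLp_two_iff_integrable_sq hf.continuous.aestronglyMeasurable]
  exact (hf.integrable_mul hf).congr (Filter.Eventually.of_forall fun x => by ring)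

lemma integrable_exp_quarter : Integrable (fun x : ℝ => Real.exp (-(1 / 4) * x ^ 2) ^ 2) := by
  refine (integrable_exp_neg_mul_sq (b := 1 / 2) (by norm_num)).congr
    (Filter.Eventually.of_forall fun x => ?_)
  simp only
  rw [← Real.exp_nat_mul]
  congr 1; push_cast; ring

lemma memLp_tensor {f g : ℝ → ℝ} (hf : Continuous f) (hg : Continuous g)
    (hf2 : Integrable fun x => f x ^ 2) (hg2 : Integrable fun x => g x ^ 2) :
    MemLp (fun z : ℝ × ℝ => ((f z.1 * g z.2 : ℝ) : ℂ)) 2 volume := by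
  rw [memLp_two_iff_integrable_sq_norm (Continuous.aestronglyMeasurable (by fun_prop))]
  have h := hf2.mul_prod hg2
  rw [← Measure.volume_eq_prod] at h
  refine h.congr (Filter.Eventually.of_forall fun z => ?_)
  simp only [Complex.norm_real, Real.norm_eq_abs, sq_abs]
  ring

/-- One-dimensional completeness is applied in `x` to each Hermite coefficient in `y`, and again in
`y` to almost every section. -/
lemma eq_zero_of_coef_eq_zero {u : L2xy} (h : ∀ i, coef u i = 0) : u = 0 := by
  have hq : Continuous fun x : ℝ => Real.exp (-(1 / 4) * x ^ 2) := by fun_prop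
  have hsq : ∀ k, Integrable fun x => hermiteFn k x ^ 2 := fun k =>
    (isPolyGauss_hermiteFn k).memLp.integrable_sq
  -- the Hermite coefficients in `y` vanish
  have h1 : ∀ k : ℕ, ∀ᵐ x : ℝ, hermiteCoeff u k x = 0 := by
    intro k
    refine ae_eq_zero_of_hermite ?_ ?_
    · have hi := integrable_mul_memLp u (memLp_tensor hq (isPolyGauss_hermiteFn k).continuous
        integrable_exp_quarter (hsq k))
      refine (integrable_integral_snd hi).congr (Filter.Eventually.of_forall fun x => ?_)
      simp only [hermiteCoeff]
      rw [← integral_mul_const]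
      congr 1; ext y; push_cast; ring
    · intro j
      have hi := integrable_mul_memLp u (memLp_herm (j, k))
      have h0 := h (j, k)
      rw [coef, integral_iterated hi] at h0
      rw [← h0]
      congr 1; ext x
      simp only [hermiteCoeff]
      rw [← integral_mul_const]
      congr 1; ext y; simp only [herm]; push_cast; ring
  have h2 : ∀ᵐ x : ℝ, ∀ᵐ y : ℝ, u (x, y) = 0 := by
    have hi := integrable_mul_memLp u (memLp_tensor hq hq integrable_exp_quarter
      integrable_exp_quarter)
    filter_upwards [ae_integrable_snd hi, ae_all_iff.2 h1] with x hx hx2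
    refine ae_eq_zero_of_hermite ?_ hx2
    have hne : (Real.exp (-(1 / 4) * x ^ 2) : ℂ) ≠ 0 := by exact_mod_cast (Real.exp_pos _).ne'
    refine (hx.const_mul (Real.exp (-(1 / 4) * x ^ 2) : ℂ)⁻¹).congr
      (Filter.Eventually.of_forall fun y => ?_)
    push_cast at hne ⊢
    field_simp
  have h3 : ∀ᵐ z : ℝ × ℝ, u z = 0 := by
    refine (Measure.ae_prod_iff_ae_ae (μ := volume) (ν := volume) ?_).2 h2
    exact measurableSet_eq_fun (Lp.stronglyMeasurable u).measurable measurable_const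
  refine Lp.ext ?_
  filter_upwards [h3, Lp.coeFn_zero ℂ 2 (volume : Measure (ℝ × ℝ))] with z hz hz0
  rw [hz, hz0, Pi.zero_apply]

/-- The Hermite basis of `L²(ℝ × ℝ)`. -/
def hermBasis : HilbertBasis (ℕ × ℕ) ℂ L2xy :=
  HilbertBasis.mkOfOrthogonalEqBot orthonormal_hermL (by
    rw [Submodule.eq_bot_iff]
    intro u hu
    refine eq_zero_of_coef_eq_zero fun i => ?_
    rw [coef_eq_inner]
    exact (Submodule.mem_orthogonal _ _).1 hu _ (Submodule.subset_span ⟨i, rfl⟩))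

lemma hermBasis_apply (i : ℕ × ℕ) : hermBasis i = hermL i := by
  rw [hermBasis, HilbertBasis.coe_mkOfOrthogonalEqBot]

/-- With `w = LΦ_i`, which is square integrable, this turns the right-hand side of the weak equation
into a convergent row sum of the matrix of `L`, although `u` is only in `L²`. -/
lemma hasSum_coef (u : L2xy) {w : ℝ × ℝ → ℝ} (hw : MemLp (fun z => (w z : ℂ)) 2 volume) :
    HasSum (fun j => ((∫ z, w z * herm j z : ℝ) : ℂ) * coef u j) (∫ z, u z * (w z : ℂ)) := by
  have h := hermBasis.hasSum_inner_mul_inner (hw.toLp _) u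
  rw [inner_toLp] at h
  have e : ∀ j, inner ℂ (hw.toLp _) (hermBasis j) * inner ℂ (hermBasis j) u =
      ((∫ z, w z * herm j z : ℝ) : ℂ) * coef u j := by
    intro j
    rw [hermBasis_apply, ← coef_eq_inner, ← inner_conj_symm, ← coef_eq_inner, coef_toLp,
      Complex.conj_ofReal]
  simpa only [e] using h

lemma sum_norm_coef_sq_le (u : L2xy) (Q : Finset (ℕ × ℕ)) :
    ∑ i ∈ Q, ‖coef u i‖ ^ 2 ≤ ‖u‖ ^ 2 := by
  simp only [coef_eq_inner]
  exact orthonormal_hermL.sum_inner_products_le u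

lemma norm_sq_le_of_sum_coef_le {u : L2xy} {B : ℝ}
    (h : ∀ Q : Finset (ℕ × ℕ), ∑ i ∈ Q, ‖coef u i‖ ^ 2 ≤ B) : ‖u‖ ^ 2 ≤ B := by
  have h1 := hermBasis.hasSum_inner_mul_inner u u
  have h2 : HasSum (fun i => ‖coef u i‖ ^ 2) (‖u‖ ^ 2) := by
    have e : ∀ i, inner ℂ u (hermBasis i) * inner ℂ (hermBasis i) u =
        ((‖coef u i‖ ^ 2 : ℝ) : ℂ) := by
      intro i
      rw [hermBasis_apply, ← inner_conj_symm, ← coef_eq_inner, Complex.conj_mul']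
      push_cast
      rfl
    have e2 : inner ℂ u u = ((‖u‖ ^ 2 : ℝ) : ℂ) := by
      rw [inner_self_eq_norm_sq_to_K]; push_cast; rfl
    simp only [e, e2] at h1
    exact Complex.hasSum_ofReal.1 h1
  exact le_of_tendsto' h2 h

lemma sum_integral_mul_herm_sq_le {w : ℝ × ℝ → ℝ} (hw : MemLp (fun z => (w z : ℂ)) 2 volume)
    (Q : Finset (ℕ × ℕ)) : ∑ i ∈ Q, (∫ z, w z * herm i z) ^ 2 ≤ ∫ z, w z ^ 2 := by
  have h := sum_norm_coef_sq_le (hw.toLp _) Q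
  simp only [coef_toLp, Complex.norm_real, Real.norm_eq_abs, sq_abs] at h
  refine h.trans (le_of_eq ?_)
  have h2 := inner_toLp hw (hw.toLp _)
  rw [inner_self_eq_norm_sq_to_K] at h2
  have h3 : ∫ z, (hw.toLp _ : L2xy) z * (w z : ℂ) = ((∫ z, w z ^ 2 : ℝ) : ℂ) := by
    rw [← integral_complex_ofReal]
    refine integral_congr_ae ?_
    filter_upwards [hw.coeFn_toLp] with z hz
    rw [hz]
    push_cast
    ring
  rw [h3] at h2
  exact Complex.ofReal_injective (by rw [← h2]; push_cast; rfl)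

/-! ### Matrix elements of multiplication operators -/

/-- Continuous functions of at most quadratic growth. -/
def QuadGrowth (C : ℝ) (u : ℝ → ℝ → ℝ) : Prop :=
  Continuous (fun z : ℝ × ℝ => u z.1 z.2) ∧ ∀ x y, |u x y| ≤ C * (1 + x ^ 2 + y ^ 2)

/-- Continuous functions of at most linear growth, together with their derivatives up to the
order `r`. -/
def LinGrowth : ℕ → ℝ → (ℝ → ℝ → ℝ) → Prop
  | 0, C, u => Continuous (fun z : ℝ × ℝ => u z.1 z.2) ∧ ∀ x y, |u x y| ≤ C * (1 + |x| + |y|)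
  | r + 1, C, u => (Continuous (fun z : ℝ × ℝ => u z.1 z.2) ∧
      ∀ x y, |u x y| ≤ C * (1 + |x| + |y|)) ∧
      ∃ ux uy : ℝ → ℝ → ℝ, (∀ x y, HasDerivAt (fun s => u s y) (ux x y) x) ∧
        (∀ x y, HasDerivAt (fun s => u x s) (uy x y) y) ∧ LinGrowth r C ux ∧ LinGrowth r C uy

lemma LinGrowth.zero {r : ℕ} {C : ℝ} {u : ℝ → ℝ → ℝ} (h : LinGrowth r C u) : LinGrowth 0 C u := by
  cases r with
  | zero => exact h
  | succ r => exact h.1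

lemma LinGrowth.of_succ {r : ℕ} {C : ℝ} {u : ℝ → ℝ → ℝ} (h : LinGrowth (r + 1) C u) :
    LinGrowth r C u := by
  induction r generalizing u with
  | zero => exact h.1
  | succ r ih =>
    obtain ⟨h0, ux, uy, hx, hy, h1, h2⟩ := h
    exact ⟨h0, ux, uy, hx, hy, ih h1, ih h2⟩

lemma LinGrowth.of_le {r s : ℕ} (hrs : s ≤ r) {C : ℝ} {u : ℝ → ℝ → ℝ} (h : LinGrowth r C u) :
    LinGrowth s C u := by
  induction r, hrs using Nat.le_induction with
  | base => exact h
  | succ r _ ih => exact ih h.of_succ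

lemma LinGrowth.nonneg {r : ℕ} {C : ℝ} {u : ℝ → ℝ → ℝ} (h : LinGrowth r C u) : 0 ≤ C := by
  have := (abs_nonneg _).trans (h.zero.2 0 0)
  simpa using this

lemma LinGrowth.quadGrowth {r : ℕ} {C : ℝ} {u : ℝ → ℝ → ℝ} (h : LinGrowth r C u) :
    QuadGrowth (2 * C) u := by
  refine ⟨h.zero.1, fun x y => (h.zero.2 x y).trans ?_⟩
  have hC := h.nonneg
  have : 1 + |x| + |y| ≤ 2 * (1 + x ^ 2 + y ^ 2) := by
    nlinarith [sq_nonneg (|x| - 1), sq_nonneg (|y| - 1), sq_abs x, sq_abs y]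
  nlinarith

/-- Continuous functions dominated by a Gaussian. -/
def IsGaussDom (f : ℝ → ℝ) : Prop :=
  Continuous f ∧ ∃ C, 0 ≤ C ∧ ∀ x, |f x| ≤ C * Real.exp (-(3 / 8) * x ^ 2)

lemma IsPolyGauss.isGaussDom {f : ℝ → ℝ} (hf : IsPolyGauss f) : IsGaussDom f :=
  ⟨hf.continuous, hf.exists_le⟩

lemma IsPolyGauss.isGaussDom_mul {f g : ℝ → ℝ} (hf : IsPolyGauss f) (hg : IsPolyGauss g) :
    IsGaussDom (fun x => f x * g x) := by
  obtain ⟨C, hC, h⟩ := hf.exists_le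
  obtain ⟨D, hD, h'⟩ := hg.abs_le
  refine ⟨hf.continuous.mul hg.continuous, C * D, by positivity, fun x => ?_⟩
  rw [abs_mul]
  have := mul_le_mul (h x) (h' x) (abs_nonneg _) (by positivity)
  linarith

lemma one_add_sq_mul_exp_le (x : ℝ) :
    (1 + x ^ 2) * Real.exp (-(3 / 8) * x ^ 2) ≤ 8 * Real.exp (-(1 / 4) * x ^ 2) := by
  have h1 : x ^ 2 / 8 + 1 ≤ Real.exp (x ^ 2 / 8) := Real.add_one_le_exp _
  have h2 : Real.exp (-(1 / 4) * x ^ 2) = Real.exp (x ^ 2 / 8) * Real.exp (-(3 / 8) * x ^ 2) := by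
    rw [← Real.exp_add]; congr 1; ring
  rw [h2, ← mul_assoc]
  refine mul_le_mul_of_nonneg_right ?_ (Real.exp_pos _).le
  nlinarith [sq_nonneg x]

lemma QuadGrowth.nonneg {C : ℝ} {u : ℝ → ℝ → ℝ} (hu : QuadGrowth C u) : 0 ≤ C := by
  have := (abs_nonneg _).trans (hu.2 0 0)
  simpa using this

/-- The function `exp(-x²/4) exp(-y²/4)`. -/
def gaussDom (z : ℝ × ℝ) : ℝ := Real.exp (-(1 / 4) * z.1 ^ 2) * Real.exp (-(1 / 4) * z.2 ^ 2)

lemma memLp_gaussDom : MemLp gaussDom 2 (volume : Measure (ℝ × ℝ)) := by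
  have hq : Continuous fun x : ℝ => Real.exp (-(1 / 4) * x ^ 2) := by fun_prop
  have h := (memLp_tensor hq hq integrable_exp_quarter integrable_exp_quarter).re
  exact h

lemma gaussDom_pos (z : ℝ × ℝ) : 0 < gaussDom z := by unfold gaussDom; positivity

lemma QuadGrowth.abs_le {C A B : ℝ} {u : ℝ → ℝ → ℝ} (hu : QuadGrowth C u) (hA : 0 ≤ A)
    (hB : 0 ≤ B) {s t : ℝ} {z : ℝ × ℝ} (hs : |s| ≤ A * Real.exp (-(3 / 8) * z.1 ^ 2))
    (ht : |t| ≤ B * Real.exp (-(3 / 8) * z.2 ^ 2)) :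
    |u z.1 z.2 * (s * t)| ≤ C * (A * 8) * (B * 8) * gaussDom z := by
  have hC := hu.nonneg
  rw [abs_mul, abs_mul, gaussDom]
  have h1 : |u z.1 z.2| ≤ C * ((1 + z.1 ^ 2) * (1 + z.2 ^ 2)) := by
    refine (hu.2 _ _).trans (mul_le_mul_of_nonneg_left ?_ hC)
    nlinarith [mul_nonneg (sq_nonneg z.1) (sq_nonneg z.2)]
  have h2 : (1 + z.1 ^ 2) * |s| ≤ A * (8 * Real.exp (-(1 / 4) * z.1 ^ 2)) := by
    refine (mul_le_mul_of_nonneg_left hs (by positivity)).trans ?_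
    have := mul_le_mul_of_nonneg_left (one_add_sq_mul_exp_le z.1) hA
    linarith
  have h3 : (1 + z.2 ^ 2) * |t| ≤ B * (8 * Real.exp (-(1 / 4) * z.2 ^ 2)) := by
    refine (mul_le_mul_of_nonneg_left ht (by positivity)).trans ?_
    have := mul_le_mul_of_nonneg_left (one_add_sq_mul_exp_le z.2) hB
    linarith
  calc |u z.1 z.2| * (|s| * |t|)
      ≤ C * ((1 + z.1 ^ 2) * (1 + z.2 ^ 2)) * (|s| * |t|) :=
        mul_le_mul_of_nonneg_right h1 (by positivity)
    _ = C * (((1 + z.1 ^ 2) * |s|) * ((1 + z.2 ^ 2) * |t|)) := by ring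
    _ ≤ C * ((A * (8 * Real.exp (-(1 / 4) * z.1 ^ 2))) *
          (B * (8 * Real.exp (-(1 / 4) * z.2 ^ 2)))) :=
        mul_le_mul_of_nonneg_left (mul_le_mul h2 h3 (by positivity) (by positivity)) hC
    _ = _ := by ring

lemma quadGrowth_one : QuadGrowth 1 (fun _ _ => 1) :=
  ⟨continuous_const, fun x y => by rw [abs_one]; nlinarith [sq_nonneg x, sq_nonneg y]⟩

lemma abs_mul_le_gaussDom {A B : ℝ} (hA : 0 ≤ A) (hB : 0 ≤ B) {s t : ℝ} {z : ℝ × ℝ}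
    (hs : |s| ≤ A * Real.exp (-(3 / 8) * z.1 ^ 2)) (ht : |t| ≤ B * Real.exp (-(3 / 8) * z.2 ^ 2)) :
    |s * t| ≤ (A * 8) * (B * 8) * gaussDom z := by
  have := quadGrowth_one.abs_le hA hB hs ht
  simpa using this

lemma QuadGrowth.exists_le {C : ℝ} {u : ℝ → ℝ → ℝ} (hu : QuadGrowth C u) {f g : ℝ → ℝ}
    (hf : IsGaussDom f) (hg : IsGaussDom g) :
    ∃ K, ∀ z : ℝ × ℝ, |u z.1 z.2 * (f z.1 * g z.2)| ≤ K * gaussDom z := by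
  obtain ⟨_, A, hA, hf⟩ := hf
  obtain ⟨_, B, hB, hg⟩ := hg
  exact ⟨_, fun z => hu.abs_le hA hB (hf z.1) (hg z.2)⟩

lemma continuous_mul_tensor {u : ℝ → ℝ → ℝ} (hu : Continuous fun z : ℝ × ℝ => u z.1 z.2)
    {f g : ℝ → ℝ} (hf : Continuous f) (hg : Continuous g) :
    Continuous fun z : ℝ × ℝ => u z.1 z.2 * (f z.1 * g z.2) :=
  hu.mul ((hf.comp continuous_fst).mul (hg.comp continuous_snd))

lemma QuadGrowth.integrable {C : ℝ} {u : ℝ → ℝ → ℝ} (hu : QuadGrowth C u) {f g : ℝ → ℝ}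
    (hf : IsGaussDom f) (hg : IsGaussDom g) :
    Integrable (fun z : ℝ × ℝ => u z.1 z.2 * (f z.1 * g z.2)) := by
  obtain ⟨K, hK⟩ := hu.exists_le hf hg
  have hi : Integrable fun x : ℝ => Real.exp (-(1 / 4) * x ^ 2) :=
    integrable_exp_neg_mul_sq (by norm_num)
  have h := hi.mul_prod hi
  rw [← Measure.volume_eq_prod] at h
  exact (h.const_mul K).mono' (continuous_mul_tensor hu.1 hf.1 hg.1).aestronglyMeasurable
    (Filter.Eventually.of_forall fun z => hK z)

lemma QuadGrowth.memLp {C : ℝ} {u : ℝ → ℝ → ℝ} (hu : QuadGrowth C u) {f g : ℝ → ℝ}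
    (hf : IsGaussDom f) (hg : IsGaussDom g) :
    MemLp (fun z : ℝ × ℝ => u z.1 z.2 * (f z.1 * g z.2)) 2 volume := by
  obtain ⟨K, hK⟩ := hu.exists_le hf hg
  refine memLp_gaussDom.of_le_mul (c := K)
    (continuous_mul_tensor hu.1 hf.1 hg.1).aestronglyMeasurable
    (Filter.Eventually.of_forall fun z => ?_)
  rw [Real.norm_eq_abs, Real.norm_eq_abs, abs_of_pos (gaussDom_pos z)]
  exact hK z

/-- The matrix elements of the multiplication by `u` in the Hermite basis. -/
def umat (u : ℝ → ℝ → ℝ) (i j : ℕ × ℕ) : ℝ := ∫ z : ℝ × ℝ, u z.1 z.2 * (herm i z * herm j z)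

lemma umat_comm (u : ℝ → ℝ → ℝ) (i j : ℕ × ℕ) : umat u i j = umat u j i := by
  simp only [umat, mul_comm (herm i _)]

lemma umat_swap (u : ℝ → ℝ → ℝ) (i j : ℕ × ℕ) :
    umat (fun x y => u y x) i.swap j.swap = umat u i j := by
  have h := integral_prod_swap (μ := (volume : Measure ℝ)) (ν := (volume : Measure ℝ))
    (fun z : ℝ × ℝ => u z.1 z.2 * (herm i z * herm j z))
  rw [← Measure.volume_eq_prod] at h
  rw [umat, umat, ← h]
  congr 1
  ext z
  simp only [herm, Prod.fst_swap, Prod.snd_swap]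
  ring

lemma integral_deriv_fst_eq_zero {w : ℝ × ℝ → ℝ} {w' : ℝ × ℝ → ℝ}
    (hw : Integrable w) (hw' : Integrable w')
    (h : ∀ x y, HasDerivAt (fun s => w (s, y)) (w' (x, y)) x) : ∫ z, w' z = 0 := by
  have e : ∫ z, w' z = ∫ y, ∫ x, w' (x, y) :=
    integral_prod_symm (μ := volume) (ν := volume) w' hw'
  rw [e]
  have h1 : ∀ᵐ y : ℝ, Integrable (fun x => w (x, y)) :=
    Integrable.prod_left_ae (μ := volume) (ν := volume) hw
  have h2 : ∀ᵐ y : ℝ, Integrable (fun x => w' (x, y)) :=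
    Integrable.prod_left_ae (μ := volume) (ν := volume) hw'
  refine integral_eq_zero_of_ae ?_
  filter_upwards [h1, h2] with y hy1 hy2
  exact integral_eq_zero_of_hasDerivAt_of_integrable (fun x => h x y) hy2 hy1

lemma integral_add_three {α : Type*} [MeasureSpace α] {a b c : α → ℝ} (ha : Integrable a)
    (hb : Integrable b) (hc : Integrable c) :
    ∫ z, (a z + (b z + c z)) = (∫ z, a z) + ((∫ z, b z) + ∫ z, c z) := by
  rw [← integral_add hb hc]
  exact integral_add ha (hb.add hc)

/-- The raising operators on the indices. -/
def up1 : ℕ × ℕ ↪ ℕ × ℕ := ⟨fun i => (i.1 + 1, i.2), fun i j h => by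
  simpa [Prod.ext_iff] using h⟩

/-- The raising operators on the indices. -/
def up2 : ℕ × ℕ ↪ ℕ × ℕ := ⟨fun i => (i.1, i.2 + 1), fun i j h => by
  simpa [Prod.ext_iff] using h⟩

lemma herm_up1 (i : ℕ × ℕ) (z : ℝ × ℝ) :
    herm (up1 i) z = hermiteFn (i.1 + 1) z.1 * hermiteFn i.2 z.2 := rfl

/-- The coefficient `√((k+1)/2)` of the ladder operators. -/
def ladder (k : ℕ) : ℝ := Real.sqrt (((k : ℝ) + 1) / 2)

lemma ladder_sq (k : ℕ) : ladder k ^ 2 = ((k : ℝ) + 1) / 2 := Real.sq_sqrt (by positivity)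

/-- The integral of `∂ₓ(u Φ_{i+1}Φ_j)` vanishes. Adding and subtracting `x` turns the derivatives of
the two Hermite functions into an annihilation of `i + 1` and a creation on `j`. A ladder
coefficient on the row is thereby exchanged for one on the column, up to a term with `∂ₓu`. -/
lemma ladder_mul_umat_fst {C D : ℝ} {u ux : ℝ → ℝ → ℝ} (hu : QuadGrowth C u)
    (hux : QuadGrowth D ux) (hd : ∀ x y, HasDerivAt (fun s => u s y) (ux x y) x) (i j : ℕ × ℕ) :
    2 * ladder i.1 * umat u i j =
      2 * ladder j.1 * umat u (up1 i) (up1 j) - umat ux (up1 i) j := by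
  have hΦ := isPolyGauss_hermiteFn
  have hg := (hΦ i.2).isGaussDom_mul (hΦ j.2)
  have h1 := (hΦ (i.1 + 1)).isGaussDom_mul (hΦ j.1)
  have h2 := (hΦ (i.1 + 1)).deriv.isGaussDom_mul (hΦ j.1)
  have h3 := (hΦ (i.1 + 1)).isGaussDom_mul (hΦ j.1).deriv
  have h4 := (hΦ (i.1)).isGaussDom_mul (hΦ j.1)
  have h5 := (hΦ (i.1 + 1)).isGaussDom_mul (hΦ (j.1 + 1))
  have hI := integral_deriv_fst_eq_zero (hu.integrable h1 hg)
    (w' := fun z => ux z.1 z.2 * ((hermiteFn (i.1 + 1) z.1 * hermiteFn j.1 z.1) *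
        (hermiteFn i.2 z.2 * hermiteFn j.2 z.2)) +
      (u z.1 z.2 * ((deriv (hermiteFn (i.1 + 1)) z.1 * hermiteFn j.1 z.1) *
        (hermiteFn i.2 z.2 * hermiteFn j.2 z.2)) +
      u z.1 z.2 * ((hermiteFn (i.1 + 1) z.1 * deriv (hermiteFn j.1) z.1) *
        (hermiteFn i.2 z.2 * hermiteFn j.2 z.2))))
    ((hux.integrable h1 hg).add ((hu.integrable h2 hg).add (hu.integrable h3 hg))) ?_
  · rw [integral_add_three (hux.integrable h1 hg) (hu.integrable h2 hg) (hu.integrable h3 hg)] at hI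
    have e1 : umat ux (up1 i) j = ∫ z : ℝ × ℝ, ux z.1 z.2 *
        ((hermiteFn (i.1 + 1) z.1 * hermiteFn j.1 z.1) *
        (hermiteFn i.2 z.2 * hermiteFn j.2 z.2)) := by
      rw [umat]; congr 1; ext z; simp only [herm_up1]; simp only [herm]; ring
    have e2 : 2 * ladder i.1 * umat u i j = 2 * ladder j.1 * umat u (up1 i) (up1 j) +
        ((∫ z : ℝ × ℝ, u z.1 z.2 * ((deriv (hermiteFn (i.1 + 1)) z.1 * hermiteFn j.1 z.1) *
        (hermiteFn i.2 z.2 * hermiteFn j.2 z.2))) +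
        ∫ z : ℝ × ℝ, u z.1 z.2 * ((hermiteFn (i.1 + 1) z.1 * deriv (hermiteFn j.1) z.1) *
        (hermiteFn i.2 z.2 * hermiteFn j.2 z.2))) := by
      have e5 : umat u (up1 i) (up1 j) = ∫ z : ℝ × ℝ, u z.1 z.2 *
          ((hermiteFn (i.1 + 1) z.1 * hermiteFn (j.1 + 1) z.1) *
          (hermiteFn i.2 z.2 * hermiteFn j.2 z.2)) := by
        rw [umat]; congr 1; ext z; simp only [herm_up1]; ring
      rw [e5, ← integral_const_mul, ← integral_add_three ((hu.integrable h5 hg).const_mul _)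
        (hu.integrable h2 hg) (hu.integrable h3 hg), umat, ← integral_const_mul]
      congr 1
      ext z
      have a1 := annihilate_hermiteFn i.1 z.1
      have a2 := create_hermiteFn j.1 z.1
      simp only [herm, ladder]
      linear_combination
        (-u z.1 z.2 * hermiteFn j.1 z.1 * hermiteFn i.2 z.2 * hermiteFn j.2 z.2) * a1
        + (u z.1 z.2 * hermiteFn (i.1 + 1) z.1 * hermiteFn i.2 z.2 * hermiteFn j.2 z.2) * a2
    rw [e1, e2]
    linarith
  · intro x y
    have d1 := ((hΦ (i.1 + 1)).differentiable x).hasDerivAt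
    have d2 := ((hΦ j.1).differentiable x).hasDerivAt
    have d3 : HasDerivAt (fun s => u s y * ((hermiteFn (i.1 + 1) s * hermiteFn j.1 s) *
        (hermiteFn i.2 y * hermiteFn j.2 y))) _ x := (hd x y).mul ((d1.mul d2).mul_const _)
    refine d3.congr_deriv ?_
    simp only
    ring

lemma QuadGrowth.swap {C : ℝ} {u : ℝ → ℝ → ℝ} (hu : QuadGrowth C u) :
    QuadGrowth C (fun x y => u y x) :=
  ⟨hu.1.comp continuous_swap, fun x y => (hu.2 y x).trans (le_of_eq (by ring))⟩

lemma ladder_mul_umat_snd {C D : ℝ} {u uy : ℝ → ℝ → ℝ} (hu : QuadGrowth C u)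
    (huy : QuadGrowth D uy) (hd : ∀ x y, HasDerivAt (fun s => u x s) (uy x y) y) (i j : ℕ × ℕ) :
    2 * ladder i.2 * umat u i j =
      2 * ladder j.2 * umat u (up2 i) (up2 j) - umat uy (up2 i) j := by
  have h := ladder_mul_umat_fst hu.swap huy.swap (fun x y => hd y x) i.swap j.swap
  rw [umat_swap] at h
  rw [← umat_swap u (up2 i) (up2 j), ← umat_swap uy (up2 i) j]
  exact h

/-! ### Weighted bounds for multiplication operators and their commutators -/

/-- The weight `j + k + 1` of the Hermite mode `(j, k)`. -/
def lam (i : ℕ × ℕ) : ℝ := (i.1 : ℝ) + i.2 + 1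

lemma one_le_lam (i : ℕ × ℕ) : 1 ≤ lam i := by
  have h1 : (0 : ℝ) ≤ i.1 := Nat.cast_nonneg _
  have h2 : (0 : ℝ) ≤ i.2 := Nat.cast_nonneg _
  rw [lam]; linarith

lemma lam_pos (i : ℕ × ℕ) : 0 < lam i := zero_lt_one.trans_le (one_le_lam i)

lemma lam_swap (i : ℕ × ℕ) : lam i.swap = lam i := by
  simp only [lam, Prod.fst_swap, Prod.snd_swap]; ring

lemma lam_up1 (i : ℕ × ℕ) : lam (up1 i) = lam i + 1 := by
  change ((i.1 + 1 : ℕ) : ℝ) + (i.2 : ℕ) + 1 = _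
  rw [lam]; push_cast; ring

lemma lam_up2 (i : ℕ × ℕ) : lam (up2 i) = lam i + 1 := by
  change ((i.1 : ℕ) : ℝ) + (i.2 + 1 : ℕ) + 1 = _
  rw [lam]; push_cast; ring

lemma ladder_fst_sq_le (i : ℕ × ℕ) : 2 * ladder i.1 ^ 2 ≤ lam i := by
  have h2 : (0 : ℝ) ≤ i.2 := Nat.cast_nonneg _
  rw [ladder_sq, lam]; linarith

lemma ladder_snd_sq_le (i : ℕ × ℕ) : 2 * ladder i.2 ^ 2 ≤ lam i := by
  have h1 : (0 : ℝ) ≤ i.1 := Nat.cast_nonneg _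
  rw [ladder_sq, lam]; linarith

lemma lam_le_ladder_sq (i : ℕ × ℕ) : lam i ≤ 2 * ladder i.1 ^ 2 + 2 * ladder i.2 ^ 2 := by
  rw [ladder_sq, ladder_sq, lam]; linarith

/-- Finite sums of Hermite modes, with injective relabelling. -/
def hsum (F : Finset (ℕ × ℕ)) (J : ℕ × ℕ → ℕ × ℕ) (v : ℕ × ℕ → ℝ) (z : ℝ × ℝ) : ℝ :=
  ∑ j ∈ F, v j * herm (J j) z

/-- The multiplication by `w` is bounded from the weighted space of order `q` to `L²`. -/
def MulBound (w : ℝ → ℝ → ℝ) (q : ℕ) (K : ℝ) : Prop :=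
  ∀ (F : Finset (ℕ × ℕ)) (J : ℕ × ℕ → ℕ × ℕ) (v : ℕ × ℕ → ℝ), InjOn J F →
    ∫ z : ℝ × ℝ, (w z.1 z.2 * hsum F J v z) ^ 2 ≤ K * ∑ j ∈ F, lam (J j) ^ q * v j ^ 2

lemma QuadGrowth.memLp_herm {C : ℝ} {w : ℝ → ℝ → ℝ} (hw : QuadGrowth C w) (i : ℕ × ℕ) :
    MemLp (fun z : ℝ × ℝ => w z.1 z.2 * herm i z) 2 volume :=
  hw.memLp (isPolyGauss_hermiteFn i.1).isGaussDom (isPolyGauss_hermiteFn i.2).isGaussDom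

lemma QuadGrowth.memLp_hsum {C : ℝ} {w : ℝ → ℝ → ℝ} (hw : QuadGrowth C w)
    (F : Finset (ℕ × ℕ)) (J : ℕ × ℕ → ℕ × ℕ) (v : ℕ × ℕ → ℝ) :
    MemLp (fun z : ℝ × ℝ => w z.1 z.2 * hsum F J v z) 2 volume := by
  have e : (fun z : ℝ × ℝ => w z.1 z.2 * hsum F J v z) =
      fun z => ∑ j ∈ F, v j * (w z.1 z.2 * herm (J j) z) := by
    ext z
    rw [hsum, Finset.mul_sum]
    exact Finset.sum_congr rfl fun j _ => by ring
  rw [e]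
  exact memLp_finsetSum _ fun j _ => (hw.memLp_herm (J j)).const_mul (v j)

lemma mulBound_one : MulBound (fun _ _ => 1) 0 1 := by
  classical
  intro F J v hJ
  have e : ∀ z : ℝ × ℝ, (1 * hsum F J v z) ^ 2 =
      ∑ i ∈ F, ∑ j ∈ F, v i * v j * (herm (J i) z * herm (J j) z) := by
    intro z
    rw [one_mul, hsum, pow_two, Finset.sum_mul_sum]
    exact Finset.sum_congr rfl fun i _ => Finset.sum_congr rfl fun j _ => by ring
  have hi : ∀ i j, Integrable (fun z => herm i z * herm j z) := by
    intro i j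
    have h1 : QuadGrowth 1 (fun _ _ => 1) :=
      ⟨continuous_const, fun x y => by rw [abs_one]; nlinarith [sq_nonneg x, sq_nonneg y]⟩
    have h2 := (h1.memLp_herm i).integrable_mul (h1.memLp_herm j)
    refine h2.congr (Filter.Eventually.of_forall fun z => ?_)
    simp only [Pi.mul_apply, one_mul]
  simp only [e]
  rw [integral_finsetSum _ fun i _ => integrable_finsetSum _ fun j _ => (hi _ _).const_mul _]
  simp only [pow_zero, one_mul]
  refine le_of_eq (Finset.sum_congr rfl fun i hi' => ?_)
  rw [integral_finsetSum _ fun j _ => (hi _ _).const_mul _]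
  simp only [integral_const_mul, integral_herm_mul]
  rw [Finset.sum_eq_single i]
  · simp [pow_two]
  · intro j hj hne
    rw [if_neg fun h => hne (hJ hj hi' h.symm), mul_zero]
  · intro h; exact absurd hi' h

lemma MulBound.swap {w : ℝ → ℝ → ℝ} {q : ℕ} {K : ℝ} (h : MulBound w q K) :
    MulBound (fun x y => w y x) q K := by
  intro F J v hJ
  have h1 := h F (fun j => (J j).swap) v (fun i hi j hj hij => hJ hi hj (Prod.swap_injective hij))
  simp only [lam_swap] at h1
  refine le_trans (le_of_eq ?_) h1
  have h2 := integral_prod_swap (μ := (volume : Measure ℝ)) (ν := (volume : Measure ℝ))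
    (fun z : ℝ × ℝ => (w z.1 z.2 * hsum F (fun j => (J j).swap) v z) ^ 2)
  rw [← Measure.volume_eq_prod] at h2
  rw [← h2]
  congr 1
  ext z
  simp only [Prod.fst_swap, Prod.snd_swap, hsum, herm]
  congr 2
  exact Finset.sum_congr rfl fun j _ => by ring

/-- Multiplication by `x` is a raising plus a lowering shift of the modes, each with squared
coefficient at most `λ`. Both shifts are injective relabellings, the lowering one after the modes of
index 0 are dropped, and this is why `MulBound` carries the map `J`. The constant is `2(2^q + 2^q)`,
where `2^q` bounds the growth of `λ^q` under a shift. -/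
lemma MulBound.mul_fst {w : ℝ → ℝ → ℝ} {q : ℕ} {K C D : ℝ} (h : MulBound w q K) (hK : 0 ≤ K)
    (hw : QuadGrowth C w) (hwx : QuadGrowth D (fun x y => w x y * x)) :
    MulBound (fun x y => w x y * x) (q + 1) (4 * 2 ^ q * K) := by
  classical
  intro F J v hJ
  let v₁ : ℕ × ℕ → ℝ := fun j => ladder (J j).1 * v j
  let v₂ : ℕ × ℕ → ℝ := fun j => Real.sqrt (((J j).1 : ℝ) / 2) * v j
  let F₂ := F.filter fun j => (J j).1 ≠ 0
  let J₁ : ℕ × ℕ → ℕ × ℕ := fun j => up1 (J j)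
  let J₂ : ℕ × ℕ → ℕ × ℕ := fun j => ((J j).1 - 1, (J j).2)
  have hJ₁ : InjOn J₁ F := fun i hi j hj hij => hJ hi hj (up1.injective hij)
  have hJ₂ : InjOn J₂ F₂ := by
    intro i hi j hj hij
    simp only [F₂, Finset.coe_filter, mem_ofPred_eq] at hi hj
    refine hJ hi.1 hj.1 ?_
    simp only [J₂, Prod.mk.injEq] at hij
    exact Prod.ext (by have := hi.2; have := hj.2; omega) hij.2
  have e : ∀ z : ℝ × ℝ, w z.1 z.2 * z.1 * hsum F J v z =
      w z.1 z.2 * hsum F J₁ v₁ z + w z.1 z.2 * hsum F₂ J₂ v₂ z := by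
    intro z
    have h2 : hsum F₂ J₂ v₂ z = ∑ j ∈ F, v₂ j * herm (J₂ j) z := by
      rw [hsum, Finset.sum_filter]
      refine Finset.sum_congr rfl fun j _ => ?_
      split_ifs with h0
      · rfl
      · rw [not_not] at h0
        simp [v₂, h0]
    rw [← mul_add, mul_assoc, h2, hsum, hsum, ← Finset.sum_add_distrib, Finset.mul_sum]
    congr 1
    refine Finset.sum_congr rfl fun j _ => ?_
    have := mul_hermiteFn (J j).1 z.1
    simp only [v₁, v₂, J₁, J₂, herm_up1, ladder]
    simp only [herm]
    linear_combination v j * hermiteFn (J j).2 z.2 * this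
  have i1 := (hw.memLp_hsum F J₁ v₁).integrable_sq
  have i2 := (hw.memLp_hsum F₂ J₂ v₂).integrable_sq
  have i3 := (hwx.memLp_hsum F J v).integrable_sq
  have hle : ∫ z : ℝ × ℝ, (w z.1 z.2 * z.1 * hsum F J v z) ^ 2 ≤
      2 * (∫ z : ℝ × ℝ, (w z.1 z.2 * hsum F J₁ v₁ z) ^ 2) +
      2 * ∫ z : ℝ × ℝ, (w z.1 z.2 * hsum F₂ J₂ v₂ z) ^ 2 := by
    rw [← integral_const_mul, ← integral_const_mul,
      ← integral_add (i1.const_mul 2) (i2.const_mul 2)]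
    refine integral_mono i3 ((i1.const_mul 2).add (i2.const_mul 2)) fun z => ?_
    simp only [e]
    nlinarith [sq_nonneg (w z.1 z.2 * hsum F J₁ v₁ z - w z.1 z.2 * hsum F₂ J₂ v₂ z)]
  refine hle.trans ?_
  have b1 := h F J₁ v₁ hJ₁
  have b2 := h F₂ J₂ v₂ hJ₂
  have c1 : ∑ j ∈ F, lam (J₁ j) ^ q * v₁ j ^ 2 ≤
      2 ^ q * ∑ j ∈ F, lam (J j) ^ (q + 1) * v j ^ 2 := by
    rw [Finset.mul_sum]
    refine Finset.sum_le_sum fun j _ => ?_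
    have l1 : lam (J₁ j) ^ q ≤ (2 * lam (J j)) ^ q := by
      refine pow_le_pow_left₀ (lam_pos _).le ?_ _
      have := one_le_lam (J j)
      simp only [J₁, lam_up1]; linarith
    have l2 : v₁ j ^ 2 ≤ lam (J j) * v j ^ 2 := by
      simp only [v₁, mul_pow]
      refine mul_le_mul_of_nonneg_right ?_ (sq_nonneg _)
      have := ladder_fst_sq_le (J j)
      nlinarith [sq_nonneg (ladder (J j).1)]
    calc lam (J₁ j) ^ q * v₁ j ^ 2 ≤ (2 * lam (J j)) ^ q * (lam (J j) * v j ^ 2) :=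
          mul_le_mul l1 l2 (sq_nonneg _) (pow_nonneg (by have := lam_pos (J j); linarith) _)
      _ = _ := by rw [mul_pow]; ring
  have c2 : ∑ j ∈ F₂, lam (J₂ j) ^ q * v₂ j ^ 2 ≤
      2 ^ q * ∑ j ∈ F, lam (J j) ^ (q + 1) * v j ^ 2 := by
    rw [Finset.mul_sum]
    have hpos : ∀ j, 0 ≤ 2 ^ q * (lam (J j) ^ (q + 1) * v j ^ 2) := fun j => by
      have := lam_pos (J j); positivity
    refine le_trans (Finset.sum_le_sum fun j _ => ?_)
      (Finset.sum_le_sum_of_subset_of_nonneg (Finset.filter_subset _ _) fun j _ _ => hpos j)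
    have l1 : lam (J₂ j) ^ q ≤ lam (J j) ^ q := by
      refine pow_le_pow_left₀ (lam_pos _).le ?_ _
      have : (((J j).1 - 1 : ℕ) : ℝ) ≤ (J j).1 := by exact_mod_cast Nat.sub_le _ _
      simp only [J₂, lam]; linarith
    have l2 : v₂ j ^ 2 ≤ lam (J j) * v j ^ 2 := by
      simp only [v₂, mul_pow]
      refine mul_le_mul_of_nonneg_right ?_ (sq_nonneg _)
      rw [Real.sq_sqrt (by positivity), lam]
      have h1 : (0 : ℝ) ≤ (J j).1 := Nat.cast_nonneg _
      have h2 : (0 : ℝ) ≤ (J j).2 := Nat.cast_nonneg _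
      linarith
    have l3 : (1 : ℝ) ≤ 2 ^ q := one_le_pow₀ (by norm_num)
    calc lam (J₂ j) ^ q * v₂ j ^ 2 ≤ lam (J j) ^ q * (lam (J j) * v j ^ 2) :=
          mul_le_mul l1 l2 (sq_nonneg _) (pow_nonneg (lam_pos _).le _)
      _ = 1 * (lam (J j) ^ (q + 1) * v j ^ 2) := by ring
      _ ≤ _ := mul_le_mul_of_nonneg_right l3 (by have := lam_pos (J j); positivity)
  have b1' := b1.trans (mul_le_mul_of_nonneg_left c1 hK)
  have b2' := b2.trans (mul_le_mul_of_nonneg_left c2 hK)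
  linarith

lemma exists_mulBound_monomials : ∃ K, 0 ≤ K ∧
    MulBound (fun x _ => x) 1 K ∧ MulBound (fun _ y => y) 1 K ∧
    MulBound (fun x _ => x ^ 2) 2 K ∧ MulBound (fun _ y => y ^ 2) 2 K := by
  have q1 : QuadGrowth 1 (fun _ _ => 1) :=
    ⟨continuous_const, fun x y => by rw [abs_one]; nlinarith [sq_nonneg x, sq_nonneg y]⟩
  have q2 : QuadGrowth 1 (fun x _ => 1 * x) :=
    ⟨by fun_prop, fun x y => by
      rw [one_mul, abs_le]; constructor <;>
        nlinarith [sq_nonneg (x - 1), sq_nonneg (x + 1), sq_nonneg y]⟩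
  have q3 : QuadGrowth 1 (fun x _ => 1 * x * x) :=
    ⟨by fun_prop, fun x y => by
      rw [abs_le]; constructor <;> nlinarith [sq_nonneg x, sq_nonneg y]⟩
  have h1 := mulBound_one.mul_fst zero_le_one q1 q2
  have h2 := h1.mul_fst (by norm_num) q2 q3
  have mono : ∀ {w : ℝ → ℝ → ℝ} {q : ℕ} {K K' : ℝ}, MulBound w q K → K ≤ K' → MulBound w q K' := by
    intro w q K K' h hK F J v hJ
    refine (h F J v hJ).trans (mul_le_mul_of_nonneg_right hK (Finset.sum_nonneg fun j _ => ?_))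
    have := lam_pos (J j); positivity
  have h1' : MulBound (fun x _ => x) 1 (4 * 2 ^ 1 * (4 * 2 ^ 0 * 1)) := by
    simpa using mono h1 (by norm_num)
  have h2' : MulBound (fun x _ => x ^ 2) 2 (4 * 2 ^ 1 * (4 * 2 ^ 0 * 1)) := by
    simpa [pow_two] using h2
  exact ⟨_, by norm_num, h1', h1'.swap, h2', h2'.swap⟩

lemma MulBound.integral_le {w : ℝ → ℝ → ℝ} {q r : ℕ} {K : ℝ} (h : MulBound w q K) (hqr : q ≤ r)
    (hK : 0 ≤ K) {F : Finset (ℕ × ℕ)} {J : ℕ × ℕ → ℕ × ℕ} (hJ : InjOn J F) (v : ℕ × ℕ → ℝ) :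
    ∫ z : ℝ × ℝ, (w z.1 z.2 * hsum F J v z) ^ 2 ≤ K * ∑ j ∈ F, lam (J j) ^ r * v j ^ 2 :=
  (h F J v hJ).trans (mul_le_mul_of_nonneg_left (Finset.sum_le_sum fun _ _ =>
    mul_le_mul_of_nonneg_right (pow_le_pow_right₀ (one_le_lam _) hqr) (sq_nonneg _)) hK)

/-- Bounds on the level of functions, unlike bounds on matrix entries, are monotone in `|u|`. The
growth of a potential therefore reduces to the monomials `x`, `y`, `x²`, `y²`. -/
lemma exists_mulBound_of_le (q : ℕ) {m₁ m₂ : ℝ → ℝ → ℝ} {K₁ K₂ C₁ C₂ : ℝ} (hK₁ : 0 ≤ K₁)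
    (hK₂ : 0 ≤ K₂) (h₁ : MulBound m₁ q K₁) (h₂ : MulBound m₂ q K₂)
    (hm₁ : QuadGrowth C₁ m₁) (hm₂ : QuadGrowth C₂ m₂) {C D : ℝ}
    {u : ℝ → ℝ → ℝ} (hu : QuadGrowth D u)
    (hle : ∀ x y, |u x y| ≤ C * (1 + |m₁ x y| + |m₂ x y|)) :
    MulBound u q (3 * C ^ 2 * (1 + K₁ + K₂)) := by
  intro F J v hJ
  have q1 : QuadGrowth 1 (fun _ _ => 1) :=
    ⟨continuous_const, fun x y => by rw [abs_one]; nlinarith [sq_nonneg x, sq_nonneg y]⟩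
  have i0 := (q1.memLp_hsum F J v).integrable_sq
  have i1 := (hm₁.memLp_hsum F J v).integrable_sq
  have i2 := (hm₂.memLp_hsum F J v).integrable_sq
  have i3 := (hu.memLp_hsum F J v).integrable_sq
  have b0 := mulBound_one.integral_le (Nat.zero_le q) zero_le_one hJ v
  have b1 := h₁.integral_le le_rfl hK₁ hJ v
  have b2 := h₂.integral_le le_rfl hK₂ hJ v
  have hpt : ∀ z : ℝ × ℝ, (u z.1 z.2 * hsum F J v z) ^ 2 ≤ 3 * C ^ 2 *
      ((1 * hsum F J v z) ^ 2 + ((m₁ z.1 z.2 * hsum F J v z) ^ 2 +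
        (m₂ z.1 z.2 * hsum F J v z) ^ 2)) := by
    intro z
    have h1 : u z.1 z.2 ^ 2 ≤ 3 * C ^ 2 * (1 + (m₁ z.1 z.2 ^ 2 + m₂ z.1 z.2 ^ 2)) := by
      have h2 := pow_le_pow_left₀ (abs_nonneg _) (hle z.1 z.2) 2
      rw [sq_abs, mul_pow] at h2
      refine h2.trans ?_
      have h3 : (1 + |m₁ z.1 z.2| + |m₂ z.1 z.2|) ^ 2 ≤
          3 * (1 + (m₁ z.1 z.2 ^ 2 + m₂ z.1 z.2 ^ 2)) := by
        rw [← sq_abs (m₁ _ _), ← sq_abs (m₂ _ _)]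
        nlinarith [sq_nonneg (1 - |m₁ z.1 z.2|), sq_nonneg (1 - |m₂ z.1 z.2|),
          sq_nonneg (|m₁ z.1 z.2| - |m₂ z.1 z.2|)]
      nlinarith [mul_le_mul_of_nonneg_left h3 (sq_nonneg C)]
    have := mul_le_mul_of_nonneg_right h1 (sq_nonneg (hsum F J v z))
    simp only [mul_pow, one_mul]
    linarith
  have i4 : Integrable (fun z : ℝ × ℝ => 3 * C ^ 2 *
      ((1 * hsum F J v z) ^ 2 + ((m₁ z.1 z.2 * hsum F J v z) ^ 2 +
        (m₂ z.1 z.2 * hsum F J v z) ^ 2))) := (i0.add (i1.add i2)).const_mul (3 * C ^ 2)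
  have hint := integral_mono i3 i4 hpt
  rw [integral_const_mul, integral_add_three i0 i1 i2] at hint
  refine hint.trans ?_
  have : 3 * C ^ 2 * (1 + K₁ + K₂) * ∑ j ∈ F, lam (J j) ^ q * v j ^ 2 = 3 * C ^ 2 *
      (1 * ∑ j ∈ F, lam (J j) ^ q * v j ^ 2 + (K₁ * ∑ j ∈ F, lam (J j) ^ q * v j ^ 2 +
        K₂ * ∑ j ∈ F, lam (J j) ^ q * v j ^ 2)) := by ring
  rw [this]
  exact mul_le_mul_of_nonneg_left (add_le_add b0 (add_le_add b1 b2)) (by positivity)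

/-- Bessel's inequality for the matrix elements of a multiplication operator. -/
lemma MulBound.umat_le {u : ℝ → ℝ → ℝ} {q : ℕ} {K D : ℝ} (h : MulBound u q K)
    (hu : QuadGrowth D u) (F F' : Finset (ℕ × ℕ)) {J : ℕ × ℕ → ℕ × ℕ} (hJ : InjOn J F)
    (v : ℕ × ℕ → ℝ) :
    ∑ i ∈ F', (∑ j ∈ F, umat u i (J j) * v j) ^ 2 ≤ K * ∑ j ∈ F, lam (J j) ^ q * v j ^ 2 := by
  refine le_trans ?_ (h F J v hJ)
  refine le_trans (le_of_eq ?_)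
    (sum_integral_mul_herm_sq_le (w := fun z => u z.1 z.2 * hsum F J v z)
      ((hu.memLp_hsum F J v).ofReal) F')
  refine Finset.sum_congr rfl fun i _ => ?_
  congr 1
  have hΦ := isPolyGauss_hermiteFn
  have hint : ∀ j, Integrable (fun z => u z.1 z.2 * (herm i z * herm (J j) z)) := by
    intro j
    refine (hu.integrable ((hΦ i.1).isGaussDom_mul (hΦ (J j).1))
      ((hΦ i.2).isGaussDom_mul (hΦ (J j).2))).congr (Filter.Eventually.of_forall fun z => ?_)
    simp only [herm]; ring
  simp only [umat]
  have e : ∀ z, u z.1 z.2 * hsum F J v z * herm i z =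
      ∑ j ∈ F, (u z.1 z.2 * (herm i z * herm (J j) z)) * v j := by
    intro z
    rw [hsum, Finset.mul_sum, Finset.sum_mul]
    exact Finset.sum_congr rfl fun j _ => by ring
  simp only [e]
  rw [integral_finsetSum _ fun j _ => (hint j).mul_const _]
  simp only [integral_mul_const]

lemma umat_le_of_linGrowth : ∃ K, 0 ≤ K ∧ ∀ (C : ℝ) (u : ℝ → ℝ → ℝ), LinGrowth 0 C u →
    ∀ (F F' : Finset (ℕ × ℕ)) (J : ℕ × ℕ → ℕ × ℕ) (v : ℕ × ℕ → ℝ), InjOn J F →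
    ∑ i ∈ F', (∑ j ∈ F, umat u i (J j) * v j) ^ 2 ≤
      K * C ^ 2 * ∑ j ∈ F, lam (J j) ^ 1 * v j ^ 2 := by
  obtain ⟨K, hK, hx, hy, -, -⟩ := exists_mulBound_monomials
  refine ⟨3 * (1 + K + K), by positivity, fun C u hu F F' J v hJ => ?_⟩
  have qx : QuadGrowth 1 (fun x _ => x) :=
    ⟨by fun_prop, fun x y => by
      rw [abs_le]; constructor <;>
        nlinarith [sq_nonneg (x - 1), sq_nonneg (x + 1), sq_nonneg y]⟩
  have h := (exists_mulBound_of_le 1 hK hK hx hy qx qx.swap hu.quadGrowth hu.2).umat_le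
    hu.quadGrowth F F' hJ v
  refine h.trans (le_of_eq ?_)
  ring

lemma umat_le_of_quadGrowth : ∃ K, 0 ≤ K ∧ ∀ (C : ℝ) (u : ℝ → ℝ → ℝ), QuadGrowth C u →
    MatBound (umat u) (fun j => lam j ^ 2) (K * C ^ 2) := by
  obtain ⟨K, hK, -, -, hx, hy⟩ := exists_mulBound_monomials
  refine ⟨3 * (1 + K + K), by positivity, fun C u hu F F' v => ?_⟩
  have qx : QuadGrowth 1 (fun x _ => x ^ 2) :=
    ⟨by fun_prop, fun x y => by
      rw [abs_le]; constructor <;> nlinarith [sq_nonneg x, sq_nonneg y]⟩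
  have h := (exists_mulBound_of_le 2 (C := C) hK hK hx hy qx qx.swap hu (fun x y => by
    rw [abs_of_nonneg (sq_nonneg x), abs_of_nonneg (sq_nonneg y)]; exact hu.2 x y)).umat_le
    hu F F' (J := id) (injOn_id _) v
  refine h.trans (le_of_eq ?_)
  simp only [id]
  ring

/-- One step of the induction that controls weighted norms by creation operators. -/
lemma weighted_step {r : ℕ} {K C : ℝ} (hK : 0 ≤ K) {u ux : ℝ → ℝ → ℝ} {e : ℕ × ℕ ↪ ℕ × ℕ}
    {a : ℕ × ℕ → ℝ} (he : ∀ i, lam (e i) = lam i + 1) (ha : ∀ i, 2 * a i ^ 2 ≤ lam i)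
    (hrel : ∀ i j, 2 * a i * umat u i j = 2 * a j * umat u (e i) (e j) - umat ux (e i) j)
    (hbu : ∀ (F F' : Finset (ℕ × ℕ)) (J : ℕ × ℕ → ℕ × ℕ) (v : ℕ × ℕ → ℝ), InjOn J F →
      ∑ i ∈ F', lam i ^ r * (∑ j ∈ F, umat u i (J j) * v j) ^ 2 ≤
        K * C ^ 2 * ∑ j ∈ F, lam (J j) ^ (r + 1) * v j ^ 2)
    (hbx : ∀ (F F' : Finset (ℕ × ℕ)) (J : ℕ × ℕ → ℕ × ℕ) (v : ℕ × ℕ → ℝ), InjOn J F →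
      ∑ i ∈ F', lam i ^ r * (∑ j ∈ F, umat ux i (J j) * v j) ^ 2 ≤
        K * C ^ 2 * ∑ j ∈ F, lam (J j) ^ (r + 1) * v j ^ 2)
    (F F' : Finset (ℕ × ℕ)) (J : ℕ × ℕ → ℕ × ℕ) (v : ℕ × ℕ → ℝ) (hJ : InjOn J F) :
    ∑ i ∈ F', lam i ^ r * (2 * a i ^ 2) * (∑ j ∈ F, umat u i (J j) * v j) ^ 2 ≤
      (2 ^ (r + 2) + 1) * K * C ^ 2 * ∑ j ∈ F, lam (J j) ^ (r + 2) * v j ^ 2 := by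
  -- `hrel` shifts rows and columns together, so the induction hypothesis is needed with the columns
  -- relabelled by `e ∘ J`. This is the reason for the quantifier over `J` in the hypotheses.
  set A : ℕ × ℕ → ℝ := fun i => ∑ j ∈ F, umat u i (e (J j)) * (2 * a (J j) * v j)
  set B : ℕ × ℕ → ℝ := fun i => ∑ j ∈ F, umat ux i (J j) * v j
  have hX : ∀ i, 2 * a i * ∑ j ∈ F, umat u i (J j) * v j = A (e i) - B (e i) := by
    intro i
    simp only [A, B]
    rw [← Finset.sum_sub_distrib, Finset.mul_sum]
    refine Finset.sum_congr rfl fun j _ => ?_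
    linear_combination v j * hrel i (J j)
  have h1 : ∀ i, lam i ^ r * (2 * a i ^ 2) * (∑ j ∈ F, umat u i (J j) * v j) ^ 2 ≤
      lam (e i) ^ r * A (e i) ^ 2 + lam (e i) ^ r * B (e i) ^ 2 := by
    intro i
    have h2 : lam i ^ r ≤ lam (e i) ^ r :=
      pow_le_pow_left₀ (lam_pos i).le (by rw [he]; linarith) r
    have h3 : (2 * a i ^ 2) * (∑ j ∈ F, umat u i (J j) * v j) ^ 2 ≤ A (e i) ^ 2 + B (e i) ^ 2 := by
      have : (2 * a i ^ 2) * (∑ j ∈ F, umat u i (J j) * v j) ^ 2 =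
        (2 * a i * ∑ j ∈ F, umat u i (J j) * v j) ^ 2 / 2 := by ring
      rw [this, hX]
      nlinarith [sq_nonneg (A (e i) + B (e i))]
    rw [mul_assoc, ← mul_add]
    exact mul_le_mul h2 h3 (by positivity) (pow_nonneg (lam_pos _).le _)
  refine (Finset.sum_le_sum fun i _ => h1 i).trans ?_
  rw [Finset.sum_add_distrib, ← Finset.sum_map F' e (fun i => lam i ^ r * A i ^ 2),
    ← Finset.sum_map F' e (fun i => lam i ^ r * B i ^ 2)]
  have hA := hbu F (F'.map e) (fun j => e (J j)) (fun j => 2 * a (J j) * v j)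
    (fun i hi j hj hij => hJ hi hj (e.injective hij))
  have hB := hbx F (F'.map e) J v hJ
  have cA : ∑ j ∈ F, lam (e (J j)) ^ (r + 1) * (2 * a (J j) * v j) ^ 2 ≤
      2 ^ (r + 2) * ∑ j ∈ F, lam (J j) ^ (r + 2) * v j ^ 2 := by
    rw [Finset.mul_sum]
    refine Finset.sum_le_sum fun j _ => ?_
    have l1 : lam (e (J j)) ^ (r + 1) ≤ (2 * lam (J j)) ^ (r + 1) :=
      pow_le_pow_left₀ (lam_pos _).le (by rw [he]; have := one_le_lam (J j); linarith) _
    have l2 : (2 * a (J j) * v j) ^ 2 ≤ 2 * lam (J j) * v j ^ 2 := by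
      have := mul_le_mul_of_nonneg_right (ha (J j)) (sq_nonneg (v j))
      nlinarith
    refine (mul_le_mul l1 l2 (sq_nonneg _)
      (pow_nonneg (by have := lam_pos (J j); linarith) _)).trans
      (le_of_eq ?_)
    rw [mul_pow]; ring
  have cB : ∑ j ∈ F, lam (J j) ^ (r + 1) * v j ^ 2 ≤ ∑ j ∈ F, lam (J j) ^ (r + 2) * v j ^ 2 :=
    Finset.sum_le_sum fun j _ => mul_le_mul_of_nonneg_right
      (pow_le_pow_right₀ (one_le_lam _) (by omega)) (sq_nonneg _)
  have hKC : 0 ≤ K * C ^ 2 := by positivity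
  have := add_le_add (hA.trans (mul_le_mul_of_nonneg_left cA hKC))
    (hB.trans (mul_le_mul_of_nonneg_left cB hKC))
  refine this.trans (le_of_eq ?_)
  ring

/-- Multiplication by a function of linear growth costs half a power of the weight. -/
lemma exists_weighted_umat_le (r : ℕ) : ∃ K, 0 ≤ K ∧ ∀ (C : ℝ) (u : ℝ → ℝ → ℝ),
    LinGrowth r C u → ∀ (F F' : Finset (ℕ × ℕ)) (J : ℕ × ℕ → ℕ × ℕ) (v : ℕ × ℕ → ℝ), InjOn J F →
    ∑ i ∈ F', lam i ^ r * (∑ j ∈ F, umat u i (J j) * v j) ^ 2 ≤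
      K * C ^ 2 * ∑ j ∈ F, lam (J j) ^ (r + 1) * v j ^ 2 := by
  induction r with
  | zero =>
    obtain ⟨K, hK, h⟩ := umat_le_of_linGrowth
    refine ⟨K, hK, fun C u hu F F' J v hJ => ?_⟩
    simpa using h C u hu F F' J v hJ
  | succ r ih =>
    obtain ⟨K, hK, h⟩ := ih
    refine ⟨2 * ((2 ^ (r + 2) + 1) * K), by positivity, fun C u hu F F' J v hJ => ?_⟩
    have hu' := hu.of_succ
    obtain ⟨-, ux, uy, hx, hy, hux, huy⟩ := hu
    have s1 := weighted_step hK lam_up1 ladder_fst_sq_le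
      (ladder_mul_umat_fst hu'.quadGrowth hux.quadGrowth hx) (h C u hu') (h C ux hux) F F' J v hJ
    have s2 := weighted_step hK lam_up2 ladder_snd_sq_le
      (ladder_mul_umat_snd hu'.quadGrowth huy.quadGrowth hy) (h C u hu') (h C uy huy) F F' J v hJ
    -- The extra factor `λ_i` is split into the two ladder coefficients, one for each variable. Each
    -- part is moved to the columns by `weighted_step`.
    have : ∑ i ∈ F', lam i ^ (r + 1) * (∑ j ∈ F, umat u i (J j) * v j) ^ 2 ≤
        ∑ i ∈ F', lam i ^ r * (2 * ladder i.1 ^ 2) * (∑ j ∈ F, umat u i (J j) * v j) ^ 2 +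
        ∑ i ∈ F', lam i ^ r * (2 * ladder i.2 ^ 2) * (∑ j ∈ F, umat u i (J j) * v j) ^ 2 := by
      rw [← Finset.sum_add_distrib]
      refine Finset.sum_le_sum fun i _ => ?_
      rw [← add_mul, ← mul_add, pow_succ]
      refine mul_le_mul_of_nonneg_right ?_ (sq_nonneg _)
      exact mul_le_mul_of_nonneg_left (lam_le_ladder_sq i) (pow_nonneg (lam_pos _).le _)
    refine this.trans ((add_le_add s1 s2).trans (le_of_eq ?_))
    ring

/-! ### The matrix of the Weyl operator -/

lemma MatBound.mono {ι : Type*} {A : ι → ι → ℝ} {w w' : ι → ℝ} {C C' : ℝ} (h : MatBound A w C)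
    (hC : 0 ≤ C) (hCC : C ≤ C') (hw : ∀ i, w i ≤ w' i) (hw0 : ∀ i, 0 ≤ w' i) :
    MatBound A w' C' := by
  intro F F' v
  refine (h F F' v).trans ?_
  refine (mul_le_mul_of_nonneg_left (Finset.sum_le_sum fun j _ =>
    mul_le_mul_of_nonneg_right (hw j) (sq_nonneg (v j))) hC).trans ?_
  exact mul_le_mul_of_nonneg_right hCC
    (Finset.sum_nonneg fun j _ => mul_nonneg (hw0 j) (sq_nonneg _))

lemma MatBound.add {ι : Type*} {A B : ι → ι → ℝ} {w : ι → ℝ} {C D : ℝ} (hA : MatBound A w C)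
    (hB : MatBound B w D) : MatBound (fun i j => A i j + B i j) w (2 * C + 2 * D) := by
  intro F F' v
  have h1 : ∀ i, (∑ j ∈ F, (A i j + B i j) * v j) ^ 2 ≤
      2 * (∑ j ∈ F, A i j * v j) ^ 2 + 2 * (∑ j ∈ F, B i j * v j) ^ 2 := by
    intro i
    simp only [add_mul, Finset.sum_add_distrib]
    nlinarith [sq_nonneg (∑ j ∈ F, A i j * v j - ∑ j ∈ F, B i j * v j)]
  refine (Finset.sum_le_sum fun i _ => h1 i).trans ?_
  rw [Finset.sum_add_distrib, ← Finset.mul_sum, ← Finset.mul_sum]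
  have := hA F F' v
  have := hB F F' v
  linarith

lemma MatBound.mul_right {ι : Type*} {A : ι → ι → ℝ} {w : ι → ℝ} {C : ℝ} (hA : MatBound A w C)
    (a : ι → ℝ) : MatBound (fun i j => A i j * a j) (fun j => w j * a j ^ 2) C := by
  intro F F' v
  have := hA F F' (fun j => a j * v j)
  simpa only [mul_assoc, mul_pow] using this

/-- The relation times `a i`, minus its transpose times `a j`: the doubly shifted entries of `u`
cancel by symmetry, and only entries of the derivative remain. -/
lemma commutator_umat {u ux : ℝ → ℝ → ℝ} {e : ℕ × ℕ ↪ ℕ × ℕ} {a : ℕ × ℕ → ℝ}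
    (hrel : ∀ i j, 2 * a i * umat u i j = 2 * a j * umat u (e i) (e j) - umat ux (e i) j)
    (i j : ℕ × ℕ) :
    (2 * a i ^ 2 - 2 * a j ^ 2) * umat u i j =
      a j * umat ux i (e j) - a i * umat ux (e i) j := by
  have h1 := hrel i j
  have h2 := hrel j i
  rw [umat_comm u j i, umat_comm u (e j) (e i), umat_comm ux (e j) i] at h2
  linear_combination a i * h1 - a j * h2

/-- In `commutator_umat` the ladder coefficient and the derivative of linear growth cost half a
power of `λ` each, together `λ²` in the squared norm. Where the coefficient `a i` sits on the row it
raises the row weight to `λ^{r+1}`, so one derivative more is needed. -/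
lemma weighted_commutator_le (r : ℕ) : ∃ K, 0 ≤ K ∧ ∀ (C : ℝ) (u ux : ℝ → ℝ → ℝ)
    (e : ℕ × ℕ ↪ ℕ × ℕ) (a : ℕ × ℕ → ℝ), LinGrowth (r + 1) C ux →
    (∀ i, lam (e i) = lam i + 1) → (∀ i, 2 * a i ^ 2 ≤ lam i) →
    (∀ i j, 2 * a i * umat u i j = 2 * a j * umat u (e i) (e j) - umat ux (e i) j) →
    ∀ (F F' : Finset (ℕ × ℕ)) (v : ℕ × ℕ → ℝ),
    ∑ i ∈ F', lam i ^ r * (∑ j ∈ F, (2 * a i ^ 2 - 2 * a j ^ 2) * umat u i j * v j) ^ 2 ≤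
      K * C ^ 2 * ∑ j ∈ F, lam j ^ (r + 2) * v j ^ 2 := by
  obtain ⟨K₁, hK₁, h₁⟩ := exists_weighted_umat_le r
  obtain ⟨K₂, hK₂, h₂⟩ := exists_weighted_umat_le (r + 1)
  refine ⟨2 ^ (r + 1) * K₁ + K₂, by positivity, fun C u ux e a hux he ha hrel F F' v => ?_⟩
  have b₁ := h₁ C ux hux.of_succ F F' e (fun j => a j * v j) (e.injective.injOn)
  have b₂ := h₂ C ux hux F (F'.map e) id v (injOn_id _)
  set A : ℕ × ℕ → ℝ := fun i => ∑ j ∈ F, umat ux i (e j) * (a j * v j) with hA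
  set B : ℕ × ℕ → ℝ := fun i => ∑ j ∈ F, umat ux i (id j) * v j with hB
  have hX : ∀ i, ∑ j ∈ F, (2 * a i ^ 2 - 2 * a j ^ 2) * umat u i j * v j =
      A i - a i * B (e i) := by
    intro i
    simp only [hA, hB, id]
    rw [Finset.mul_sum, ← Finset.sum_sub_distrib]
    refine Finset.sum_congr rfl fun j _ => ?_
    rw [commutator_umat hrel]
    ring
  have hpt : ∀ i, lam i ^ r * (∑ j ∈ F, (2 * a i ^ 2 - 2 * a j ^ 2) * umat u i j * v j) ^ 2 ≤
      2 * (lam i ^ r * A i ^ 2) + lam (e i) ^ (r + 1) * B (e i) ^ 2 := by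
    intro i
    rw [hX]
    have hl := lam_pos i
    have l1 : (A i - a i * B (e i)) ^ 2 ≤ 2 * A i ^ 2 + lam i * B (e i) ^ 2 := by
      have := mul_le_mul_of_nonneg_right (ha i) (sq_nonneg (B (e i)))
      nlinarith [sq_nonneg (A i + a i * B (e i))]
    have l2 : lam i ^ (r + 1) ≤ lam (e i) ^ (r + 1) :=
      pow_le_pow_left₀ hl.le (by rw [he]; linarith) _
    have l3 := mul_le_mul_of_nonneg_left l1 (pow_nonneg hl.le r)
    have l4 := mul_le_mul_of_nonneg_right l2 (sq_nonneg (B (e i)))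
    have l5 : lam i ^ r * (lam i * B (e i) ^ 2) = lam i ^ (r + 1) * B (e i) ^ 2 := by ring
    linarith
  refine (Finset.sum_le_sum fun i _ => hpt i).trans ?_
  rw [Finset.sum_add_distrib, ← Finset.mul_sum,
    ← Finset.sum_map F' e (fun i => lam i ^ (r + 1) * B i ^ 2)]
  have c₁ : ∑ j ∈ F, lam (e j) ^ (r + 1) * (a j * v j) ^ 2 ≤
      2 ^ r * ∑ j ∈ F, lam j ^ (r + 2) * v j ^ 2 := by
    rw [Finset.mul_sum]
    refine Finset.sum_le_sum fun j _ => ?_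
    have hl := lam_pos j
    have l1 : lam (e j) ^ (r + 1) ≤ (2 * lam j) ^ (r + 1) :=
      pow_le_pow_left₀ (lam_pos _).le (by rw [he]; have := one_le_lam j; linarith) _
    have l2 : (a j * v j) ^ 2 ≤ (lam j / 2) * v j ^ 2 := by
      rw [mul_pow]
      exact mul_le_mul_of_nonneg_right (by linarith [ha j]) (sq_nonneg _)
    refine (mul_le_mul l1 l2 (sq_nonneg _) (by positivity)).trans (le_of_eq ?_)
    rw [mul_pow]; ring
  have b₁' := b₁.trans (mul_le_mul_of_nonneg_left c₁ (by positivity))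
  simp only [id] at b₂
  have : (2 ^ (r + 1) * K₁ + K₂) * C ^ 2 * ∑ j ∈ F, lam j ^ (r + 2) * v j ^ 2 =
      2 * (K₁ * C ^ 2 * (2 ^ r * ∑ j ∈ F, lam j ^ (r + 2) * v j ^ 2)) +
        K₂ * C ^ 2 * ∑ j ∈ F, lam j ^ (r + 2) * v j ^ 2 := by ring
  rw [this]
  exact add_le_add (by linarith) b₂

/-- Potentials of quadratic growth whose gradient has linear growth, with all derivatives up to
the order `r`. -/
def IsPotential (r : ℕ) (C : ℝ) (u : ℝ → ℝ → ℝ) : Prop :=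
  QuadGrowth C u ∧ ∃ ux uy : ℝ → ℝ → ℝ, (∀ x y, HasDerivAt (fun s => u s y) (ux x y) x) ∧
    (∀ x y, HasDerivAt (fun s => u x s) (uy x y) y) ∧ LinGrowth r C ux ∧ LinGrowth r C uy

/-- `λ` differs by a constant from the sum of the squared ladder coefficients `2a²` in the two
variables, so its commutator is the sum of the two already bounded. -/
lemma weighted_commutator_lam_le (r : ℕ) : ∃ K, 0 ≤ K ∧ ∀ (C : ℝ) (u : ℝ → ℝ → ℝ),
    IsPotential (r + 1) C u → ∀ (F F' : Finset (ℕ × ℕ)) (v : ℕ × ℕ → ℝ),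
    ∑ i ∈ F', lam i ^ r * (∑ j ∈ F, (lam i - lam j) * umat u i j * v j) ^ 2 ≤
      K * C ^ 2 * ∑ j ∈ F, lam j ^ (r + 2) * v j ^ 2 := by
  obtain ⟨K, hK, h⟩ := weighted_commutator_le r
  refine ⟨4 * K, by positivity, fun C u hu F F' v => ?_⟩
  obtain ⟨hq, ux, uy, hx, hy, hux, huy⟩ := hu
  have b₁ := h C u ux up1 _ hux lam_up1 ladder_fst_sq_le
    (ladder_mul_umat_fst hq hux.quadGrowth hx) F F' v
  have b₂ := h C u uy up2 _ huy lam_up2 ladder_snd_sq_le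
    (ladder_mul_umat_snd hq huy.quadGrowth hy) F F' v
  have hpt : ∀ i, lam i ^ r * (∑ j ∈ F, (lam i - lam j) * umat u i j * v j) ^ 2 ≤
      2 * (lam i ^ r * (∑ j ∈ F, (2 * ladder i.1 ^ 2 - 2 * ladder j.1 ^ 2) * umat u i j * v j) ^ 2)
      + 2 * (lam i ^ r *
        (∑ j ∈ F, (2 * ladder i.2 ^ 2 - 2 * ladder j.2 ^ 2) * umat u i j * v j) ^ 2) := by
    intro i
    have e : ∑ j ∈ F, (lam i - lam j) * umat u i j * v j =
        ∑ j ∈ F, (2 * ladder i.1 ^ 2 - 2 * ladder j.1 ^ 2) * umat u i j * v j +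
        ∑ j ∈ F, (2 * ladder i.2 ^ 2 - 2 * ladder j.2 ^ 2) * umat u i j * v j := by
      rw [← Finset.sum_add_distrib]
      refine Finset.sum_congr rfl fun j _ => ?_
      simp only [ladder_sq, lam]
      ring
    rw [e]
    set A := ∑ j ∈ F, (2 * ladder i.1 ^ 2 - 2 * ladder j.1 ^ 2) * umat u i j * v j
    set B := ∑ j ∈ F, (2 * ladder i.2 ^ 2 - 2 * ladder j.2 ^ 2) * umat u i j * v j
    have hl := pow_nonneg (lam_pos i).le r
    have l1 : (A + B) ^ 2 ≤ 2 * A ^ 2 + 2 * B ^ 2 := by nlinarith [sq_nonneg (A - B)]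
    have := mul_le_mul_of_nonneg_left l1 hl
    linarith
  refine (Finset.sum_le_sum fun i _ => hpt i).trans ?_
  rw [Finset.sum_add_distrib, ← Finset.mul_sum, ← Finset.mul_sum]
  linarith

/-- The factorisation `λ_i^s - λ_j^s = ∑_{k<s} λ_i^k (λ_i - λ_j) λ_j^{s-1-k}` reduces to commutators
with `λ` in the row weight `λ^{2k}`. As `k ≤ s - 1`, the order `2k + 1 ≤ 2s - 1` suffices. -/
lemma pow_commutator_umat_le (s : ℕ) : ∃ K, 0 ≤ K ∧ ∀ (C : ℝ) (u : ℝ → ℝ → ℝ),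
    IsPotential (2 * s - 1) C u →
    MatBound (fun i j => (lam i ^ s - lam j ^ s) * umat u i j) (fun j => lam j ^ (2 * s))
      (K * C ^ 2) := by
  choose K hK h using weighted_commutator_lam_le
  refine ⟨s * ∑ k ∈ Finset.range s, K (2 * k),
    mul_nonneg (Nat.cast_nonneg _) (Finset.sum_nonneg fun k _ => hK _), fun C u hu F F' v => ?_⟩
  have hterm : ∀ k ∈ Finset.range s, ∑ i ∈ F', (lam i ^ k *
      ∑ j ∈ F, (lam i - lam j) * umat u i j * (lam j ^ (s - 1 - k) * v j)) ^ 2 ≤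
      K (2 * k) * C ^ 2 * ∑ j ∈ F, lam j ^ (2 * s) * v j ^ 2 := by
    intro k hk
    rw [Finset.mem_range] at hk
    have hu' : IsPotential (2 * k + 1) C u := by
      obtain ⟨hq, ux, uy, hx, hy, hux, huy⟩ := hu
      exact ⟨hq, ux, uy, hx, hy, hux.of_le (by omega), huy.of_le (by omega)⟩
    have b := h (2 * k) C u hu' F F' (fun j => lam j ^ (s - 1 - k) * v j)
    refine le_trans (le_of_eq ?_) (b.trans (le_of_eq ?_))
    · refine Finset.sum_congr rfl fun i _ => ?_
      rw [mul_pow, ← pow_mul, mul_comm k]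
    · congr 1
      refine Finset.sum_congr rfl fun j _ => ?_
      rw [mul_pow, ← pow_mul, ← mul_assoc, ← pow_add]
      congr 2
      omega
  have e : ∀ i, ∑ j ∈ F, (lam i ^ s - lam j ^ s) * umat u i j * v j =
      ∑ k ∈ Finset.range s, lam i ^ k *
        ∑ j ∈ F, (lam i - lam j) * umat u i j * (lam j ^ (s - 1 - k) * v j) := by
    intro i
    simp only [Finset.mul_sum]
    rw [Finset.sum_comm]
    refine Finset.sum_congr rfl fun j _ => ?_
    rw [← geom_sum₂_mul, Finset.sum_mul, Finset.sum_mul, Finset.sum_mul]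
    exact Finset.sum_congr rfl fun k _ => by ring
  have hcs : ∀ i, (∑ j ∈ F, (lam i ^ s - lam j ^ s) * umat u i j * v j) ^ 2 ≤
      s * ∑ k ∈ Finset.range s, (lam i ^ k *
        ∑ j ∈ F, (lam i - lam j) * umat u i j * (lam j ^ (s - 1 - k) * v j)) ^ 2 := by
    intro i
    rw [e]
    simpa using sq_sum_le_card_mul_sum_sq (s := Finset.range s) (f := fun k => lam i ^ k *
        ∑ j ∈ F, (lam i - lam j) * umat u i j * (lam j ^ (s - 1 - k) * v j))
  refine (Finset.sum_le_sum fun i _ => hcs i).trans ?_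
  rw [← Finset.mul_sum, Finset.sum_comm]
  refine (mul_le_mul_of_nonneg_left (Finset.sum_le_sum hterm) (Nat.cast_nonneg s)).trans
    (le_of_eq ?_)
  rw [← Finset.sum_mul, ← Finset.sum_mul]
  ring

/-- The matrix of `d/dx` in the Hermite basis. -/
def dmat (k l : ℕ) : ℝ := if l = k + 1 then ladder k else if k = l + 1 then -ladder l else 0

lemma dmat_anti (k l : ℕ) : dmat k l = -dmat l k := by
  unfold dmat
  split_ifs <;> first | omega | simp

lemma dmat_sq_le (k l : ℕ) : dmat k l ^ 2 ≤ ((l : ℝ) + 1) / 2 := by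
  unfold dmat
  split_ifs with h h'
  · rw [ladder_sq, h]; push_cast; linarith
  · rw [neg_sq, ladder_sq]
  · rw [zero_pow two_ne_zero]; positivity

/-- The matrix of `-∂ₓ∂_y + u` in the Hermite basis. -/
def weylMat (u : ℝ → ℝ → ℝ) (i j : ℕ × ℕ) : ℝ :=
  umat u i j + -(dmat i.1 j.1 * dmat i.2 j.2)

lemma weylMat_comm (u : ℝ → ℝ → ℝ) (i j : ℕ × ℕ) : weylMat u i j = weylMat u j i := by
  rw [weylMat, weylMat, umat_comm, dmat_anti i.1, dmat_anti i.2]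
  ring

/-- The indices that can be coupled by the matrix of `∂ₓ∂_y`. -/
def nbr (i : ℕ × ℕ) : Finset (ℕ × ℕ) := ({i.1 - 1, i.1 + 1} : Finset ℕ) ×ˢ {i.2 - 1, i.2 + 1}

lemma card_nbr_le (i : ℕ × ℕ) : (nbr i).card ≤ 4 := by
  rw [nbr, Finset.card_product]
  exact Nat.mul_le_mul Finset.card_le_two Finset.card_le_two

lemma mem_nbr_symm {i j : ℕ × ℕ} (h : j ∈ nbr i) : i ∈ nbr j := by
  simp only [nbr, Finset.mem_product, Finset.mem_insert, Finset.mem_singleton] at h ⊢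
  omega

lemma mem_nbr_of_dmat_ne {i j : ℕ × ℕ} (h : dmat i.1 j.1 * dmat i.2 j.2 ≠ 0) : j ∈ nbr i := by
  have h1 := left_ne_zero_of_mul h
  have h2 := right_ne_zero_of_mul h
  simp only [nbr, Finset.mem_product, Finset.mem_insert, Finset.mem_singleton]
  unfold dmat at h1 h2
  split_ifs at h1 h2 <;> first | omega | simp at h1 h2

/-- Rows and columns have at most 4 nonzero entries. Cauchy–Schwarz along the rows gives one factor
4, counting the rows that meet a column gives the other. -/
lemma matBound_of_nbr {A : ℕ × ℕ → ℕ × ℕ → ℝ} {s : ℕ} {c : ℝ}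
    (h0 : ∀ i j, A i j ≠ 0 → j ∈ nbr i) (hA : ∀ i j, A i j ^ 2 ≤ c * lam j ^ (2 * s)) :
    MatBound A (fun j => lam j ^ (2 * s)) (16 * c) := by
  intro F F' v
  have h1 : ∀ i, (∑ j ∈ F, A i j * v j) ^ 2 ≤
      ∑ j ∈ F, if j ∈ nbr i then 4 * (c * lam j ^ (2 * s) * v j ^ 2) else 0 := by
    intro i
    have e : ∑ j ∈ F, A i j * v j = ∑ j ∈ F with j ∈ nbr i, A i j * v j := by
      rw [Finset.sum_filter]
      refine Finset.sum_congr rfl fun j _ => ?_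
      split_ifs with h
      · rfl
      · rw [not_imp_comm.1 (h0 i j) h, zero_mul]
    rw [e, ← Finset.sum_filter, ← Finset.mul_sum]
    refine (sq_sum_le_card_mul_sum_sq (s := F.filter fun j => j ∈ nbr i)).trans ?_
    have hc : (((F.filter fun j => j ∈ nbr i).card : ℕ) : ℝ) ≤ 4 := by
      have : (F.filter fun j => j ∈ nbr i).card ≤ (nbr i).card :=
        Finset.card_le_card fun j hj => (Finset.mem_filter.1 hj).2
      exact_mod_cast this.trans (card_nbr_le i)
    refine mul_le_mul hc (Finset.sum_le_sum fun j _ => ?_)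
      (Finset.sum_nonneg fun _ _ => sq_nonneg _) (by norm_num)
    rw [mul_pow]
    exact mul_le_mul_of_nonneg_right (hA i j) (sq_nonneg _)
  refine (Finset.sum_le_sum fun i _ => h1 i).trans ?_
  rw [Finset.sum_comm, Finset.mul_sum]
  refine Finset.sum_le_sum fun j _ => ?_
  rw [← Finset.sum_filter, Finset.sum_const, nsmul_eq_mul]
  have hc : (((F'.filter fun i => j ∈ nbr i).card : ℕ) : ℝ) ≤ 4 := by
    have : (F'.filter fun i => j ∈ nbr i).card ≤ (nbr j).card :=
      Finset.card_le_card fun i hi => mem_nbr_symm (Finset.mem_filter.1 hi).2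
    exact_mod_cast this.trans (card_nbr_le j)
  have hnn : 0 ≤ 4 * (c * lam j ^ (2 * s) * v j ^ 2) := by
    have := (sq_nonneg _).trans (hA j j)
    positivity
  refine (mul_le_mul_of_nonneg_right hc hnn).trans (le_of_eq ?_)
  ring

lemma dmat_mul_sq_le (i j : ℕ × ℕ) : (dmat i.1 j.1 * dmat i.2 j.2) ^ 2 ≤ lam j ^ 2 := by
  have h1 := dmat_sq_le i.1 j.1
  have h2 := dmat_sq_le i.2 j.2
  have h3 : (0 : ℝ) ≤ j.1 := Nat.cast_nonneg _
  have h4 : (0 : ℝ) ≤ j.2 := Nat.cast_nonneg _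
  rw [mul_pow, pow_two (lam j)]
  refine mul_le_mul (h1.trans ?_) (h2.trans ?_) (sq_nonneg _) (lam_pos _).le <;>
  · rw [lam]; linarith

/-- Modes coupled by `∂ₓ∂_y` have weights that differ by at most 2. Hence `λ_i^s - λ_j^s` is of
order `λ_j^{s-1}`, which compensates the entry of order `λ_j`. -/
lemma exists_pow_commutator_dmat_le (s : ℕ) : ∃ K, 0 ≤ K ∧
    MatBound (fun i j => (lam i ^ s - lam j ^ s) * -(dmat i.1 j.1 * dmat i.2 j.2))
      (fun j => lam j ^ (2 * s)) K := by
  refine ⟨16 * (2 * (s * 3 ^ s)) ^ 2, by positivity, matBound_of_nbr ?_ ?_⟩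
  · intro i j h
    exact mem_nbr_of_dmat_ne (neg_ne_zero.1 (right_ne_zero_of_mul h))
  · intro i j
    by_cases hd : dmat i.1 j.1 * dmat i.2 j.2 = 0
    · rw [hd, neg_zero, mul_zero, zero_pow two_ne_zero]
      have := lam_pos j
      positivity
    have hj := lam_pos j
    have hi := lam_pos i
    have hij : |lam i - lam j| ≤ 2 ∧ lam i ≤ 3 * lam j := by
      have hm := mem_nbr_of_dmat_ne hd
      simp only [nbr, Finset.mem_product, Finset.mem_insert, Finset.mem_singleton] at hm
      have h1 : (i.1 : ℝ) ≤ j.1 + 1 ∧ (j.1 : ℝ) ≤ i.1 + 1 := by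
        constructor <;> exact_mod_cast (by omega)
      have h2 : (i.2 : ℝ) ≤ j.2 + 1 ∧ (j.2 : ℝ) ≤ i.2 + 1 := by
        constructor <;> exact_mod_cast (by omega)
      have h3 := one_le_lam j
      simp only [lam, abs_le] at h3 ⊢
      refine ⟨⟨?_, ?_⟩, ?_⟩ <;> linarith
    rcases s with _ | s
    · simp
    have hgeom : |lam i ^ (s + 1) - lam j ^ (s + 1)| ≤
        2 * (((s + 1 : ℕ) : ℝ) * 3 ^ (s + 1)) * lam j ^ s := by
      rw [← geom_sum₂_mul, abs_mul, abs_of_nonneg (Finset.sum_nonneg fun k _ => by positivity)]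
      have hsum : ∑ k ∈ Finset.range (s + 1), lam i ^ k * lam j ^ (s + 1 - 1 - k) ≤
          ((s + 1 : ℕ) : ℝ) * (3 ^ (s + 1) * lam j ^ s) := by
        have := Finset.sum_le_card_nsmul (Finset.range (s + 1))
          (fun k => lam i ^ k * lam j ^ (s + 1 - 1 - k)) (3 ^ (s + 1) * lam j ^ s) ?_
        · simpa using this
        · intro k hk
          rw [Finset.mem_range] at hk
          have l1 : lam i ^ k ≤ (3 * lam j) ^ k := pow_le_pow_left₀ hi.le hij.2 k
          have l2 : (3 : ℝ) ^ k ≤ 3 ^ (s + 1) := pow_le_pow_right₀ (by norm_num) (by omega)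
          have l3 : lam j ^ k * lam j ^ (s + 1 - 1 - k) = lam j ^ s := by
            rw [← pow_add]; congr 1; omega
          calc lam i ^ k * lam j ^ (s + 1 - 1 - k)
              ≤ (3 * lam j) ^ k * lam j ^ (s + 1 - 1 - k) :=
                mul_le_mul_of_nonneg_right l1 (by positivity)
            _ = 3 ^ k * lam j ^ s := by rw [mul_pow, mul_assoc, l3]
            _ ≤ _ := mul_le_mul_of_nonneg_right l2 (by positivity)
      calc _ ≤ ((s + 1 : ℕ) : ℝ) * (3 ^ (s + 1) * lam j ^ s) * 2 :=
            mul_le_mul hsum hij.1 (abs_nonneg _) (by positivity)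
        _ = _ := by ring
    have h1 := pow_le_pow_left₀ (abs_nonneg _) hgeom 2
    rw [sq_abs] at h1
    have h2 := dmat_mul_sq_le i j
    rw [mul_pow, neg_sq]
    refine (mul_le_mul h1 h2 (sq_nonneg _) (sq_nonneg _)).trans (le_of_eq ?_)
    ring

/-- Uniform weighted bounds for the matrix of the Weyl operator and its commutators. -/
lemma exists_weylMat_bounds (p : ℕ) (C : ℝ) : ∃ K, 0 ≤ K ∧ ∀ u : ℝ → ℝ → ℝ,
    IsPotential (2 * p + 1) C u →
    MatBound (weylMat u) (fun j => lam j ^ 2) K ∧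
    ∀ s ≤ p + 1, MatBound (fun i j => (lam i ^ s - lam j ^ s) * weylMat u i j)
      (fun j => lam j ^ (2 * s)) K := by
  obtain ⟨K₀, hK₀, h₀⟩ := umat_le_of_quadGrowth
  choose K₁ hK₁ h₁ using pow_commutator_umat_le
  choose K₂ hK₂ h₂ using exists_pow_commutator_dmat_le
  have hd : MatBound (fun i j : ℕ × ℕ => -(dmat i.1 j.1 * dmat i.2 j.2))
      (fun j => lam j ^ (2 * 1)) (16 * 1) := by
    refine matBound_of_nbr (fun i j h => mem_nbr_of_dmat_ne (neg_ne_zero.1 h)) fun i j => ?_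
    rw [neg_sq, one_mul]
    exact dmat_mul_sq_le i j
  have hs0 : ∀ s, 0 ≤ 2 * (K₁ s * C ^ 2) + 2 * K₂ s := fun s => by
    have := hK₁ s; have := hK₂ s; positivity
  have hw : ∀ (s : ℕ) (i : ℕ × ℕ), 0 ≤ lam i ^ s := fun s i => pow_nonneg (lam_pos i).le s
  refine ⟨(2 * (K₀ * C ^ 2) + 2 * (16 * 1)) +
    ∑ s ∈ Finset.range (p + 2), (2 * (K₁ s * C ^ 2) + 2 * K₂ s), ?_, fun u hu => ⟨?_, ?_⟩⟩
  · have := Finset.sum_nonneg fun s (_ : s ∈ Finset.range (p + 2)) => hs0 s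
    positivity
  · refine ((h₀ C u hu.1).add hd).mono (by positivity) ?_ (fun _ => le_rfl) (hw 2)
    exact le_add_of_nonneg_right (Finset.sum_nonneg fun s _ => hs0 s)
  · intro s hs
    have hu' : IsPotential (2 * s - 1) C u := by
      obtain ⟨hq, ux, uy, hx, hy, hux, huy⟩ := hu
      exact ⟨hq, ux, uy, hx, hy, hux.of_le (by omega), huy.of_le (by omega)⟩
    have h := (h₁ s C u hu').add (h₂ s)
    have h' : MatBound (fun i j => (lam i ^ s - lam j ^ s) * weylMat u i j)
        (fun j => lam j ^ (2 * s)) (2 * (K₁ s * C ^ 2) + 2 * K₂ s) := by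
      simpa only [weylMat, mul_add] using h
    refine h'.mono (hs0 s) ?_ (fun _ => le_rfl) (hw _)
    refine le_add_of_nonneg_of_le (by positivity) ?_
    exact Finset.single_le_sum (f := fun s => 2 * (K₁ s * C ^ 2) + 2 * K₂ s) (fun s _ => hs0 s)
      (Finset.mem_range.2 (show s < p + 2 by omega))

/-! ### The potentials of the von Neumann equation and of its semiclassical limit -/

lemma LinGrowth.mono {r : ℕ} {C D : ℝ} {u : ℝ → ℝ → ℝ} (h : LinGrowth r C u) (hCD : C ≤ D) :
    LinGrowth r D u := by
  induction r generalizing u with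
  | zero => exact ⟨h.1, fun x y => (h.2 x y).trans
      (mul_le_mul_of_nonneg_right hCD (by positivity))⟩
  | succ r ih =>
    obtain ⟨h0, ux, uy, hx, hy, h1, h2⟩ := h
    exact ⟨⟨h0.1, fun x y => (h0.2 x y).trans (mul_le_mul_of_nonneg_right hCD (by positivity))⟩,
      ux, uy, hx, hy, ih h1, ih h2⟩

lemma LinGrowth.const_mul {r : ℕ} {C : ℝ} {u : ℝ → ℝ → ℝ} (h : LinGrowth r C u) {c : ℝ}
    (hc : 0 ≤ c) : LinGrowth r (c * C) (fun x y => c * u x y) := by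
  have hb : ∀ {u : ℝ → ℝ → ℝ}, (∀ x y, |u x y| ≤ C * (1 + |x| + |y|)) →
      ∀ x y, |c * u x y| ≤ c * C * (1 + |x| + |y|) := by
    intro u hu x y
    rw [abs_mul, abs_of_nonneg hc, mul_assoc]
    exact mul_le_mul_of_nonneg_left (hu x y) hc
  induction r generalizing u with
  | zero => exact ⟨continuous_const.mul h.1, hb h.2⟩
  | succ r ih =>
    obtain ⟨h0, ux, uy, hx, hy, h1, h2⟩ := h
    exact ⟨⟨continuous_const.mul h0.1, hb h0.2⟩, _, _, fun x y => (hx x y).const_mul c,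
      fun x y => (hy x y).const_mul c, ih h1, ih h2⟩

/-- `A j` and `B j` stand for the symmetric difference quotient and the average of `V^{(j)}` at `x ±
ħy/2`. Differentiation in `x` preserves the kind and differentiation in `y` exchanges the kinds, so
the family is closed. The limit potential is the case `c = 0`. The power of `1 + c₀` collects the
factors `c` from the `y`-derivatives. -/
lemma isPotential_of_family {m : ℕ} {A B : ℕ → ℝ → ℝ → ℝ} {c c₀ C : ℝ} (hc : 0 ≤ c)
    (hcc : c ≤ c₀) (hC : 0 ≤ C) (hA : ∀ j, 1 ≤ j → j ≤ m + 1 → LinGrowth 0 C (A j))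
    (hB : ∀ j, 1 ≤ j → j ≤ m + 1 → LinGrowth 0 C (B j))
    (hAx : ∀ j, j ≤ m → ∀ x y, HasDerivAt (fun s => A j s y) (A (j + 1) x y) x)
    (hAy : ∀ j, j ≤ m → ∀ x y, HasDerivAt (fun s => A j x s) (B (j + 1) x y) y)
    (hBx : ∀ j, j ≤ m → ∀ x y, HasDerivAt (fun s => B j s y) (B (j + 1) x y) x)
    (hBy : ∀ j, j ≤ m → ∀ x y, HasDerivAt (fun s => B j x s) (c * A (j + 1) x y) y)
    (hQ : QuadGrowth C (A 0)) : IsPotential m (C * (1 + c₀) ^ m) (A 0) := by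
  have hc₀ : 0 ≤ c₀ := hc.trans hcc
  have hone : (1 : ℝ) ≤ 1 + c₀ := by linarith
  have key : ∀ r j, 1 ≤ j → j + r ≤ m + 1 → LinGrowth r (C * (1 + c₀) ^ r) (A j) ∧
      LinGrowth r (C * (1 + c₀) ^ r) (B j) := by
    intro r
    induction r with
    | zero => intro j hj hjm; simpa using ⟨hA j hj hjm, hB j hj hjm⟩
    | succ r ih =>
      intro j hj hjm
      obtain ⟨iA, iB⟩ := ih (j + 1) (by omega) (by omega)
      have h1 : C ≤ C * (1 + c₀) ^ (r + 1) := le_mul_of_one_le_right hC (one_le_pow₀ hone)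
      have h2 : C * (1 + c₀) ^ r ≤ C * (1 + c₀) ^ (r + 1) :=
        mul_le_mul_of_nonneg_left (pow_le_pow_right₀ hone (Nat.le_succ r)) hC
      have h3 : c * (C * (1 + c₀) ^ r) ≤ C * (1 + c₀) ^ (r + 1) := by
        have : 0 ≤ C * (1 + c₀) ^ r := by positivity
        rw [pow_succ]
        nlinarith
      exact ⟨⟨(hA j hj (by omega)).mono h1, _, _, hAx j (by omega), hAy j (by omega),
          iA.mono h2, iB.mono h2⟩,
        ⟨(hB j hj (by omega)).mono h1, _, _, hBx j (by omega), hBy j (by omega),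
          iB.mono h2, (iA.const_mul hc).mono h3⟩⟩
  obtain ⟨kA, kB⟩ := key m 1 le_rfl (by omega)
  refine ⟨⟨hQ.1, fun x y => (hQ.2 x y).trans (mul_le_mul_of_nonneg_right
    (le_mul_of_one_le_right hC (one_le_pow₀ hone)) (by positivity))⟩, A 1, B 1,
    hAx 0 (Nat.zero_le _), hAy 0 (Nat.zero_le _), kA, kB⟩

section

variable {m : ℕ} {V : ℝ → ℝ}

lemma IsAdmissiblePotential.hasDerivAt (hV : IsAdmissiblePotential m V) {n : ℕ} (hn : n ≤ m)
    (x : ℝ) : HasDerivAt (iteratedDeriv n V) (iteratedDeriv (n + 1) V x) x := by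
  rw [iteratedDeriv_succ]
  refine DifferentiableAt.hasDerivAt ?_
  exact (hV.1.differentiable_iteratedDeriv n (by exact_mod_cast Nat.lt_succ_of_le hn)) x

lemma IsAdmissiblePotential.continuous (hV : IsAdmissiblePotential m V) {n : ℕ} (hn : n ≤ m + 1) :
    Continuous (iteratedDeriv n V) :=
  hV.1.continuous_iteratedDeriv n (by exact_mod_cast hn)

lemma IsAdmissiblePotential.exists_bound (hV : IsAdmissiblePotential m V) (hm : 1 ≤ m) :
    ∃ B, 0 ≤ B ∧ (∀ n, 2 ≤ n → n ≤ m + 1 → ∀ x, |iteratedDeriv n V x| ≤ B) ∧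
      ∀ x, |iteratedDeriv 1 V x| ≤ B * (1 + |x|) := by
  have h : ∀ n : ℕ, ∃ B : ℝ, 0 ≤ B ∧ (2 ≤ n → n ≤ m + 1 → ∀ x, |iteratedDeriv n V x| ≤ B) := by
    intro n
    by_cases h2 : 2 ≤ n ∧ n ≤ m + 1
    · obtain ⟨B, hB⟩ := hV.2 n h2.1 h2.2
      exact ⟨B, (abs_nonneg _).trans (hB 0), fun _ _ => hB⟩
    · exact ⟨0, le_rfl, fun h3 h4 => absurd ⟨h3, h4⟩ h2⟩
  choose B hB0 hB using h
  set S := ∑ n ∈ Finset.range (m + 2), B n with hS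
  have hBS : ∀ n, n ≤ m + 1 → B n ≤ S := fun n hn =>
    Finset.single_le_sum (fun n _ => hB0 n) (Finset.mem_range.2 (show n < m + 2 by omega))
  have hS0 : 0 ≤ S := Finset.sum_nonneg fun n _ => hB0 n
  refine ⟨S + |iteratedDeriv 1 V 0|, by positivity, fun n h2 hn x => ?_, fun x => ?_⟩
  · exact (hB n h2 hn x).trans ((hBS n hn).trans (le_add_of_nonneg_right (abs_nonneg _)))
  · have h1 := convex_univ.norm_image_sub_le_of_norm_hasDerivWithin_le (C := S)
      (fun y _ => (hV.hasDerivAt hm y).hasDerivWithinAt)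
      (fun y _ => (hB 2 le_rfl (by omega) y).trans (hBS 2 (by omega))) (mem_univ 0) (mem_univ x)
    rw [Real.norm_eq_abs, Real.norm_eq_abs, sub_zero] at h1
    have h2 : |iteratedDeriv 1 V x| ≤
        |iteratedDeriv 1 V x - iteratedDeriv 1 V 0| + |iteratedDeriv 1 V 0| := by
      simpa using abs_add_le (iteratedDeriv 1 V x - iteratedDeriv 1 V 0) (iteratedDeriv 1 V 0)
    have h3 := mul_nonneg (abs_nonneg (iteratedDeriv 1 V 0)) (abs_nonneg x)
    nlinarith

lemma IsAdmissiblePotential.isPotential_limit {p : ℕ}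
    (hV : IsAdmissiblePotential (2 * (p + 1)) V) :
    ∃ C, IsPotential (2 * p + 1) C (limitPotential V) := by
  obtain ⟨B, hB0, hB, hB1⟩ := hV.exists_bound (by omega)
  refine ⟨B * (1 + 0) ^ (2 * p + 1), ?_⟩
  have e : limitPotential V = fun x y => iteratedDeriv (0 + 1) V x * y := by
    funext x y
    rw [limitPotential, zero_add, iteratedDeriv_one]
  rw [e]
  refine isPotential_of_family (A := fun j x y => iteratedDeriv (j + 1) V x * y)
    (B := fun j x _ => iteratedDeriv j V x) le_rfl le_rfl hB0 ?_ ?_ ?_ ?_ ?_ ?_ ?_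
  · intro j hj hjm
    refine ⟨((hV.continuous (by omega)).comp continuous_fst).mul continuous_snd, fun x y => ?_⟩
    rw [abs_mul]
    refine mul_le_mul (hB _ (by omega) (by omega) x) ?_ (abs_nonneg _) hB0
    linarith [abs_nonneg x]
  · intro j hj hjm
    refine ⟨(hV.continuous (by omega)).comp continuous_fst, fun x y => ?_⟩
    rcases eq_or_lt_of_le hj with rfl | hj
    · refine (hB1 x).trans (mul_le_mul_of_nonneg_left ?_ hB0)
      linarith [abs_nonneg y]
    · refine (hB j (by omega) (by omega) x).trans (le_mul_of_one_le_right hB0 ?_)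
      linarith [abs_nonneg x, abs_nonneg y]
  · intro j hj x y
    exact (hV.hasDerivAt (by omega) x).mul_const y
  · intro j hj x y
    simpa using (hasDerivAt_id y).const_mul (iteratedDeriv (j + 1) V x)
  · intro j hj x y
    exact hV.hasDerivAt (by omega) x
  · intro j hj x y
    simpa using hasDerivAt_const y (iteratedDeriv j V x)
  · refine ⟨((hV.continuous (by omega)).comp continuous_fst).mul continuous_snd, fun x y => ?_⟩
    rw [abs_mul, zero_add]
    refine (mul_le_mul_of_nonneg_right (hB1 x) (abs_nonneg y)).trans ?_
    rw [mul_assoc]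
    refine mul_le_mul_of_nonneg_left ?_ hB0
    nlinarith [sq_nonneg (|x| - |y|), sq_nonneg (|y| - 1), sq_abs x, sq_abs y]

/-- The constant is uniform in `ħ`: the mean value theorem on an interval of length `ħ|y|` cancels
the division by `ħ`. For `j = 2p + 2` this uses the bound on `V^{(2p+3)}`. -/
lemma IsAdmissiblePotential.isPotential_weyl {p : ℕ}
    (hV : IsAdmissiblePotential (2 * (p + 1)) V) (hbar₀ : ℝ) :
    ∃ C, ∀ hbar, 0 < hbar → hbar ≤ hbar₀ → IsPotential (2 * p + 1) C (weylPotential V hbar) := by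
  obtain ⟨B, hB0, hB, hB1⟩ := hV.exists_bound (by omega)
  set C : ℝ := B * (2 * (1 + hbar₀)) with hC
  refine ⟨C * (1 + hbar₀ ^ 2) ^ (2 * p + 1), fun hbar h0 hle => ?_⟩
  have hh0 : 0 < hbar₀ := h0.trans_le hle
  have hC0 : 0 ≤ C := by positivity
  have hBC : B ≤ C := le_mul_of_one_le_right hB0 (by linarith)
  have habs : ∀ y : ℝ, |hbar / 2 * y| ≤ hbar₀ / 2 * |y| := fun y => by
    rw [abs_mul, abs_of_pos (by positivity)]
    exact mul_le_mul_of_nonneg_right (by linarith) (abs_nonneg y)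
  have e : weylPotential V hbar = fun x y =>
      (iteratedDeriv 0 V (x + hbar / 2 * y) - iteratedDeriv 0 V (x - hbar / 2 * y)) / hbar := by
    funext x y
    rw [weylPotential, iteratedDeriv_zero]
  have hcp : Continuous fun z : ℝ × ℝ => z.1 + hbar / 2 * z.2 := by fun_prop
  have hcm : Continuous fun z : ℝ × ℝ => z.1 - hbar / 2 * z.2 := by fun_prop
  have hAc : ∀ j, j ≤ 2 * p + 3 → Continuous fun z : ℝ × ℝ =>
      (iteratedDeriv j V (z.1 + hbar / 2 * z.2) -
        iteratedDeriv j V (z.1 - hbar / 2 * z.2)) / hbar :=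
    fun j hj => (((hV.continuous (by omega)).comp hcp).sub
      ((hV.continuous (by omega)).comp hcm)).div_const _
  -- The derivative is bounded only on `[-ρ, ρ]`, because for `j = 0` it is `V'`, which may grow
  -- linearly.
  have hdiff : ∀ (j : ℕ) (D ρ : ℝ) (x y : ℝ), j ≤ 2 * p + 2 →
      (∀ s, |s| ≤ ρ → |iteratedDeriv (j + 1) V s| ≤ D) → |x| + |hbar / 2 * y| ≤ ρ →
      |(iteratedDeriv j V (x + hbar / 2 * y) - iteratedDeriv j V (x - hbar / 2 * y)) / hbar| ≤
        D * |y| := by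
    intro j D ρ x y hj hD hρ
    have h1 := (convex_Icc (-ρ) ρ).norm_image_sub_le_of_norm_hasDerivWithin_le (C := D)
      (fun s _ => (hV.hasDerivAt (n := j) (by omega) s).hasDerivWithinAt)
      (fun s hs => hD s (abs_le.2 hs)) (x := x - hbar / 2 * y) (y := x + hbar / 2 * y)
      (abs_le.1 ((abs_sub _ _).trans hρ)) (abs_le.1 ((abs_add_le _ _).trans hρ))
    rw [Real.norm_eq_abs, Real.norm_eq_abs,
      show x + hbar / 2 * y - (x - hbar / 2 * y) = hbar * y by ring, abs_mul, abs_of_pos h0] at h1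
    rw [abs_div, abs_of_pos h0, div_le_iff₀ h0]
    linarith
  have dp : ∀ j, j ≤ 2 * p + 2 → ∀ x y, HasDerivAt (fun s => iteratedDeriv j V (s + hbar / 2 * y))
      (iteratedDeriv (j + 1) V (x + hbar / 2 * y)) x := fun j hj x y =>
    (hV.hasDerivAt (by omega) _).comp_add_const x (hbar / 2 * y)
  have dm : ∀ j, j ≤ 2 * p + 2 → ∀ x y, HasDerivAt (fun s => iteratedDeriv j V (s - hbar / 2 * y))
      (iteratedDeriv (j + 1) V (x - hbar / 2 * y)) x := fun j hj x y =>
    (hV.hasDerivAt (by omega) _).comp_sub_const x (hbar / 2 * y)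
  have dp' : ∀ j, j ≤ 2 * p + 2 → ∀ x y, HasDerivAt (fun s => iteratedDeriv j V (x + hbar / 2 * s))
      (iteratedDeriv (j + 1) V (x + hbar / 2 * y) * (hbar / 2)) y := fun j hj x y => by
    have := ((hasDerivAt_id y).const_mul (hbar / 2)).const_add x
    rw [mul_one] at this
    exact (hV.hasDerivAt (by omega) _).comp y this
  have dm' : ∀ j, j ≤ 2 * p + 2 → ∀ x y, HasDerivAt (fun s => iteratedDeriv j V (x - hbar / 2 * s))
      (iteratedDeriv (j + 1) V (x - hbar / 2 * y) * -(hbar / 2)) y := fun j hj x y => by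
    have := ((hasDerivAt_id y).const_mul (hbar / 2)).const_sub x
    rw [mul_one] at this
    exact (hV.hasDerivAt (by omega) _).comp y this
  rw [e]
  -- A derivative in `y` brings out `ħ/2`. From difference to average it cancels against the
  -- normalisations `1/ħ` and `1/2`; from average to difference `ħ²/4` remains.
  refine isPotential_of_family (c := hbar ^ 2 / 4) (A := fun j x y =>
      (iteratedDeriv j V (x + hbar / 2 * y) - iteratedDeriv j V (x - hbar / 2 * y)) / hbar)
    (B := fun j x y =>
      (iteratedDeriv j V (x + hbar / 2 * y) + iteratedDeriv j V (x - hbar / 2 * y)) / 2)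
    (by positivity) (by nlinarith) hC0 ?_ ?_ ?_ ?_ ?_ ?_ ?_
  · intro j hj hjm
    refine ⟨hAc j (by omega), fun x y => ?_⟩
    refine (hdiff j B _ x y (by omega)
      (fun s _ => hB (j + 1) (by omega) (by omega) s) le_rfl).trans ?_
    refine mul_le_mul hBC ?_ (abs_nonneg _) hC0
    linarith [abs_nonneg x]
  · intro j hj hjm
    refine ⟨(((hV.continuous (by omega)).comp hcp).add
      ((hV.continuous (by omega)).comp hcm)).div_const _, fun x y => ?_⟩
    have hb : ∀ s, |s| ≤ |x| + hbar₀ / 2 * |y| →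
        |iteratedDeriv j V s| ≤ C * (1 + |x| + |y|) := by
      intro s hs
      have h2 : |iteratedDeriv j V s| ≤ B * (1 + |s|) := by
        rcases eq_or_lt_of_le hj with rfl | hj
        · exact hB1 s
        · refine (hB j (by omega) (by omega) s).trans (le_mul_of_one_le_right hB0 ?_)
          linarith [abs_nonneg s]
      refine h2.trans ?_
      rw [hC, mul_assoc]
      refine mul_le_mul_of_nonneg_left ?_ hB0
      nlinarith [mul_nonneg hh0.le (abs_nonneg x), mul_nonneg hh0.le (abs_nonneg y),
        abs_nonneg x, abs_nonneg y]
    have h1 := hb (x + hbar / 2 * y) ((abs_add_le _ _).trans (add_le_add le_rfl (habs y)))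
    have h2 := hb (x - hbar / 2 * y) ((abs_sub _ _).trans (add_le_add le_rfl (habs y)))
    rw [abs_div, abs_two, div_le_iff₀ two_pos]
    refine (abs_add_le _ _).trans ?_
    linarith
  · intro j hj x y
    exact ((dp j (by omega) x y).sub (dm j (by omega) x y)).div_const hbar
  · intro j hj x y
    refine (((dp' j (by omega) x y).sub (dm' j (by omega) x y)).div_const hbar).congr_deriv ?_
    field_simp
    ring
  · intro j hj x y
    exact ((dp j (by omega) x y).add (dm j (by omega) x y)).div_const 2
  · intro j hj x y
    refine (((dp' j (by omega) x y).add (dm' j (by omega) x y)).div_const 2).congr_deriv ?_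
    field_simp
    ring
  · refine ⟨hAc 0 (by omega), fun x y => ?_⟩
    refine (hdiff 0 (B * (1 + (|x| + hbar₀ / 2 * |y|))) _ x y (by omega) (fun s hs => ?_)
      (add_le_add le_rfl (habs y))).trans ?_
    · exact (hB1 s).trans (mul_le_mul_of_nonneg_left (by linarith) hB0)
    · rw [hC, mul_assoc, mul_assoc]
      refine mul_le_mul_of_nonneg_left ?_ hB0
      nlinarith [sq_nonneg (|x| - |y|), sq_nonneg (|y| - 1), sq_abs x, sq_abs y,
        mul_nonneg hh0.le (sq_nonneg x), mul_nonneg hh0.le (sq_nonneg y)]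

end

/-! ### Extension of weak formulations to a larger class of test functions -/

section Pairing

variable {α : Type*} [MeasurableSpace α] {μ : Measure α}

lemma integral_mul_eq_inner (u : Lp ℂ 2 μ) {w : α → ℂ} (hw : MemLp w 2 μ) :
    ∫ z, u z * w z ∂μ = inner ℂ (hw.star.toLp _) u := by
  rw [L2.inner_def]
  refine integral_congr_ae ?_
  filter_upwards [hw.star.coeFn_toLp] with z hz
  rw [hz, RCLike.inner_apply]
  simp

lemma norm_integral_mul_le (u : Lp ℂ 2 μ) {w : α → ℂ} (hw : AEStronglyMeasurable w μ) {B : α → ℝ}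
    (hB : MemLp B 2 μ) (hwB : ∀ z, ‖w z‖ ≤ B z) : ‖∫ z, u z * w z ∂μ‖ ≤ ‖hB.toLp B‖ * ‖u‖ := by
  have hm : MemLp w 2 μ := hB.of_le hw (Filter.Eventually.of_forall fun z =>
    (hwB z).trans (le_abs_self _))
  rw [integral_mul_eq_inner u hm]
  refine (norm_inner_le_norm _ _).trans (mul_le_mul_of_nonneg_right ?_ (norm_nonneg _))
  refine Lp.norm_le_norm_of_ae_le ?_
  filter_upwards [hm.star.coeFn_toLp, hB.coeFn_toLp] with z h1 h2
  rw [h1, h2]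
  simpa using (hwB z).trans (le_abs_self _)

lemma continuousOn_integral_mul {R : ℝ → Lp ℂ 2 μ} {s : Set ℝ} (hR : ContinuousOn R s) {w : α → ℂ}
    (hw : MemLp w 2 μ) : ContinuousOn (fun t => ∫ z, R t z * w z ∂μ) s := by
  simp only [integral_mul_eq_inner _ hw]
  exact continuousOn_const.inner hR

lemma tendsto_integral_mul (u : Lp ℂ 2 μ) {w : ℕ → α → ℂ} {w' : α → ℂ}
    (hw : ∀ n, AEStronglyMeasurable (w n) μ) {B : α → ℝ} (hB : MemLp B 2 μ)
    (hwB : ∀ n z, ‖w n z‖ ≤ B z)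
    (hlim : ∀ z, Filter.Tendsto (fun n => w n z) Filter.atTop (nhds (w' z))) :
    Filter.Tendsto (fun n => ∫ z, u z * w n z ∂μ) Filter.atTop (nhds (∫ z, u z * w' z ∂μ)) := by
  refine tendsto_integral_of_dominated_convergence (fun z => ‖u z‖ * B z)
    (fun n => (Lp.aestronglyMeasurable u).mul (hw n)) ((Lp.memLp u).norm.integrable_mul hB)
    (fun n => Filter.Eventually.of_forall fun z => ?_)
    (Filter.Eventually.of_forall fun z => (hlim z).const_mul _)
  rw [norm_mul]
  exact mul_le_mul_of_nonneg_left (hwB n z) (norm_nonneg _)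

/-- A weak evolution equation passes to dominated limits of test functions. -/
lemma hasDerivWithinAt_of_tendsto {R : ℝ → Lp ℂ 2 μ} (hR : ContinuousOn R (Ici 0))
    {w v : ℕ → α → ℂ} {w' v' : α → ℂ} (hw : ∀ n, AEStronglyMeasurable (w n) μ)
    (hv : ∀ n, AEStronglyMeasurable (v n) μ) {B : α → ℝ} (hB : MemLp B 2 μ)
    (hwB : ∀ n z, ‖w n z‖ ≤ B z) (hvB : ∀ n z, ‖v n z‖ ≤ B z)
    (hwlim : ∀ z, Filter.Tendsto (fun n => w n z) Filter.atTop (nhds (w' z)))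
    (hvlim : ∀ z, Filter.Tendsto (fun n => v n z) Filter.atTop (nhds (v' z)))
    (h : ∀ n t, 0 ≤ t → HasDerivWithinAt (fun s => ∫ z, R s z * w n z ∂μ)
      (∫ z, R t z * v n z ∂μ) (Ici 0) t) {t : ℝ} (ht : 0 ≤ t) :
    HasDerivWithinAt (fun s => ∫ z, R s z * w' z ∂μ) (∫ z, R t z * v' z ∂μ) (Ici 0) t := by
  have hmem : ∀ {f : α → ℂ}, AEStronglyMeasurable f μ → (∀ z, ‖f z‖ ≤ B z) → MemLp f 2 μ :=
    fun hf hfB => hB.of_le hf (Filter.Eventually.of_forall fun z =>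
      (hfB z).trans (le_abs_self _))
  have hv'm : AEStronglyMeasurable v' μ :=
    aestronglyMeasurable_of_tendsto_ae Filter.atTop hv (Filter.Eventually.of_forall hvlim)
  have hv'B : ∀ z, ‖v' z‖ ≤ B z := fun z =>
    le_of_tendsto (hvlim z).norm (Filter.Eventually.of_forall fun n => hvB n z)
  -- Composition with `max s 0` extends the pairing continuously to all of `ℝ`, so the fundamental
  -- theorem of calculus also applies at the endpoint 0.
  have hcont : ∀ {f : α → ℂ}, MemLp f 2 μ →
      Continuous fun s => ∫ z, R (max s 0) z * f z ∂μ := fun hf =>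
    (continuousOn_integral_mul hR hf).comp_continuous (f := fun s : ℝ => max s 0) (by fun_prop)
      fun s => le_max_right s 0
  have hQ := hcont (hmem hv'm hv'B)
  -- the integrated equation
  have hint : ∀ x : ℝ, 0 ≤ x → ∫ z, R x z * w' z ∂μ =
      (∫ z, R 0 z * w' z ∂μ) + ∫ s in (0 : ℝ)..x, ∫ z, R (max s 0) z * v' z ∂μ := by
    intro x hx
    have h1 : ∀ n, ∫ s in (0 : ℝ)..x, ∫ z, R (max s 0) z * v n z ∂μ =
        (∫ z, R x z * w n z ∂μ) - ∫ z, R 0 z * w n z ∂μ := by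
      intro n
      refine intervalIntegral.integral_eq_sub_of_hasDeriv_right_of_le hx
        (fun s hs => ((h n s hs.1).continuousWithinAt).mono fun y hy => hy.1) (fun s hs => ?_)
        ((hcont (hmem (hv n) (hvB n))).intervalIntegrable _ _)
      rw [max_eq_left hs.1.le]
      exact (h n s hs.1.le).mono fun y hy => hs.1.le.trans (le_of_lt hy)
    have h2 : Filter.Tendsto (fun n => ∫ s in (0 : ℝ)..x, ∫ z, R (max s 0) z * v n z ∂μ)
        Filter.atTop (nhds (∫ s in (0 : ℝ)..x, ∫ z, R (max s 0) z * v' z ∂μ)) := by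
      have hnc : Continuous fun s => ‖hB.toLp B‖ * ‖R (max s 0)‖ :=
        continuous_const.mul (hR.comp_continuous (f := fun s : ℝ => max s 0) (by fun_prop)
          fun s => le_max_right s 0).norm
      refine intervalIntegral.tendsto_integral_filter_of_dominated_convergence
        (fun s => ‖hB.toLp B‖ * ‖R (max s 0)‖)
        (Filter.Eventually.of_forall fun n =>
          (hcont (hmem (hv n) (hvB n))).aestronglyMeasurable)
        (Filter.Eventually.of_forall fun n => Filter.Eventually.of_forall fun s _ =>
          norm_integral_mul_le _ (hv n) hB (hvB n))
        (hnc.intervalIntegrable _ _) (Filter.Eventually.of_forall fun s _ =>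
          tendsto_integral_mul _ hv hB hvB hvlim)
    simp only [h1] at h2
    have h3 := (tendsto_integral_mul (R x) hw hB hwB hwlim).sub
      (tendsto_integral_mul (R 0) hw hB hwB hwlim)
    rw [← tendsto_nhds_unique h3 h2]
    ring
  have hd := ((hQ.integral_hasStrictDerivAt 0 t).hasDerivAt.const_add
    (∫ z, R 0 z * w' z ∂μ)).hasDerivWithinAt (s := Ici 0)
  simp only [max_eq_left ht] at hd
  exact hd.congr (fun x hx => hint x hx) (hint t ht)

end Pairing

lemma hasCompactSupport_iteratedDeriv {f : ℝ → ℝ} (hf : HasCompactSupport f) (n : ℕ) :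
    HasCompactSupport (iteratedDeriv n f) := by
  induction n with
  | zero => simpa using hf
  | succ n ih => rw [iteratedDeriv_succ]; exact ih.deriv

/-- The smooth functions `g n` converge to `f`, together with all derivatives, and are dominated
by Gaussians. -/
def GaussApprox (g : ℕ → ℝ → ℝ) (f : ℝ → ℝ) : Prop :=
  (∀ n, ContDiff ℝ ∞ (g n)) ∧
    ∀ k, (∃ C, 0 ≤ C ∧ ∀ n x, |iteratedDeriv k (g n) x| ≤ C * Real.exp (-(3 / 8) * x ^ 2)) ∧
      ∀ x, Filter.Tendsto (fun n => iteratedDeriv k (g n) x) Filter.atTop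
        (nhds (iteratedDeriv k f x))

lemma IsPolyGauss.gaussApprox_const {f : ℝ → ℝ} (hf : IsPolyGauss f) :
    GaussApprox (fun _ => f) f := by
  refine ⟨fun _ => hf.contDiff, fun k => ⟨?_, fun x => tendsto_const_nhds⟩⟩
  obtain ⟨C, hC, h⟩ := (hf.iteratedDeriv k).exists_le
  exact ⟨C, hC, fun _ => h⟩

/-- Polynomials times Gaussians are dominated limits, with all derivatives, of smooth compactly
supported functions. -/
lemma IsPolyGauss.exists_approx {f : ℝ → ℝ} (hf : IsPolyGauss f) : ∃ g : ℕ → ℝ → ℝ,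
    (∀ n, HasCompactSupport (g n)) ∧ GaussApprox g f := by
  let χ : ContDiffBump (0 : ℝ) := ⟨1, 2, one_pos, one_lt_two⟩
  have hχ : ContDiff ℝ ∞ χ := χ.contDiff
  set c : ℕ → ℝ := fun n => ((n : ℝ) + 1)⁻¹ with hc
  have hc0 : ∀ n, 0 < c n := fun n => by simp only [hc]; positivity
  -- Dilation by a factor at most 1 does not increase the derivatives of the cutoff, which makes the
  -- Gaussian domination uniform in `n`.
  have hc1 : ∀ n, c n ≤ 1 := fun n => inv_le_one_of_one_le₀ (by linarith [n.cast_nonneg (α := ℝ)])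
  have hcχ : ∀ n, ContDiff ℝ ∞ fun x => χ (c n * x) := fun n => hχ.comp (by fun_prop)
  refine ⟨fun n x => χ (c n * x) * f x, fun n => ?_, fun n => (hcχ n).mul hf.contDiff,
    fun k => ⟨?_, ?_⟩⟩
  · have h := χ.hasCompactSupport.comp_homeomorph (Homeomorph.mulLeft₀ (c n) (hc0 n).ne')
    exact HasCompactSupport.mul_right h
  · have hB : ∀ i, ∃ B, ∀ x, |_root_.iteratedDeriv i χ x| ≤ B := by
      intro i
      have h2 : Continuous (_root_.iteratedDeriv i χ) :=
        hχ.continuous_iteratedDeriv i (by exact_mod_cast le_top)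
      have h3 : HasCompactSupport (_root_.iteratedDeriv i χ) :=
        hasCompactSupport_iteratedDeriv χ.hasCompactSupport i
      exact h3.exists_bound_of_continuous h2
    choose B hB using hB
    have hB0 : ∀ i, 0 ≤ B i := fun i => (abs_nonneg _).trans (hB i 0)
    choose D hD0 hD using fun i => (hf.iteratedDeriv i).exists_le
    refine ⟨∑ i ∈ Finset.range (k + 1), (k.choose i : ℝ) * B i * D (k - i),
      Finset.sum_nonneg fun i _ => by have := hB0 i; have := hD0 (k - i); positivity, fun n x => ?_⟩
    have e := iteratedDeriv_fun_mul (n := k) (x := x)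
      (((hcχ n).contDiffAt (x := x)).of_le (by exact_mod_cast le_top))
      ((hf.contDiff.contDiffAt (x := x)).of_le (by exact_mod_cast le_top))
    rw [e, Finset.sum_mul]
    refine (Finset.abs_sum_le_sum_abs _ _).trans (Finset.sum_le_sum fun i _ => ?_)
    rw [iteratedDeriv_comp_const_mul (hχ.of_le (by exact_mod_cast le_top)), abs_mul, abs_mul]
    have h1 : |c n ^ i • _root_.iteratedDeriv i χ (c n * x)| ≤ B i := by
      rw [smul_eq_mul, abs_mul, abs_of_nonneg (pow_nonneg (hc0 n).le i)]
      exact (mul_le_of_le_one_left (abs_nonneg _) (pow_le_one₀ (hc0 n).le (hc1 n))).trans (hB _ _)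
    rw [Nat.abs_cast, mul_assoc, mul_assoc, mul_assoc]
    exact mul_le_mul_of_nonneg_left (mul_le_mul h1 (hD _ _) (abs_nonneg _) (hB0 i)) (by positivity)
  · intro x
    -- For large `n` the cutoff is 1 on a neighbourhood of `x`, so all derivatives at `x` eventually
    -- agree with those of `f`.
    refine tendsto_const_nhds.congr' ?_
    filter_upwards [Filter.eventually_gt_atTop ⌈|x|⌉₊] with n hn
    refine (Filter.EventuallyEq.iteratedDeriv_eq k ?_).symm
    have h1 : |c n * x| < 1 := by
      rw [abs_mul, abs_of_pos (hc0 n), hc, inv_mul_lt_one₀ (by positivity)]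
      have := Nat.le_ceil |x|
      have : (⌈|x|⌉₊ : ℝ) < n := by exact_mod_cast hn
      linarith
    have h2 : ∀ᶠ y in nhds x, |c n * y| < 1 :=
      (Continuous.tendsto (f := fun y : ℝ => |c n * y|) (by fun_prop) x).eventually_lt_const h1
    filter_upwards [h2] with y hy
    rw [χ.one_of_mem_closedBall, one_mul]
    simpa [χ] using hy.le

lemma iteratedDeriv_ofReal {f : ℝ → ℝ} (hf : ContDiff ℝ ∞ f) (n : ℕ) (x : ℝ) :
    iteratedDeriv n (fun s => (f s : ℂ)) x = ((iteratedDeriv n f x : ℝ) : ℂ) := by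
  induction n generalizing x with
  | zero => simp
  | succ n ih =>
    rw [iteratedDeriv_succ, iteratedDeriv_succ, show iteratedDeriv n (fun s => (f s : ℂ)) =
      fun s => ((iteratedDeriv n f s : ℝ) : ℂ) from funext ih]
    exact (((hf.differentiable_iteratedDeriv n (by exact_mod_cast ENat.natCast_lt_top n))
      x).hasDerivAt.ofReal_comp).deriv

lemma partialXY_tensor {f g : ℝ → ℝ} (hf : ContDiff ℝ ∞ f) (hg : ContDiff ℝ ∞ g) (b β : ℕ)
    (z : ℝ × ℝ) : partialXY b β (fun z => ((f z.1 * g z.2 : ℝ) : ℂ)) z =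
      ((iteratedDeriv b f z.1 * iteratedDeriv β g z.2 : ℝ) : ℂ) := by
  simp only [partialXY, Complex.ofReal_mul]
  simp only [iteratedDeriv_const_mul_field, iteratedDeriv_ofReal hg]
  rw [← iteratedDeriv_ofReal hf, mul_comm, ← iteratedDeriv_const_mul_field]
  simp only [mul_comm]

lemma isTest_ofReal {f : ℝ → ℝ} (hf : ContDiff ℝ ∞ f) (hf' : HasCompactSupport f) :
    IsTest (fun x => (f x : ℂ)) :=
  ⟨Complex.ofRealCLM.contDiff.comp hf, hf'.comp_left Complex.ofReal_zero⟩

lemma isTest_tensor {f g : ℝ → ℝ} (hf : ContDiff ℝ ∞ f) (hg : ContDiff ℝ ∞ g)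
    (hf' : HasCompactSupport f) (hg' : HasCompactSupport g) :
    IsTest (fun z : ℝ × ℝ => ((f z.1 * g z.2 : ℝ) : ℂ)) := by
  refine ⟨Complex.ofRealCLM.contDiff.comp
    ((hf.comp contDiff_fst).mul (hg.comp contDiff_snd)), ?_⟩
  refine HasCompactSupport.intro (hf'.isCompact.prod hg'.isCompact) fun z hz => ?_
  by_cases h1 : z.1 ∈ tsupport f
  · have h2 : z.2 ∉ tsupport g := fun h2 => hz ⟨h1, h2⟩
    simp [image_eq_zero_of_notMem_tsupport h2]
  · simp [image_eq_zero_of_notMem_tsupport h1]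

lemma IsWeakPartial.integral_tensor {b β : ℕ} {F G : L2xy} (h : IsWeakPartial b β F G)
    {f g : ℝ → ℝ} (hf : IsPolyGauss f) (hg : IsPolyGauss g) :
    ∫ z, F z * ((iteratedDeriv b f z.1 * iteratedDeriv β g z.2 : ℝ) : ℂ) =
      (-1 : ℂ) ^ (b + β) * ∫ z, G z * ((f z.1 * g z.2 : ℝ) : ℂ) := by
  obtain ⟨f', hfc, hf', hfb⟩ := hf.exists_approx
  obtain ⟨g', hgc, hg', hgb⟩ := hg.exists_approx
  have key : ∀ (u : L2xy) (k l : ℕ), Filter.Tendsto (fun n => ∫ z, u z *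
      ((iteratedDeriv k (f' n) z.1 * iteratedDeriv l (g' n) z.2 : ℝ) : ℂ)) Filter.atTop
      (nhds (∫ z, u z * ((iteratedDeriv k f z.1 * iteratedDeriv l g z.2 : ℝ) : ℂ))) := by
    intro u k l
    obtain ⟨⟨A, hA, hfk⟩, hflim⟩ := hfb k
    obtain ⟨⟨B, hB, hgl⟩, hglim⟩ := hgb l
    refine tendsto_integral_mul u (fun n => ?_) (memLp_gaussDom.const_mul ((A * 8) * (B * 8)))
      (fun n z => ?_) fun z => ?_
    · have h1 := (hf' n).continuous_iteratedDeriv k (by exact_mod_cast le_top)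
      have h2 := (hg' n).continuous_iteratedDeriv l (by exact_mod_cast le_top)
      exact Continuous.aestronglyMeasurable (by fun_prop)
    · rw [Complex.norm_real]
      exact abs_mul_le_gaussDom hA hB (hfk n z.1) (hgl n z.2)
    · exact (Complex.continuous_ofReal.tendsto _).comp ((hflim z.1).mul (hglim z.2))
  have h1 := key F b β
  have h2 := (key G 0 0).const_mul ((-1 : ℂ) ^ (b + β))
  simp only [iteratedDeriv_zero] at h2
  refine tendsto_nhds_unique h1 (h2.congr fun n => ?_)
  rw [← h _ (isTest_tensor (hf' n) (hg' n) (hfc n) (hgc n))]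
  refine integral_congr_ae (Filter.Eventually.of_forall fun z => ?_)
  simp only [partialXY_tensor (hf' n) (hg' n)]

/-- The operator `-∂ₓ∂_y + u` applied to `f(x) g(y)`. -/
def weylOp (u : ℝ → ℝ → ℝ) (f g : ℝ → ℝ) (z : ℝ × ℝ) : ℝ :=
  -(deriv f z.1 * deriv g z.2) + u z.1 z.2 * (f z.1 * g z.2)

lemma memLp_weylOp {C : ℝ} {u : ℝ → ℝ → ℝ} (hu : QuadGrowth C u) {f g : ℝ → ℝ}
    (hf : IsGaussDom f) (hf' : IsGaussDom (deriv f)) (hg : IsGaussDom g)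
    (hg' : IsGaussDom (deriv g)) : MemLp (fun z => (weylOp u f g z : ℂ)) 2 volume := by
  refine (((quadGrowth_one.memLp hf' hg').neg.add (hu.memLp hf hg)).ofReal (K := ℂ)).ae_eq
    (Filter.Eventually.of_forall fun z => ?_)
  simp [weylOp]

/-- The weak equation passes to the limit for any dominated approximation of the two factors. For
Weyl solutions both factors are cut off; for the truncated system only the factor in `x` is. -/
lemma hasDerivWithinAt_tensor_of_approx {C : ℝ} {U : ℝ → ℝ → ℝ} (hU : QuadGrowth C U)
    {R : ℝ → L2xy} (hR : ContinuousOn R (Ici 0)) {f g : ℝ → ℝ} {f' g' : ℕ → ℝ → ℝ}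
    (hf : GaussApprox f' f) (hg : GaussApprox g' g)
    (h : ∀ n t, 0 ≤ t → HasDerivWithinAt (fun s => ∫ z, R s z * ((f' n z.1 * g' n z.2 : ℝ) : ℂ))
      (-Complex.I * ∫ z, R t z * (weylOp U (f' n) (g' n) z : ℂ)) (Ici 0) t)
    {t : ℝ} (ht : 0 ≤ t) :
    HasDerivWithinAt (fun s => ∫ z, R s z * ((f z.1 * g z.2 : ℝ) : ℂ))
      (-Complex.I * ∫ z, R t z * (weylOp U f g z : ℂ)) (Ici 0) t := by
  obtain ⟨hf', hfb⟩ := hf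
  obtain ⟨hg', hgb⟩ := hg
  obtain ⟨⟨A₀, hA₀, hf0⟩, hf0lim⟩ := hfb 0
  obtain ⟨⟨A₁, hA₁, hf1⟩, hf1lim⟩ := hfb 1
  obtain ⟨⟨B₀, hB₀, hg0⟩, hg0lim⟩ := hgb 0
  obtain ⟨⟨B₁, hB₁, hg1⟩, hg1lim⟩ := hgb 1
  simp only [iteratedDeriv_zero, iteratedDeriv_one] at *
  have hC := hU.nonneg
  set K := A₀ * 8 * (B₀ * 8) + A₁ * 8 * (B₁ * 8) + C * (A₀ * 8) * (B₀ * 8) with hK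
  have hf'c : ∀ n, Continuous (f' n) := fun n => (hf' n).continuous
  have hg'c : ∀ n, Continuous (g' n) := fun n => (hg' n).continuous
  have hf'd : ∀ n, Continuous (deriv (f' n)) := fun n =>
    (hf' n).continuous_deriv (by exact_mod_cast le_top)
  have hg'd : ∀ n, Continuous (deriv (g' n)) := fun n =>
    (hg' n).continuous_deriv (by exact_mod_cast le_top)
  have hcont : ∀ n, Continuous (weylOp U (f' n) (g' n)) := fun n =>
    (((hf'd n).comp continuous_fst).mul ((hg'd n).comp continuous_snd)).neg.add
      (continuous_mul_tensor hU.1 (hf'c n) (hg'c n))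
  have hI : ∀ f g t, -Complex.I * ∫ z, R t z * (weylOp U f g z : ℂ) =
      ∫ z, R t z * (-Complex.I * (weylOp U f g z : ℂ)) := by
    intro f g t
    rw [← integral_const_mul]
    congr 1; ext z; ring
  rw [hI]
  refine hasDerivWithinAt_of_tendsto hR
    (w := fun n z => ((f' n z.1 * g' n z.2 : ℝ) : ℂ))
    (v := fun n z => -Complex.I * (weylOp U (f' n) (g' n) z : ℂ))
    (fun n => ?_) (fun n => ?_) (memLp_gaussDom.const_mul K) (fun n z => ?_) (fun n z => ?_)
    (fun z => ?_) (fun z => ?_) (fun n t ht => ?_) ht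
  · have := hf'c n
    have := hg'c n
    exact Continuous.aestronglyMeasurable (by fun_prop)
  · have := hcont n
    exact Continuous.aestronglyMeasurable (by fun_prop)
  · rw [Complex.norm_real]
    refine (abs_mul_le_gaussDom hA₀ hB₀ (hf0 n z.1) (hg0 n z.2)).trans
      (mul_le_mul_of_nonneg_right ?_ (gaussDom_pos z).le)
    rw [hK, add_assoc]
    exact le_add_of_nonneg_right (by positivity)
  · rw [norm_mul, norm_neg, Complex.norm_I, one_mul, Complex.norm_real, weylOp]
    refine (norm_add_le _ _).trans ?_
    rw [norm_neg]
    refine (add_le_add (abs_mul_le_gaussDom hA₁ hB₁ (hf1 n z.1) (hg1 n z.2))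
      (hU.abs_le hA₀ hB₀ (hf0 n z.1) (hg0 n z.2))).trans ?_
    rw [← add_mul]
    refine mul_le_mul_of_nonneg_right ?_ (gaussDom_pos z).le
    rw [hK, add_assoc]
    exact le_add_of_nonneg_left (by positivity)
  · exact (Complex.continuous_ofReal.tendsto _).comp ((hf0lim z.1).mul (hg0lim z.2))
  · exact ((Complex.continuous_ofReal.tendsto _).comp
      (((hf1lim z.1).mul (hg1lim z.2)).neg.add
        (((hf0lim z.1).mul (hg0lim z.2)).const_mul _))).const_mul _
  · rw [← hI]
    exact h n t ht

lemma IsWeylSolution.hasDerivWithinAt_tensor {C : ℝ} {U : ℝ → ℝ → ℝ} (hU : QuadGrowth C U)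
    {Rin : L2xy} {R : ℝ → L2xy} (hR : IsWeylSolution U Rin R) {f g : ℝ → ℝ} (hf : IsPolyGauss f)
    (hg : IsPolyGauss g) {t : ℝ} (ht : 0 ≤ t) :
    HasDerivWithinAt (fun s => ∫ z, R s z * ((f z.1 * g z.2 : ℝ) : ℂ))
      (-Complex.I * ∫ z, R t z * (weylOp U f g z : ℂ)) (Ici 0) t := by
  obtain ⟨f', hfc, hf'⟩ := hf.exists_approx
  obtain ⟨g', hgc, hg'⟩ := hg.exists_approx
  refine hasDerivWithinAt_tensor_of_approx hU hR.continuousOn hf' hg' (fun n t ht => ?_) ht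
  refine (hR.weak_eq _ (isTest_tensor (hf'.1 n) (hg'.1 n) (hfc n) (hgc n)) t ht).congr_deriv ?_
  rw [← integral_const_mul]
  refine integral_congr_ae (Filter.Eventually.of_forall fun z => ?_)
  simp only [partialXY_tensor (hf'.1 n) (hg'.1 n), iteratedDeriv_one, weylOp]
  push_cast
  ring

lemma integral_hermiteFn_mul_deriv (k l : ℕ) :
    ∫ y, hermiteFn k y * deriv (hermiteFn l) y = dmat k l := by
  have hΦ := isPolyGauss_hermiteFn
  have e : ∀ y, hermiteFn k y * deriv (hermiteFn l) y =
      Real.sqrt ((l : ℝ) / 2) * (hermiteFn k y * hermiteFn (l - 1) y) -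
        Real.sqrt (((l : ℝ) + 1) / 2) * (hermiteFn k y * hermiteFn (l + 1) y) := by
    intro y; rw [deriv_hermiteFn]; ring
  simp only [e]
  rw [integral_sub (((hΦ k).integrable_mul (hΦ _)).const_mul _)
    (((hΦ k).integrable_mul (hΦ _)).const_mul _), integral_const_mul, integral_const_mul,
    integral_hermiteFn_mul, integral_hermiteFn_mul, dmat]
  rcases l with _ | l
  · have : (0 : ℕ) ≠ k + 1 := by omega
    by_cases h1 : k = 1 <;> simp [ladder, h1]
  · by_cases h1 : l = k
    · subst h1
      have : l ≠ l + 1 + 1 := by omega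
      simp [ladder, this]
    · have h2 : k ≠ l := Ne.symm h1
      by_cases h3 : k = l + 1 + 1
      · subst h3
        simp [ladder, h2]
      · simp [h1, h2, h3]

lemma integral_weylOp_mul_herm {C : ℝ} {u : ℝ → ℝ → ℝ} (hu : QuadGrowth C u) (i j : ℕ × ℕ) :
    ∫ z, weylOp u (hermiteFn i.1) (hermiteFn i.2) z * herm j z = weylMat u i j := by
  have hΦ := isPolyGauss_hermiteFn
  have e : ∀ z : ℝ × ℝ, weylOp u (hermiteFn i.1) (hermiteFn i.2) z * herm j z =
      u z.1 z.2 * (herm i z * herm j z) -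
      ((hermiteFn j.1 z.1 * deriv (hermiteFn i.1) z.1) *
        (hermiteFn j.2 z.2 * deriv (hermiteFn i.2) z.2)) := by
    intro z; simp only [weylOp, herm]; ring
  simp only [e]
  have h1 := integral_prod_mul (μ := (volume : Measure ℝ)) (ν := (volume : Measure ℝ))
    (fun x => hermiteFn j.1 x * deriv (hermiteFn i.1) x)
    (fun y => hermiteFn j.2 y * deriv (hermiteFn i.2) y)
  rw [← Measure.volume_eq_prod] at h1
  have h2 := ((hΦ j.1).integrable_mul (hΦ i.1).deriv).mul_prod
    ((hΦ j.2).integrable_mul (hΦ i.2).deriv)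
  rw [← Measure.volume_eq_prod] at h2
  have h3 : Integrable fun z : ℝ × ℝ => u z.1 z.2 * (herm i z * herm j z) := by
    refine (hu.integrable ((hΦ i.1).isGaussDom_mul (hΦ j.1))
      ((hΦ i.2).isGaussDom_mul (hΦ j.2))).congr (Filter.Eventually.of_forall fun z => ?_)
    simp only [herm]; ring
  rw [integral_sub h3 h2, h1, integral_hermiteFn_mul_deriv,
    integral_hermiteFn_mul_deriv, weylMat, umat, dmat_anti i.1, dmat_anti i.2]
  ring

/-! ### Solutions of the truncated system -/

lemma norm_sq_eq_integral {α : Type*} [MeasurableSpace α] {μ : Measure α} (u : Lp ℂ 2 μ) :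
    ‖u‖ ^ 2 = ∫ z, ‖u z‖ ^ 2 ∂μ := by
  have h : ((‖u‖ ^ 2 : ℝ) : ℂ) = ((∫ z, ‖u z‖ ^ 2 ∂μ : ℝ) : ℂ) := by
    rw [← integral_complex_ofReal, Complex.ofReal_pow]
    refine (inner_self_eq_norm_sq_to_K (𝕜 := ℂ) u).symm.trans ?_
    rw [L2.inner_def]
    refine integral_congr_ae (Filter.Eventually.of_forall fun z => ?_)
    simp only [inner_self_eq_norm_sq_to_K]
    push_cast
    rfl
  exact_mod_cast h

lemma ae_fst {p : ℝ → Prop} (h : ∀ᵐ x : ℝ, p x) : ∀ᵐ z : ℝ × ℝ, p z.1 :=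
  (Measure.quasiMeasurePreserving_fst (μ := (volume : Measure ℝ))
    (ν := (volume : Measure ℝ))).ae h

lemma memLp_mul_hermiteFn (r : L2x) (k : ℕ) :
    MemLp (fun z : ℝ × ℝ => r z.1 * (hermiteFn k z.2 : ℂ)) 2 volume := by
  have hc := (isPolyGauss_hermiteFn k).continuous
  have h1 : AEStronglyMeasurable (fun z : ℝ × ℝ => r z.1) volume :=
    (Lp.aestronglyMeasurable r).comp_quasiMeasurePreserving
      (Measure.quasiMeasurePreserving_fst (μ := (volume : Measure ℝ))
        (ν := (volume : Measure ℝ)))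
  have h2 : AEStronglyMeasurable (fun z : ℝ × ℝ => (hermiteFn k z.2 : ℂ)) volume :=
    Continuous.aestronglyMeasurable (by fun_prop)
  refine (memLp_two_iff_integrable_sq_norm (h1.mul h2)).2 ?_
  have h := ((Lp.memLp r).integrable_norm_pow two_ne_zero).mul_prod
    (isPolyGauss_hermiteFn k).memLp.integrable_sq
  rw [← Measure.volume_eq_prod] at h
  refine h.congr (Filter.Eventually.of_forall fun z => ?_)
  simp only [Pi.mul_apply, norm_mul, Complex.norm_real, Real.norm_eq_abs, mul_pow, sq_abs]

/-- The map `r ↦ r(x) Φ_k(y)`. -/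
def mulHermite (k : ℕ) : L2x →L[ℂ] L2xy :=
  LinearMap.mkContinuous
    { toFun := fun r => (memLp_mul_hermiteFn r k).toLp _
      map_add' := fun r s => by
        refine Lp.ext ?_
        filter_upwards [(memLp_mul_hermiteFn (r + s) k).coeFn_toLp,
          Lp.coeFn_add ((memLp_mul_hermiteFn r k).toLp _) ((memLp_mul_hermiteFn s k).toLp _),
          (memLp_mul_hermiteFn r k).coeFn_toLp, (memLp_mul_hermiteFn s k).coeFn_toLp,
          ae_fst (Lp.coeFn_add r s)] with z h1 h2 h3 h4 h5
        rw [h1, h2, Pi.add_apply, h3, h4, h5, Pi.add_apply, add_mul]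
      map_smul' := fun c r => by
        refine Lp.ext ?_
        filter_upwards [(memLp_mul_hermiteFn (c • r) k).coeFn_toLp,
          Lp.coeFn_smul c ((memLp_mul_hermiteFn r k).toLp _),
          (memLp_mul_hermiteFn r k).coeFn_toLp, ae_fst (Lp.coeFn_smul c r)] with z h1 h2 h3 h4
        rw [h1, RingHom.id_apply, h2, Pi.smul_apply, h3, h4, Pi.smul_apply, smul_eq_mul,
          smul_eq_mul, mul_assoc] } 1 (fun r => by
    rw [one_mul, ← abs_of_nonneg (norm_nonneg r), ← abs_of_nonneg (norm_nonneg (_ : L2xy)),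
      ← sq_le_sq, norm_sq_eq_integral, norm_sq_eq_integral]
    have h1 := integral_prod_mul (μ := (volume : Measure ℝ)) (ν := (volume : Measure ℝ))
      (fun x => ‖r x‖ ^ 2) (fun y => hermiteFn k y * hermiteFn k y)
    rw [← Measure.volume_eq_prod, integral_hermiteFn_mul, if_pos rfl, mul_one] at h1
    refine le_of_eq (Eq.trans (integral_congr_ae ?_) h1)
    filter_upwards [(memLp_mul_hermiteFn r k).coeFn_toLp] with z hz
    simp only [LinearMap.coe_mk, AddHom.coe_mk]
    rw [hz, norm_mul, Complex.norm_real, Real.norm_eq_abs, mul_pow, sq_abs, sq (hermiteFn k z.2)])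

lemma coeFn_mulHermite (k : ℕ) (r : L2x) :
    mulHermite k r =ᵐ[volume] fun z => r z.1 * (hermiteFn k z.2 : ℂ) :=
  (memLp_mul_hermiteFn r k).coeFn_toLp

/-- The element of `L²(ℝ²)` represented by `hermiteSum N r`. -/
def hermiteSumL (N : ℕ) (r : ℕ → L2x) : L2xy := ∑ k ∈ Finset.range (N + 1), mulHermite k (r k)

lemma coeFn_hermiteSumL (N : ℕ) (r : ℕ → L2x) : hermiteSumL N r =ᵐ[volume] hermiteSum N r := by
  have h : ∀ᵐ z : ℝ × ℝ, ∀ k ∈ Finset.range (N + 1),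
      mulHermite k (r k) z = r k z.1 * (hermiteFn k z.2 : ℂ) :=
    (Filter.eventually_all_finset _).2 fun k _ => coeFn_mulHermite k (r k)
  filter_upwards [h, Lp.coeFn_finsetSum (Finset.range (N + 1)) (fun k => mulHermite k (r k))]
    with z h1 h2
  rw [hermiteSumL, h2, hermiteSum, Finset.sum_apply]
  exact Finset.sum_congr rfl fun k hk => h1 k hk

lemma IsTruncatedSolution.continuousOn_hermiteSumL {V : ℝ → ℝ} {e : ℕ → ℕ → ℝ → ℝ} {N : ℕ}
    {Rin : L2xy} {r : ℝ → ℕ → L2x} (hr : IsTruncatedSolution V e N Rin r) :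
    ContinuousOn (fun t => hermiteSumL N (r t)) (Ici 0) :=
  continuousOn_finsetSum _ fun k hk => (mulHermite k).continuous.comp_continuousOn
    (hr.continuousOn k (Nat.lt_succ_iff.1 (Finset.mem_range.1 hk)))

/-- Integration of a Hermite sum against a function of two variables. -/
lemma integral_hermiteSumL_mul (N : ℕ) (r : ℕ → L2x) {w : ℝ × ℝ → ℝ}
    (hw : MemLp (fun z => (w z : ℂ)) 2 volume)
    (hw' : ∀ l x, Integrable fun y => hermiteFn l y * w (x, y)) :
    ∫ z, hermiteSumL N r z * (w z : ℂ) = ∫ x, ∑ l ∈ Finset.range (N + 1),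
      r l x * ((∫ y, hermiteFn l y * w (x, y) : ℝ) : ℂ) := by
  have hi := integrable_mul_memLp (hermiteSumL N r) hw
  have e : (fun z => hermiteSumL N r z * (w z : ℂ)) =ᵐ[volume]
      fun z => hermiteSum N r z * (w z : ℂ) := by
    filter_upwards [coeFn_hermiteSumL N r] with z hz
    rw [hz]
  rw [integral_congr_ae e, integral_iterated (hi.congr e)]
  refine integral_congr_ae (Filter.Eventually.of_forall fun x => ?_)
  have e2 : ∀ y, hermiteSum N r (x, y) * (w (x, y) : ℂ) = ∑ l ∈ Finset.range (N + 1),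
      r l x * ((hermiteFn l y * w (x, y) : ℝ) : ℂ) := by
    intro y
    rw [hermiteSum, Finset.sum_mul]
    refine Finset.sum_congr rfl fun l _ => ?_
    push_cast
    ring
  simp only [e2]
  rw [integral_finsetSum _ fun l _ => ((hw' l x).ofReal).const_mul _]
  refine Finset.sum_congr rfl fun l _ => ?_
  rw [integral_const_mul, integral_complex_ofReal]

lemma integral_hermiteSumL_mul_tensor (N : ℕ) (r : ℕ → L2x) {f : ℝ → ℝ} (hf : Continuous f)
    (hf2 : Integrable fun x => f x ^ 2) (k : ℕ) :
    ∫ z, hermiteSumL N r z * ((f z.1 * hermiteFn k z.2 : ℝ) : ℂ) =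
      if k ≤ N then ∫ x, r k x * (f x : ℂ) else 0 := by
  have hΦ := isPolyGauss_hermiteFn
  rw [integral_hermiteSumL_mul N r
    (memLp_tensor hf (hΦ k).continuous hf2 (hΦ k).memLp.integrable_sq)
    (fun l x => (((hΦ l).integrable_mul (hΦ k)).const_mul (f x)).congr
      (Filter.Eventually.of_forall fun y => by ring))]
  have e : ∀ l x, ∫ y, hermiteFn l y * (f x * hermiteFn k y) = if l = k then f x else 0 := by
    intro l x
    have : ∀ y, hermiteFn l y * (f x * hermiteFn k y) =
        f x * (hermiteFn l y * hermiteFn k y) := fun y => by ring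
    simp only [this]
    rw [integral_const_mul, integral_hermiteFn_mul]
    split_ifs <;> simp
  simp only [e]
  split_ifs with h
  · refine integral_congr_ae (Filter.Eventually.of_forall fun x => ?_)
    simp only
    rw [Finset.sum_eq_single k]
    · simp
    · intro l _ hl; simp [hl]
    · intro hk; exact absurd (Finset.mem_range.2 (by omega)) hk
  · refine (integral_congr_ae (Filter.Eventually.of_forall fun x => ?_)).trans
      (integral_zero ℝ ℂ)
    refine Finset.sum_eq_zero fun l hl => ?_
    have : l ≠ k := by have := Finset.mem_range.1 hl; omega
    simp [this]

lemma QuadGrowth.integrable_snd {C : ℝ} {u : ℝ → ℝ → ℝ} (hu : QuadGrowth C u) (x : ℝ) {f : ℝ → ℝ}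
    (hf : IsGaussDom f) : Integrable fun y => u x y * f y := by
  obtain ⟨hfc, A, hA, hfA⟩ := hf
  have hc : Continuous fun y => u x y := hu.1.comp (by fun_prop : Continuous fun y : ℝ => (x, y))
  have hi : Integrable fun y : ℝ => Real.exp (-(1 / 4) * y ^ 2) :=
    integrable_exp_neg_mul_sq (by norm_num)
  have hC := hu.nonneg
  refine (hi.const_mul (C * (1 + x ^ 2) * (A * 8))).mono' (hc.mul hfc).aestronglyMeasurable
    (Filter.Eventually.of_forall fun y => ?_)
  rw [Real.norm_eq_abs, abs_mul]
  have h1 : |u x y| ≤ C * ((1 + x ^ 2) * (1 + y ^ 2)) := by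
    refine (hu.2 _ _).trans (mul_le_mul_of_nonneg_left ?_ hC)
    nlinarith [mul_nonneg (sq_nonneg x) (sq_nonneg y)]
  have h2 : (1 + y ^ 2) * |f y| ≤ A * (8 * Real.exp (-(1 / 4) * y ^ 2)) := by
    refine (mul_le_mul_of_nonneg_left (hfA y) (by positivity)).trans ?_
    have := mul_le_mul_of_nonneg_left (one_add_sq_mul_exp_le y) hA
    linarith
  calc |u x y| * |f y| ≤ C * ((1 + x ^ 2) * (1 + y ^ 2)) * |f y| :=
        mul_le_mul_of_nonneg_right h1 (abs_nonneg _)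
    _ = C * (1 + x ^ 2) * ((1 + y ^ 2) * |f y|) := by ring
    _ ≤ C * (1 + x ^ 2) * (A * (8 * Real.exp (-(1 / 4) * y ^ 2))) :=
        mul_le_mul_of_nonneg_left h2 (by positivity)
    _ = _ := by ring

/-- The operator `-∂ₓ∂_y + U` in the Hermite basis of the variable `y`. -/
lemma weylOp_hermiteFn (V : ℝ → ℝ) (U : ℝ → ℝ → ℝ) (f : ℝ → ℝ) (k : ℕ) (x y : ℝ) :
    weylOp U f (hermiteFn k) (x, y) =
      Real.sqrt ((k : ℝ) / 2) * (-deriv f x + deriv V x * f x) * hermiteFn (k - 1) y +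
      Real.sqrt (((k : ℝ) + 1) / 2) * (deriv f x + deriv V x * f x) * hermiteFn (k + 1) y +
      f x * ((U x y - limitPotential V x y) * hermiteFn k y) := by
  have h1 := mul_hermiteFn k y
  have h2 := deriv_hermiteFn k y
  simp only [weylOp, limitPotential]
  linear_combination (deriv V x * f x) * h1 - deriv f x * h2

section

variable {V : ℝ → ℝ} {U : ℝ → ℝ → ℝ} {C D : ℝ}

lemma QuadGrowth.integrable_mul_hermiteFn (hU : QuadGrowth C U) (x : ℝ) (k l : ℕ) :
    Integrable fun y => U x y * hermiteFn k y * hermiteFn l y :=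
  (hU.integrable_snd x ((isPolyGauss_hermiteFn k).isGaussDom_mul (isPolyGauss_hermiteFn l))).congr
    (Filter.Eventually.of_forall fun y => by simp only; ring)

lemma QuadGrowth.sub_integrable_mul_hermiteFn (hU : QuadGrowth C U)
    (hL : QuadGrowth D (limitPotential V)) (x : ℝ) (k l : ℕ) :
    Integrable fun y => (U x y - limitPotential V x y) * hermiteFn k y * hermiteFn l y :=
  ((hU.integrable_mul_hermiteFn x k l).sub (hL.integrable_mul_hermiteFn x k l)).congr
    (Filter.Eventually.of_forall fun y => by simp only [Pi.sub_apply]; ring)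

lemma integrable_hermiteFn_mul_weylOp (hU : QuadGrowth C U) (hL : QuadGrowth D (limitPotential V))
    (f : ℝ → ℝ) (k l : ℕ) (x : ℝ) :
    Integrable fun y => hermiteFn l y * weylOp U f (hermiteFn k) (x, y) := by
  have hΦ := isPolyGauss_hermiteFn
  refine (((((hΦ l).integrable_mul (hΦ (k - 1))).const_mul
    (Real.sqrt ((k : ℝ) / 2) * (-deriv f x + deriv V x * f x))).add
    (((hΦ l).integrable_mul (hΦ (k + 1))).const_mul
      (Real.sqrt (((k : ℝ) + 1) / 2) * (deriv f x + deriv V x * f x)))).add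
    ((hU.sub_integrable_mul_hermiteFn hL x k l).const_mul (f x))).congr
    (Filter.Eventually.of_forall fun y => ?_)
  simp only [Pi.add_apply]
  rw [weylOp_hermiteFn V]
  ring

lemma integral_hermiteFn_mul_weylOp (hU : QuadGrowth C U) (hL : QuadGrowth D (limitPotential V))
    (f : ℝ → ℝ) (k l : ℕ) (x : ℝ) :
    ∫ y, hermiteFn l y * weylOp U f (hermiteFn k) (x, y) =
      Real.sqrt ((k : ℝ) / 2) * (-deriv f x + deriv V x * f x) * (if l = k - 1 then 1 else 0) +
      Real.sqrt (((k : ℝ) + 1) / 2) * (deriv f x + deriv V x * f x) *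
        (if l = k + 1 then 1 else 0) +
      f x * ∫ y, (U x y - limitPotential V x y) * hermiteFn k y * hermiteFn l y := by
  have hΦ := isPolyGauss_hermiteFn
  have e : ∀ y, hermiteFn l y * weylOp U f (hermiteFn k) (x, y) =
      (Real.sqrt ((k : ℝ) / 2) * (-deriv f x + deriv V x * f x)) *
        (hermiteFn l y * hermiteFn (k - 1) y) +
      ((Real.sqrt (((k : ℝ) + 1) / 2) * (deriv f x + deriv V x * f x)) *
        (hermiteFn l y * hermiteFn (k + 1) y) +
      f x * ((U x y - limitPotential V x y) * hermiteFn k y * hermiteFn l y)) := by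
    intro y; rw [weylOp_hermiteFn V]; ring
  simp only [e]
  rw [integral_add_three (((hΦ l).integrable_mul (hΦ (k - 1))).const_mul _)
    (((hΦ l).integrable_mul (hΦ (k + 1))).const_mul _)
    ((hU.sub_integrable_mul_hermiteFn hL x k l).const_mul _), integral_const_mul,
    integral_const_mul, integral_const_mul, integral_hermiteFn_mul, integral_hermiteFn_mul,
    add_assoc]

/-- The action of a tridiagonal matrix plus a remainder on a truncated sequence. -/
lemma sum_range_mul_tridiagonal {N k : ℕ} (hk : k ≤ N) {a : ℕ → ℂ} (ha : a (N + 1) = 0)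
    (α β : ℂ) (γ : ℕ → ℂ) : ∑ l ∈ Finset.range (N + 1), a l *
      (α * (if l = k - 1 then 1 else 0) + β * (if l = k + 1 then 1 else 0) + γ l) =
      α * a (k - 1) + β * a (k + 1) + ∑ l ∈ Finset.range (N + 1), γ l * a l := by
  have h1 : ∑ l ∈ Finset.range (N + 1), a l * (if l = k - 1 then (1 : ℂ) else 0) = a (k - 1) := by
    have : k - 1 < N + 1 := by omega
    simp [this]
  have h2 : ∑ l ∈ Finset.range (N + 1), a l * (if l = k + 1 then (1 : ℂ) else 0) = a (k + 1) := by
    -- For `k = N` the index `k + 1` lies outside the range, and `a (N + 1) = 0` closes the system.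
    rcases Nat.lt_or_ge k N with h | h
    · simp [h]
    · obtain rfl : k = N := le_antisymm hk h
      simp [ha]
  rw [← h1, ← h2, Finset.mul_sum, Finset.mul_sum, ← Finset.sum_add_distrib,
    ← Finset.sum_add_distrib]
  exact Finset.sum_congr rfl fun l _ => by ring

/-- The truncated system is the weak form of the Weyl equation, tested with the first Hermite
functions in `y`. -/
lemma IsTruncatedSolution.hasDerivWithinAt_tensor {e : ℕ → ℕ → ℝ → ℝ} {N : ℕ} {Rin : L2xy}
    {r : ℝ → ℕ → L2x} (hr : IsTruncatedSolution V e N Rin r) (hU : QuadGrowth C U)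
    (hL : QuadGrowth D (limitPotential V))
    (he : ∀ k l x, e k l x =
      ∫ y, (U x y - limitPotential V x y) * hermiteFn k y * hermiteFn l y)
    {f : ℝ → ℝ} (hf : IsPolyGauss f) {k : ℕ} (hk : k ≤ N) {t : ℝ} (ht : 0 ≤ t) :
    HasDerivWithinAt (fun s => ∫ z, hermiteSumL N (r s) z * ((f z.1 * hermiteFn k z.2 : ℝ) : ℂ))
      (-Complex.I * ∫ z, hermiteSumL N (r t) z * (weylOp U f (hermiteFn k) z : ℂ))
      (Ici 0) t := by
  have hΦ := isPolyGauss_hermiteFn k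
  obtain ⟨f', hfc, hf'⟩ := hf.exists_approx
  have hmain : ∀ n t, 0 ≤ t → HasDerivWithinAt
      (fun s => ∫ z, hermiteSumL N (r s) z * ((f' n z.1 * hermiteFn k z.2 : ℝ) : ℂ))
      (-Complex.I * ∫ z, hermiteSumL N (r t) z * (weylOp U (f' n) (hermiteFn k) z : ℂ))
      (Ici 0) t := by
    intro n t ht
    have hg0 : IsGaussDom (f' n) := by
      obtain ⟨A, hA, h⟩ := (hf'.2 0).1
      exact ⟨(hf'.1 n).continuous, A, hA, by simpa using h n⟩
    have hg1 : IsGaussDom (deriv (f' n)) := by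
      obtain ⟨A, hA, h⟩ := (hf'.2 1).1
      exact ⟨(hf'.1 n).continuous_deriv (by exact_mod_cast le_top), A, hA,
        by simpa [iteratedDeriv_one] using h n⟩
    have hsq : Integrable fun x => f' n x ^ 2 := by
      simp only [sq]
      exact (hg0.1.mul hg0.1).integrable_of_hasCompactSupport (hfc n).mul_right
    have h := hr.weak_eq k hk _ (isTest_ofReal (hf'.1 n) (hfc n)) t ht
    have hw : ∀ s, ∫ z, hermiteSumL N (r s) z * ((f' n z.1 * hermiteFn k z.2 : ℝ) : ℂ) =
        ∫ x, r s k x * (f' n x : ℂ) := fun s => by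
      rw [integral_hermiteSumL_mul_tensor N (r s) hg0.1 hsq, if_pos hk]
    simp only [hw]
    refine h.congr_deriv ?_
    rw [integral_hermiteSumL_mul N (r t)
      (memLp_weylOp hU hg0 hg1 hΦ.isGaussDom hΦ.deriv.isGaussDom)
      (fun l x => integrable_hermiteFn_mul_weylOp hU hL _ k l x), ← integral_const_mul]
    have hz : ∀ᵐ x : ℝ, r t (N + 1) x = 0 := by
      rw [hr.truncated t ht (N + 1) N.lt_succ_self]
      exact Lp.coeFn_zero ℂ 2 volume
    refine integral_congr_ae ?_
    -- Integrating out `y` turns `weylOp` into the tridiagonal coupling by `𝓓*` and `𝓓`, acting on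
    -- the test function, plus the remainder matrix.
    filter_upwards [hz] with x hx
    have hd : deriv (fun x => (f' n x : ℂ)) x = ((deriv (f' n) x : ℝ) : ℂ) :=
      ((((hf'.1 n).differentiable (by simp)) x).hasDerivAt.ofReal_comp).deriv
    have h1 := sum_range_mul_tridiagonal hk (a := fun l => r t l x) hx
      (Real.sqrt ((k : ℝ) / 2) * (-deriv (f' n) x + deriv V x * f' n x) : ℝ)
      (Real.sqrt (((k : ℝ) + 1) / 2) * (deriv (f' n) x + deriv V x * f' n x) : ℝ)
      (fun l => (f' n x : ℂ) * (e k l x : ℂ))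
    have h2 : ∀ l, ((∫ y, hermiteFn l y * weylOp U (f' n) (hermiteFn k) (x, y) : ℝ) : ℂ) =
        (Real.sqrt ((k : ℝ) / 2) * (-deriv (f' n) x + deriv V x * f' n x) : ℝ) *
          (if l = k - 1 then 1 else 0) +
        (Real.sqrt (((k : ℝ) + 1) / 2) * (deriv (f' n) x + deriv V x * f' n x) : ℝ) *
          (if l = k + 1 then 1 else 0) + (f' n x : ℂ) * (e k l x : ℂ) := by
      intro l
      rw [integral_hermiteFn_mul_weylOp hU hL, ← he]
      split_ifs <;> push_cast <;> ring
    have h3 : ∑ l ∈ Finset.range (N + 1), (e k l x : ℂ) * r t l x * (f' n x : ℂ) =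
        ∑ l ∈ Finset.range (N + 1), (f' n x : ℂ) * (e k l x : ℂ) * r t l x :=
      Finset.sum_congr rfl fun l _ => by ring
    simp only [h2]
    rw [h1, h3, opD, opDStar, hd]
    push_cast
    ring
  exact hasDerivWithinAt_tensor_of_approx hU hr.continuousOn_hermiteSumL hf'
    hΦ.gaussApprox_const hmain ht

end

lemma coef_hermiteSumL (N : ℕ) (r : ℕ → L2x) (i : ℕ × ℕ) : coef (hermiteSumL N r) i =
    if i.2 ≤ N then ∫ x, r i.2 x * (hermiteFn i.1 x : ℂ) else 0 :=
  integral_hermiteSumL_mul_tensor N r (isPolyGauss_hermiteFn i.1).continuous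
    (isPolyGauss_hermiteFn i.1).memLp.integrable_sq i.2

lemma integral_hermiteCoeff_mul (u : L2xy) (i : ℕ × ℕ) :
    ∫ x, hermiteCoeff u i.2 x * (hermiteFn i.1 x : ℂ) = coef u i := by
  rw [coef, integral_iterated (integrable_mul_memLp u (memLp_herm i))]
  refine integral_congr_ae (Filter.Eventually.of_forall fun x => ?_)
  simp only [hermiteCoeff, herm]
  rw [← integral_mul_const]
  congr 1; ext y; push_cast; ring

lemma IsTruncatedSolution.coef_initial {V : ℝ → ℝ} {e : ℕ → ℕ → ℝ → ℝ} {N : ℕ} {Rin : L2xy}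
    {r : ℝ → ℕ → L2x} (hr : IsTruncatedSolution V e N Rin r) {i : ℕ × ℕ} (hi : i.2 ≤ N) :
    coef (hermiteSumL N (r 0)) i = coef Rin i := by
  rw [coef_hermiteSumL, if_pos hi, ← integral_hermiteCoeff_mul]
  refine integral_congr_ae ?_
  filter_upwards [hr.initial i.2 hi] with x hx
  rw [hx]

/-! ### Decay of the Hermite coefficients of the initial data -/

/-- Weighted bounds for the pure derivatives in the first variable, which are tested against
tensor products. -/
def SobolevFst (m : ℕ) (M : ℝ≥0) (F : L2xy) : Prop :=
  ∀ b ≤ m, ∃ G : L2xy, (∀ f g : ℝ → ℝ, IsPolyGauss f → IsPolyGauss g →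
    ∫ z, F z * ((iteratedDeriv b f z.1 * g z.2 : ℝ) : ℂ) =
      (-1 : ℂ) ^ b * ∫ z, G z * ((f z.1 * g z.2 : ℝ) : ℂ)) ∧
    ∀ a, a + b ≤ m → eLpNorm (fun z : ℝ × ℝ => (z.1 : ℂ) ^ a * G z) 2 volume ≤ M

lemma WeightedSobolevBound.sobolevFst {m : ℕ} {M : ℝ≥0} {F : L2xy}
    (h : WeightedSobolevBound m M F) : SobolevFst m M F := by
  intro b hb
  obtain ⟨G, hG, hGM⟩ := h b 0 (by omega)
  refine ⟨G, fun f g hf hg => ?_, fun a ha => ?_⟩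
  · simpa using hG.integral_tensor hf hg
  · simpa using hGM a 0 (by omega)

lemma measurePreserving_swap_real :
    MeasurePreserving (Prod.swap : ℝ × ℝ → ℝ × ℝ) volume volume :=
  Measure.measurePreserving_swap (μ := (volume : Measure ℝ)) (ν := (volume : Measure ℝ))

/-- The exchange of the two variables. -/
def swapL (u : L2xy) : L2xy :=
  Lp.compMeasurePreserving Prod.swap measurePreserving_swap_real u

lemma coeFn_swapL (u : L2xy) : swapL u =ᵐ[volume] fun z => u z.swap :=
  Lp.coeFn_compMeasurePreserving u measurePreserving_swap_real

lemma integral_swapL_mul (u : L2xy) (w : ℝ × ℝ → ℂ) :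
    ∫ z, swapL u z * w z = ∫ z, u z * w z.swap := by
  have h := measurePreserving_swap_real.integral_comp' (f := MeasurableEquiv.prodComm)
    (fun z => u z * w z.swap)
  refine Eq.trans (integral_congr_ae ?_) h
  filter_upwards [coeFn_swapL u] with z hz
  rw [hz]
  rfl

lemma WeightedSobolevBound.sobolevFst_swapL {m : ℕ} {M : ℝ≥0} {F : L2xy}
    (h : WeightedSobolevBound m M F) : SobolevFst m M (swapL F) := by
  intro b hb
  obtain ⟨G, hG, hGM⟩ := h 0 b (by omega)
  refine ⟨swapL G, fun f g hf hg => ?_, fun a ha => ?_⟩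
  · rw [integral_swapL_mul, integral_swapL_mul]
    have := hG.integral_tensor hg hf
    simpa [mul_comm] using this
  · have h1 := hGM 0 a (by omega)
    refine le_trans (le_of_eq ?_) h1
    have h2 : AEStronglyMeasurable (fun z : ℝ × ℝ => (z.2 : ℂ) ^ a * G z) volume :=
      (Continuous.aestronglyMeasurable (by fun_prop)).mul (Lp.aestronglyMeasurable G)
    have h3 := eLpNorm_comp_measurePreserving (p := 2) h2 measurePreserving_swap_real
    simp only [pow_zero, one_mul]
    rw [← h3]
    refine eLpNorm_congr_ae ?_
    filter_upwards [coeFn_swapL G] with z hz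
    rw [hz]
    rfl

lemma integrable_mul_tensor (u : L2xy) {f g : ℝ → ℝ} (hf : IsPolyGauss f) (hg : IsPolyGauss g) :
    Integrable fun z => u z * ((f z.1 * g z.2 : ℝ) : ℂ) :=
  integrable_mul_memLp u (hf.memLp_prod hg)

/-- Here `G` and `G'` play the roles of `∂ₓ^b F` and `∂ₓ^{b+1} F`. The mode `i` is written as the
annihilation `x + ∂` of `up1 i`, and the derivative is moved onto `x^a G`. The product rule gives
the last two terms. -/
lemma two_mul_ladder_mul_integral {F G G' : L2xy} {b : ℕ}
    (hG : ∀ f g : ℝ → ℝ, IsPolyGauss f → IsPolyGauss g →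
      ∫ z, F z * ((iteratedDeriv b f z.1 * g z.2 : ℝ) : ℂ) =
        (-1 : ℂ) ^ b * ∫ z, G z * ((f z.1 * g z.2 : ℝ) : ℂ))
    (hG' : ∀ f g : ℝ → ℝ, IsPolyGauss f → IsPolyGauss g →
      ∫ z, F z * ((iteratedDeriv (b + 1) f z.1 * g z.2 : ℝ) : ℂ) =
        (-1 : ℂ) ^ (b + 1) * ∫ z, G' z * ((f z.1 * g z.2 : ℝ) : ℂ)) (a : ℕ) (i : ℕ × ℕ) :
    (2 * ladder i.1 : ℝ) * ∫ z, G z * ((z.1 ^ a * herm i z : ℝ) : ℂ) =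
      (∫ z, G z * ((z.1 ^ (a + 1) * herm (up1 i) z : ℝ) : ℂ)) -
      (∫ z, G' z * ((z.1 ^ a * herm (up1 i) z : ℝ) : ℂ)) -
      a * ∫ z, G z * ((z.1 ^ (a - 1) * herm (up1 i) z : ℝ) : ℂ) := by
  have hΦ := isPolyGauss_hermiteFn
  set φ := hermiteFn (i.1 + 1) with hφ
  set ψ := hermiteFn i.2 with hψ
  have hφP : IsPolyGauss φ := hΦ _
  have hψP : IsPolyGauss ψ := hΦ _
  have hf := hφP.pow_mul a
  have hd : ∀ x, deriv (fun x => x ^ a * φ x) x = a * (x ^ (a - 1) * φ x) + x ^ a * deriv φ x := by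
    intro x
    refine (((hasDerivAt_pow a x).mul (hφP.differentiable x).hasDerivAt).deriv).trans ?_
    ring
  have h1 : ∫ z, G z * ((deriv (fun x => x ^ a * φ x) z.1 * ψ z.2 : ℝ) : ℂ) =
      -∫ z, G' z * ((z.1 ^ a * φ z.1 * ψ z.2 : ℝ) : ℂ) := by
    have e1 := hG _ _ hf.deriv hψP
    have e2 := hG' _ _ hf hψP
    rw [← iteratedDeriv_succ', e2, pow_succ] at e1
    have : ((-1 : ℂ) ^ b) ≠ 0 := pow_ne_zero _ (by norm_num)
    refine mul_left_cancel₀ this ?_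
    rw [← e1]
    ring
  have h2 : ∫ z, G z * ((deriv (fun x => x ^ a * φ x) z.1 * ψ z.2 : ℝ) : ℂ) =
      a * (∫ z, G z * ((z.1 ^ (a - 1) * φ z.1 * ψ z.2 : ℝ) : ℂ)) +
      ∫ z, G z * ((z.1 ^ a * deriv φ z.1 * ψ z.2 : ℝ) : ℂ) := by
    rw [← integral_const_mul, ← integral_add
      ((integrable_mul_tensor G (hφP.pow_mul (a - 1)) hψP).const_mul _)
      (integrable_mul_tensor G (hφP.deriv.pow_mul a) hψP)]
    refine integral_congr_ae (Filter.Eventually.of_forall fun z => ?_)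
    simp only [hd]
    push_cast
    ring
  have h3 : (2 * ladder i.1 : ℝ) * ∫ z, G z * ((z.1 ^ a * herm i z : ℝ) : ℂ) =
      (∫ z, G z * ((z.1 ^ (a + 1) * φ z.1 * ψ z.2 : ℝ) : ℂ)) +
      ∫ z, G z * ((z.1 ^ a * deriv φ z.1 * ψ z.2 : ℝ) : ℂ) := by
    rw [← integral_const_mul, ← integral_add
      (integrable_mul_tensor G (hφP.pow_mul (a + 1)) hψP)
      (integrable_mul_tensor G (hφP.deriv.pow_mul a) hψP)]
    refine integral_congr_ae (Filter.Eventually.of_forall fun z => ?_)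
    have e : 2 * ladder i.1 * (z.1 ^ a * herm i z) =
        z.1 ^ (a + 1) * φ z.1 * ψ z.2 + z.1 ^ a * deriv φ z.1 * ψ z.2 := by
      have := annihilate_hermiteFn i.1 z.1
      rw [herm, ladder, pow_succ]
      linear_combination (-(z.1 ^ a * ψ z.2)) * this
    simp only
    rw [← mul_add, ← Complex.ofReal_add, ← e]
    push_cast
    ring
  rw [h3]
  rw [h1] at h2
  have e4 : ∀ (u : L2xy) (c : ℕ), ∫ z, u z * ((z.1 ^ c * herm (up1 i) z : ℝ) : ℂ) =
      ∫ z, u z * ((z.1 ^ c * φ z.1 * ψ z.2 : ℝ) : ℂ) := by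
    intro u c
    simp only [herm_up1, mul_assoc, hφ, hψ]
  rw [e4, e4, e4]
  linear_combination -h2

/-- Iterating `two_mul_ladder_mul_integral` trades each ladder factor for one unit of the total
order `a + b ≤ m`. A step multiplies the norm bound by at most `1 + 1 + a ≤ m + 2`. The induction
runs over all weighted derivatives at once, because a step changes both `a` and `b`. -/
lemma SobolevFst.exists_shift {m : ℕ} {M : ℝ≥0} {F : L2xy} (h : SobolevFst m M F) (n : ℕ) :
    n ≤ m → ∃ g : L2xy, ‖g‖ ≤ (m + 2) ^ n * M ∧
      ∀ i : ℕ × ℕ, ((∏ q ∈ Finset.range n, 2 * ladder (i.1 + q) : ℝ) : ℂ) * coef F i =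
        coef g (i.1 + n, i.2) := by
  choose! G hG hGM using h
  have key : ∀ n a b, a + b + n ≤ m → ∃ g : L2xy, ‖g‖ ≤ (m + 2) ^ n * M ∧
      ∀ i : ℕ × ℕ, ((∏ q ∈ Finset.range n, 2 * ladder (i.1 + q) : ℝ) : ℂ) *
        ∫ z, G b z * ((z.1 ^ a * herm i z : ℝ) : ℂ) = coef g (i.1 + n, i.2) := by
    intro n
    induction n with
    | zero =>
      intro a b hab
      have hb : b ≤ m := by omega
      have hmem : MemLp (fun z : ℝ × ℝ => (z.1 : ℂ) ^ a * G b z) 2 volume :=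
        ⟨(Continuous.aestronglyMeasurable (by fun_prop)).mul (Lp.aestronglyMeasurable _),
          (hGM b hb a (by omega)).trans_lt ENNReal.coe_lt_top⟩
      refine ⟨hmem.toLp _, ?_, fun i => ?_⟩
      · rw [Lp.norm_toLp, pow_zero, one_mul]
        exact ENNReal.toReal_le_of_le_ofReal M.2 (by simpa using hGM b hb a (by omega))
      · simp only [Finset.range_zero, Finset.prod_empty, Complex.ofReal_one, one_mul, add_zero]
        refine integral_congr_ae ?_
        filter_upwards [hmem.coeFn_toLp] with z hz
        rw [hz]
        push_cast
        ring
    | succ n ih =>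
      intro a b hab
      obtain ⟨g₁, hg₁, h₁⟩ := ih (a + 1) b (by omega)
      obtain ⟨g₂, hg₂, h₂⟩ := ih a (b + 1) (by omega)
      obtain ⟨g₃, hg₃, h₃⟩ := ih (a - 1) b (by omega)
      refine ⟨g₁ - g₂ - (a : ℂ) • g₃, ?_, fun i => ?_⟩
      · refine (norm_sub_le _ _).trans ?_
        have e1 := norm_sub_le g₁ g₂
        rw [norm_smul, Complex.norm_natCast, pow_succ]
        have e2 : (a : ℝ) * ‖g₃‖ ≤ m * ((m + 2) ^ n * M) :=
          mul_le_mul (by exact_mod_cast (by omega : a ≤ m)) hg₃ (norm_nonneg _) (by positivity)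
        linarith
      · have e := two_mul_ladder_mul_integral (hG b (by omega)) (hG (b + 1) (by omega)) a i
        have e5 := h₁ (up1 i)
        have e6 := h₂ (up1 i)
        have e7 := h₃ (up1 i)
        have e8 : ((up1 i).1 + n, (up1 i).2) = (i.1 + (n + 1), i.2) :=
          Prod.ext (by change i.1 + 1 + n = i.1 + (n + 1); omega) rfl
        have e9 : ∀ q, (up1 i).1 + q = i.1 + (q + 1) := fun q => by
          change i.1 + 1 + q = i.1 + (q + 1); omega
        rw [e8] at e5 e6 e7
        simp only [e9] at e5 e6 e7
        rw [Finset.prod_range_succ', add_zero, Complex.ofReal_mul, mul_assoc, e]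
        simp only [coef_eq_inner, inner_sub_right, inner_smul_right] at e5 e6 e7 ⊢
        rw [← e5, ← e6, ← e7]
        ring
  intro hn
  obtain ⟨g, hg, hi⟩ := key n 0 0 (by omega)
  refine ⟨g, hg, fun i => ?_⟩
  rw [← hi]
  congr 1
  have := hG 0 (Nat.zero_le _) _ _ (isPolyGauss_hermiteFn i.1) (isPolyGauss_hermiteFn i.2)
  simpa [coef, herm] using this

/-- Bessel's inequality for the shifted function `g`: the shift is injective, and each squared
factor `2(i.1 + q + 1)` is at least `i.1 + 1`. -/
lemma SobolevFst.sum_le {m : ℕ} {M : ℝ≥0} {F : L2xy} (h : SobolevFst m M F)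
    (Q : Finset (ℕ × ℕ)) :
    ∑ i ∈ Q, ((i.1 : ℝ) + 1) ^ m * ‖coef F i‖ ^ 2 ≤ (((m : ℝ) + 2) ^ m * M) ^ 2 := by
  obtain ⟨g, hg, hi⟩ := h.exists_shift m le_rfl
  let e : ℕ × ℕ ↪ ℕ × ℕ := ⟨fun i => (i.1 + m, i.2), fun i j h => by
    simpa [Prod.ext_iff] using h⟩
  have h1 : ∀ i : ℕ × ℕ, ((i.1 : ℝ) + 1) ^ m * ‖coef F i‖ ^ 2 ≤ ‖coef g (e i)‖ ^ 2 := by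
    intro i
    rw [show e i = (i.1 + m, i.2) from rfl, ← hi, norm_mul, mul_pow, Complex.norm_real,
      Real.norm_eq_abs, sq_abs, ← Finset.prod_pow]
    refine mul_le_mul_of_nonneg_right ?_ (sq_nonneg _)
    rw [← Finset.card_range m, ← Finset.prod_const, Finset.card_range]
    refine Finset.prod_le_prod (fun q _ => by positivity) fun q _ => ?_
    rw [mul_pow, ladder_sq]
    push_cast
    linarith [q.cast_nonneg (α := ℝ), i.1.cast_nonneg (α := ℝ)]
  calc ∑ i ∈ Q, ((i.1 : ℝ) + 1) ^ m * ‖coef F i‖ ^ 2 ≤ ∑ i ∈ Q, ‖coef g (e i)‖ ^ 2 :=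
        Finset.sum_le_sum fun i _ => h1 i
    _ = ∑ i ∈ Q.map e, ‖coef g i‖ ^ 2 :=
        (Finset.sum_map Q e (fun i => ‖coef g i‖ ^ 2)).symm
    _ ≤ ‖g‖ ^ 2 := sum_norm_coef_sq_le g _
    _ ≤ _ := pow_le_pow_left₀ (norm_nonneg _) hg 2

lemma coef_swapL (u : L2xy) (i : ℕ × ℕ) : coef (swapL u) i = coef u i.swap := by
  rw [coef, integral_swapL_mul, coef]
  congr 1; ext z
  simp only [herm, Prod.fst_swap, Prod.snd_swap]
  push_cast
  ring

/-- If `λ` is large, one of the two indices is large, so decay in each index separately suffices.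
The second index is handled by exchanging the variables. -/
lemma WeightedSobolevBound.sum_lam_le {m : ℕ} {M : ℝ≥0} {F : L2xy}
    (h : WeightedSobolevBound m M F) (Q : Finset (ℕ × ℕ)) :
    ∑ i ∈ Q, lam i ^ m * ‖coef F i‖ ^ 2 ≤ 2 ^ (m + 1) * (((m : ℝ) + 2) ^ m * M) ^ 2 := by
  have h1 := h.sobolevFst.sum_le Q
  have h2 := h.sobolevFst_swapL.sum_le (Q.map (Equiv.prodComm ℕ ℕ).toEmbedding)
  rw [Finset.sum_map] at h2
  have hpt : ∀ i ∈ Q, lam i ^ m * ‖coef F i‖ ^ 2 ≤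
      2 ^ m * (((i.1 : ℝ) + 1) ^ m * ‖coef F i‖ ^ 2) +
      2 ^ m * (((i.2 : ℝ) + 1) ^ m * ‖coef F i‖ ^ 2) := by
    intro i _
    have e1 : lam i ^ m ≤ 2 ^ m * (((i.1 : ℝ) + 1) ^ m + ((i.2 : ℝ) + 1) ^ m) := by
      have e2 : lam i ≤ ((i.1 : ℝ) + 1) + ((i.2 : ℝ) + 1) := by rw [lam]; linarith
      refine (pow_le_pow_left₀ (lam_pos i).le e2 m).trans
        ((add_pow_le (by positivity) (by positivity) m).trans
        (mul_le_mul_of_nonneg_right ?_ (by positivity)))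
      exact pow_le_pow_right₀ one_le_two (Nat.sub_le _ _)
    have := mul_le_mul_of_nonneg_right e1 (sq_nonneg ‖coef F i‖)
    linarith
  refine (Finset.sum_le_sum hpt).trans ?_
  rw [Finset.sum_add_distrib, ← Finset.mul_sum, ← Finset.mul_sum, pow_succ, mul_assoc, two_mul,
    mul_add]
  refine add_le_add (mul_le_mul_of_nonneg_left h1 (by positivity))
    (mul_le_mul_of_nonneg_left ?_ (by positivity))
  refine le_trans (le_of_eq (Finset.sum_congr rfl fun i _ => ?_)) h2
  rw [coef_swapL]
  rfl

/-! ### The error estimate -/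

/-- The matrix bounds of the operator `-∂ₓ∂_y + U` that control the Galerkin approximations. -/
structure WeylMatBounds (p : ℕ) (K : ℝ) (U : ℝ → ℝ → ℝ) : Prop where
  bound : MatBound (weylMat U) (fun j => lam j ^ 2) K
  commutator : ∀ s ≤ p + 1, MatBound (fun i j => (lam i ^ s - lam j ^ s) * weylMat U i j)
      (fun j => lam j ^ (2 * s)) K

/-- Because `λL = [λ, L] + Lλ`. -/
lemma WeylMatBounds.lam_mul {p : ℕ} {K : ℝ} {U : ℝ → ℝ → ℝ} (h : WeylMatBounds p K U)
    (hK : 0 ≤ K) : MatBound (fun i j => lam i * weylMat U i j) (fun j => lam j ^ (2 * 2))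
      (2 * K + 2 * K) := by
  have hle : ∀ j : ℕ × ℕ, lam j ^ 2 ≤ lam j ^ (2 * 2) := fun j =>
    pow_le_pow_right₀ (one_le_lam j) (by norm_num)
  have h0 : ∀ j : ℕ × ℕ, 0 ≤ lam j ^ (2 * 2) := fun j => pow_nonneg (lam_pos j).le _
  have h1 := (h.commutator 1 (by omega)).mono hK le_rfl (w' := fun j => lam j ^ (2 * 2))
    (fun j => by simpa using hle j) h0
  have h2 := (h.bound.mul_right lam).mono hK le_rfl (w' := fun j => lam j ^ (2 * 2))
    (fun j => le_of_eq (by ring)) h0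
  have h3 := h1.add h2
  have e : (fun i j => lam i * weylMat U i j) =
      fun i j => (lam i ^ 1 - lam j ^ 1) * weylMat U i j + weylMat U i j * lam j := by
    funext i j; ring
  rwa [e]

/-- Weak solutions are limits of Galerkin approximations. -/
lemma tendsto_galerkin_coef {p : ℕ} (hp : 1 ≤ p) {K C : ℝ} (hK : 0 ≤ K) {U : ℝ → ℝ → ℝ}
    (hU : QuadGrowth C U) (hm : WeylMatBounds p K U) {S : Set (ℕ × ℕ)}
    {F : ℕ → Finset (ℕ × ℕ)} (hFS : ∀ n, ∀ i ∈ F n, i ∈ S)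
    (hF : ∀ n, ∀ i ∈ S, i ∉ F n → (n : ℝ) ≤ lam i) {ρ : ℝ → L2xy}
    (hρ : ContinuousOn ρ (Ici 0)) (hρ0 : ∀ t, 0 ≤ t → ∀ i ∉ S, coef (ρ t) i = 0)
    (hd : ∀ i ∈ S, ∀ t, 0 ≤ t → HasDerivWithinAt (fun s => coef (ρ s) i)
      (-Complex.I * ∫ z, ρ t z * (weylOp U (hermiteFn i.1) (hermiteFn i.2) z : ℂ)) (Ici 0) t)
    {v : ℕ → ℝ → ℕ × ℕ → ℂ} (hv : ∀ n, IsGalerkin (weylMat U) (F n) (v n))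
    (hv0 : ∀ n, ∀ i ∈ F n, v n 0 i = coef (ρ 0) i) {T : ℝ} (hT : 0 ≤ T) {i : ℕ × ℕ} (hi : i ∈ S) :
    Filter.Tendsto (fun n => v n T i) Filter.atTop (nhds (coef (ρ T) i)) := by
  obtain ⟨b, hb⟩ := isCompact_Icc.exists_bound_of_continuousOn
    (hρ.mono (fun s hs => hs.1 : Icc 0 T ⊆ Ici 0))
  -- The dual solution needs the weight `λ⁴`, that is the commutator with `λ²`. It is available
  -- because `p + 1 ≥ 2`.
  refine tendsto_galerkin (c := fun t => coef (ρ t)) (l := fun t i =>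
      ∫ z, ρ t z * (weylOp U (hermiteFn i.1) (hermiteFn i.2) z : ℂ)) (B := b ^ 2)
    (weylMat_comm U) hK (hm.lam_mul hK) (by positivity) (hm.commutator 2 (by omega)) hFS hF hρ0 hd
    (fun i _ t _ => ?_) hT (fun t ht Q => ?_) hv hv0 hi
  · have hΦ := isPolyGauss_hermiteFn
    have h := hasSum_coef (ρ t) (memLp_weylOp hU (hΦ i.1).isGaussDom (hΦ i.1).deriv.isGaussDom
      (hΦ i.2).isGaussDom (hΦ i.2).deriv.isGaussDom)
    simpa only [integral_weylOp_mul_herm hU] using h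
  · exact (sum_norm_coef_sq_le _ Q).trans (pow_le_pow_left₀ (norm_nonneg _) (hb t ht) 2)

/-- The indices of the Galerkin approximations. -/
def box (n : ℕ) : Finset (ℕ × ℕ) := Finset.range n ×ˢ Finset.range n

lemma le_lam_of_notMem_box {n : ℕ} {i : ℕ × ℕ} (h : i ∉ box n) : (n : ℝ) ≤ lam i := by
  simp only [box, Finset.mem_product, Finset.mem_range, not_and_or, not_lt] at h
  have h1 : (0 : ℝ) ≤ i.1 := Nat.cast_nonneg _
  have h2 : (0 : ℝ) ≤ i.2 := Nat.cast_nonneg _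
  rw [lam]
  rcases h with h | h
  · have : (n : ℝ) ≤ i.1 := by exact_mod_cast h
    linarith
  · have : (n : ℝ) ≤ i.2 := by exact_mod_cast h
    linarith

lemma eventually_subset_box (Q : Finset (ℕ × ℕ)) : ∀ᶠ n in Filter.atTop, Q ⊆ box n := by
  have h : ∀ᶠ n in Filter.atTop, ∀ i ∈ Q, i ∈ box n := by
    refine (Filter.eventually_all_finset Q).2 fun i _ => ?_
    filter_upwards [Filter.eventually_gt_atTop i.1, Filter.eventually_gt_atTop i.2] with n h1 h2
    exact Finset.mem_product.2 ⟨Finset.mem_range.2 h1, Finset.mem_range.2 h2⟩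
  exact h

/-- `galerkin_compare` bounds the error between the Galerkin flows on `box n` and on its part `k ≤
N`, uniformly in `n`. These flows converge mode by mode to `R` and to the truncated solution, and
the bound survives on every finite set of modes. -/
lemma norm_hermiteSumL_sub_sq_le {p : ℕ} (hp : 1 ≤ p) {K C D : ℝ} (hK : 0 ≤ K) {V : ℝ → ℝ}
    {U : ℝ → ℝ → ℝ} (hU : QuadGrowth C U) (hL : QuadGrowth D (limitPotential V))
    (hm : WeylMatBounds p K U) {e : ℕ → ℕ → ℝ → ℝ} (he : ∀ k l x, e k l x =
      ∫ y, (U x y - limitPotential V x y) * hermiteFn k y * hermiteFn l y)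
    {Rin : L2xy} {R : ℝ → L2xy} (hR : IsWeylSolution U Rin R) {N : ℕ} {r : ℝ → ℕ → L2x}
    (hr : IsTruncatedSolution V e N Rin r) {B : ℝ}
    (hB : ∀ Q : Finset (ℕ × ℕ), ∑ i ∈ Q, lam i ^ (2 * (p + 1)) * ‖coef Rin i‖ ^ 2 ≤ B)
    {t : ℝ} (ht : 0 ≤ t) :
    ‖hermiteSumL N (r t) - R t‖ ^ 2 ≤
      Real.exp ((2 + K) * t) * (B * (1 + K * t)) / ((N : ℝ) + 2) ^ (2 * p) := by
  have hΦ := isPolyGauss_hermiteFn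
  set F : ℕ → Finset (ℕ × ℕ) := fun n => (box n).filter fun i => i.2 ≤ N with hFdef
  choose v hv hv0 using fun n => exists_isGalerkin (weylMat U) (box n) (coef Rin)
  choose w hw hw0 using fun n => exists_isGalerkin (weylMat U) (F n) (coef Rin)
  have hvlim : ∀ i, Filter.Tendsto (fun n => v n t i) Filter.atTop (nhds (coef (R t) i)) := by
    intro i
    refine tendsto_galerkin_coef hp hK hU hm (S := univ) (fun n i _ => mem_univ i)
      (fun n i _ hi => le_lam_of_notMem_box hi) hR.continuousOn
      (fun t _ i hi => absurd (mem_univ i) hi)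
      (fun i _ t ht => hR.hasDerivWithinAt_tensor hU (hΦ i.1) (hΦ i.2) ht) hv (fun n i hi => ?_) ht
      (mem_univ i)
    rw [hv0 n i hi, hR.initial]
  have hwlim : ∀ i : ℕ × ℕ, i.2 ≤ N → Filter.Tendsto (fun n => w n t i) Filter.atTop
      (nhds (coef (hermiteSumL N (r t)) i)) := by
    intro i hi
    refine tendsto_galerkin_coef hp hK hU hm (S := {i | i.2 ≤ N})
      (ρ := fun t => hermiteSumL N (r t)) (fun n i hi => (Finset.mem_filter.1 hi).2)
      (fun n i hi hi' => le_lam_of_notMem_box fun hb => hi' (Finset.mem_filter.2 ⟨hb, hi⟩))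
      hr.continuousOn_hermiteSumL (fun t _ i hi => ?_)
      (fun i hi t ht => hr.hasDerivWithinAt_tensor hU hL he (hΦ i.1) hi ht) hw
      (fun n i hi => ?_) ht hi
    · rw [coef_hermiteSumL]
      exact if_neg hi
    · rw [hw0 n i hi, hr.coef_initial (Finset.mem_filter.1 hi).2]
  refine norm_sq_le_of_sum_coef_le fun Q => ?_
  -- For `k > N` the truncated solution has no component, so the error there is the tail of `R`.
  set d : ℕ → ℕ × ℕ → ℂ := fun n i => if i.2 ≤ N then w n t i - v n t i else -v n t i with hd
  have hdlim : ∀ i, Filter.Tendsto (fun n => d n i) Filter.atTop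
      (nhds (coef (hermiteSumL N (r t) - R t) i)) := by
    intro i
    have e1 : coef (hermiteSumL N (r t) - R t) i =
        coef (hermiteSumL N (r t)) i - coef (R t) i := by
      simp only [coef_eq_inner, inner_sub_right]
    rw [e1]
    by_cases hi : i.2 ≤ N
    · simp only [hd, if_pos hi]
      exact (hwlim i hi).sub (hvlim i)
    · simp only [hd, if_neg hi]
      rw [coef_hermiteSumL, if_neg hi, zero_sub]
      exact (hvlim i).neg
  refine le_of_tendsto (tendsto_finsetSum Q fun i _ => (hdlim i).norm.pow 2) ?_
  filter_upwards [eventually_subset_box Q] with n hn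
  refine (Finset.sum_le_sum_of_subset_of_nonneg hn fun i _ _ => sq_nonneg _).trans ?_
  -- A discarded mode has `k ≥ N + 1`, hence `λ ≥ N + 2`.
  have hcmp := galerkin_compare (weylMat_comm U) hK hm.bound (hm.commutator (p + 1) le_rfl)
    (Finset.filter_subset (fun i : ℕ × ℕ => i.2 ≤ N) (box n)) (Λ := (N : ℝ) + 2)
    (by linarith [N.cast_nonneg (α := ℝ)]) (fun i hi hi' => ?_) (hv n) (hw n)
    (fun i hi => by rw [hw0 n i hi, hv0 n i (Finset.filter_subset _ _ hi)]) (B := B) ?_ ht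
  · refine le_trans (le_of_eq ?_) hcmp
    rw [← Finset.sum_filter_add_sum_filter_not (box n) (fun i : ℕ × ℕ => i.2 ≤ N)]
    congr 1
    · refine Finset.sum_congr rfl fun i hi => ?_
      simp only [hd, if_pos (Finset.mem_filter.1 hi).2]
    · refine Finset.sum_congr (Finset.filter_congr fun i hi => ?_) fun i hi => ?_
      · simp only [Finset.mem_filter, hi, true_and]
      · have h2 : ¬ i.2 ≤ N := fun h => (Finset.mem_filter.1 hi).2
          (Finset.mem_filter.2 ⟨(Finset.mem_filter.1 hi).1, h⟩)
        simp only [hd, if_neg h2, norm_neg]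
  · have h2 : ¬ i.2 ≤ N := fun h => hi' (Finset.mem_filter.2 ⟨hi, h⟩)
    have h3 : (N : ℝ) + 1 ≤ i.2 := by exact_mod_cast (by omega : N + 1 ≤ i.2)
    rw [lam]
    linarith [i.1.cast_nonneg (α := ℝ)]
  · refine le_trans (le_of_eq (Finset.sum_congr rfl fun i hi => ?_)) (hB (box n))
    rw [hv0 n i hi]

/-- The error of the Hermite truncation is of order `(2N + 3)^{-(p - 1/2)}`, uniformly in the
potential. -/
lemma exists_norm_hermiteSumL_sub_le {p : ℕ} (hp : 1 ≤ p) (C : ℝ) (M : ℝ≥0) : ∃ c : ℝ → ℝ,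
    (∀ t, 0 ≤ c t) ∧ ∀ (U : ℝ → ℝ → ℝ) (V : ℝ → ℝ) (D : ℝ), IsPotential (2 * p + 1) C U →
    QuadGrowth D (limitPotential V) → ∀ e : ℕ → ℕ → ℝ → ℝ, (∀ k l x, e k l x =
      ∫ y, (U x y - limitPotential V x y) * hermiteFn k y * hermiteFn l y) →
    ∀ Rin : L2xy, WeightedSobolevBound (2 * (p + 1)) M Rin →
    ∀ R : ℝ → L2xy, IsWeylSolution U Rin R →
    ∀ (N : ℕ) (r : ℝ → ℕ → L2x), IsTruncatedSolution V e N Rin r → ∀ t : ℝ, 0 ≤ t →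
    ‖hermiteSumL N (r t) - R t‖ ≤ c t / (2 * (N : ℝ) + 3) ^ ((p : ℝ) - 1 / 2) := by
  obtain ⟨K, hK, hKU⟩ := exists_weylMat_bounds p C
  set B : ℝ := 2 ^ (2 * (p + 1) + 1) *
    ((((2 * (p + 1) : ℕ) : ℝ) + 2) ^ (2 * (p + 1)) * M) ^ 2 with hB
  set E : ℝ → ℝ := fun t => Real.sqrt (Real.exp ((2 + K) * t) * (B * (1 + K * t))) with hE
  -- The factor `2^p` comes from `2N + 3 ≤ 2(N + 2)`. Lowering the exponent from `p` to `p - 1/2`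
  -- costs nothing, as the base is at least 1.
  refine ⟨fun t => 2 ^ p * E t, fun t => by positivity,
    fun U V D hU hL e he Rin hRin R hR N r hr t ht => ?_⟩
  have h := norm_hermiteSumL_sub_sq_le hp hK hU.1 hL ⟨(hKU U hU).1, (hKU U hU).2⟩ he hR hr
    (fun Q => hRin.sum_lam_le Q) ht
  have hN : (0 : ℝ) ≤ N := Nat.cast_nonneg _
  have h1 : ‖hermiteSumL N (r t) - R t‖ ≤ E t / ((N : ℝ) + 2) ^ p := by
    have h2 : ‖hermiteSumL N (r t) - R t‖ ^ 2 ≤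
        Real.exp ((2 + K) * t) * (B * (1 + K * t)) / (((N : ℝ) + 2) ^ p) ^ 2 := by
      rw [← pow_mul, mul_comm p 2]
      exact h
    replace h2 := Real.le_sqrt_of_sq_le h2
    rwa [Real.sqrt_div' _ (sq_nonneg _), Real.sqrt_sq (by positivity)] at h2
  have hE0 : 0 ≤ E t := Real.sqrt_nonneg _
  refine h1.trans ?_
  rw [div_le_div_iff₀ (by positivity) (by positivity)]
  have h3 : (2 * (N : ℝ) + 3) ^ ((p : ℝ) - 1 / 2) ≤ (2 * (N : ℝ) + 3) ^ p := by
    rw [← Real.rpow_natCast]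
    exact Real.rpow_le_rpow_of_exponent_le (by linarith) (by linarith)
  have h4 : (2 * (N : ℝ) + 3) ^ p ≤ 2 ^ p * ((N : ℝ) + 2) ^ p := by
    rw [← mul_pow]
    exact pow_le_pow_left₀ (by positivity) (by linarith) p
  calc E t * (2 * (N : ℝ) + 3) ^ ((p : ℝ) - 1 / 2) ≤ E t * (2 ^ p * ((N : ℝ) + 2) ^ p) :=
        mul_le_mul_of_nonneg_left (h3.trans h4) hE0
    _ = 2 ^ p * E t * ((N : ℝ) + 2) ^ p := by ring

lemma eLpNorm_hermiteSum_sub (N : ℕ) (r : ℕ → L2x) (u : L2xy) :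
    eLpNorm (fun z => hermiteSum N r z - u z) 2 volume =
      ENNReal.ofReal ‖hermiteSumL N r - u‖ := by
  rw [Lp.norm_def, ENNReal.ofReal_toReal (Lp.eLpNorm_ne_top _)]
  refine eLpNorm_congr_ae ?_
  filter_upwards [Lp.coeFn_sub (hermiteSumL N r) u, coeFn_hermiteSumL N r] with z h1 h2
  rw [h1, Pi.sub_apply, h2]

lemma eLpNorm_sub_hermiteSum (N : ℕ) (r : ℕ → L2x) (u : L2xy) :
    eLpNorm (fun z => u z - hermiteSum N r z) 2 volume =
      ENNReal.ofReal ‖hermiteSumL N r - u‖ := by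
  rw [← eLpNorm_hermiteSum_sub, ← eLpNorm_neg]
  congr 1; ext z
  simp

end WeylHermite

end

/-! ### The error estimates for the von Neumann equation and for its limit -/

theorem theorem2p1 (p : ℕ) (hp : 1 ≤ p) (V : ℝ → ℝ)
    (hV : WeylHermite.IsAdmissiblePotential (2 * (p + 1)) V) :
    (∀ (hbar₀ : ℝ) (M : ℝ≥0), ∃ C : ℝ → ℝ,
      ∀ (hbar : ℝ), 0 < hbar → hbar ≤ hbar₀ →
      ∀ Rin : WeylHermite.L2xy, WeylHermite.WeightedSobolevBound (2 * (p + 1)) M Rin →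
      ∀ R : ℝ → WeylHermite.L2xy, WeylHermite.IsVonNeumannSolution V hbar Rin R →
      ∀ (N : ℕ) (RN : ℝ → ℕ → WeylHermite.L2x),
        WeylHermite.IsTruncatedVonNeumannSolution V hbar N Rin RN →
      ∀ t : ℝ, 0 ≤ t →
        eLpNorm (fun z => WeylHermite.hermiteSum N (RN t) z - R t z) 2 volume ≤
          ENNReal.ofReal
            (C t / (2 * (N : ℝ) + 3) ^ ((p : ℝ) - 1 / 2) * (1 + hbar ^ 2))) ∧
    (∀ M : ℝ≥0, ∃ C : ℝ → ℝ,
      ∀ Rin : WeylHermite.L2xy, WeylHermite.WeightedSobolevBound (2 * (p + 1)) M Rin →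
      ∀ R : ℝ → WeylHermite.L2xy, WeylHermite.IsLimitSolution V Rin R →
      ∀ (N : ℕ) (RN : ℝ → ℕ → WeylHermite.L2x),
        WeylHermite.IsTruncatedLimitSolution V N Rin RN →
      ∀ t : ℝ, 0 ≤ t →
        eLpNorm (fun z => R t z - WeylHermite.hermiteSum N (RN t) z) 2 volume ≤
          ENNReal.ofReal (C t / (2 * (N : ℝ) + 3) ^ ((p : ℝ) - 1 / 2))) := by
  obtain ⟨D, hD⟩ := hV.isPotential_limit
  refine ⟨fun hbar₀ M => ?_, fun M => ?_⟩
  · obtain ⟨C, hC⟩ := hV.isPotential_weyl hbar₀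
    obtain ⟨c, hc0, hc⟩ := WeylHermite.exists_norm_hermiteSumL_sub_le hp C M
    refine ⟨c, fun hbar h0 h1 Rin hRin R hR N RN hRN t ht => ?_⟩
    rw [WeylHermite.eLpNorm_hermiteSum_sub]
    refine ENNReal.ofReal_le_ofReal ((hc _ V D (hC hbar h0 h1) hD.1 _ (fun k l x => rfl) Rin hRin R
      hR N RN hRN t ht).trans ?_)
    have := hc0 t
    -- The constant from `isPotential_weyl` is already uniform for `ħ ≤ ħ₀`, so the factor `1 + ħ² ≥
    -- 1` only weakens the bound.
    exact le_mul_of_one_le_right (by positivity) (by nlinarith [sq_nonneg hbar])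
  · obtain ⟨c, hc0, hc⟩ := WeylHermite.exists_norm_hermiteSumL_sub_le hp D M
    refine ⟨c, fun Rin hRin R hR N RN hRN t ht => ?_⟩
    rw [WeylHermite.eLpNorm_sub_hermiteSum]
    exact ENNReal.ofReal_le_ofReal (hc _ V D hD hD.1 _ (fun k l x => by simp) Rin hRin R
      hR N RN hRN t ht)
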